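/- Let $\mathcal M=\mathbb R$ or $\mathcal M=\mathbb T=\mathbb R/\mathbb Z$, let $\widehat{\mathcal M}=\mathbb R$ or $\mathbb Z$ (with Lebesgue, respectively counting measure) be its dual, and let $k\ge 2$ be an integer. Consider the generalized improved Boussinesq equation $$\partial_t^2u-\partial_x^2u-\partial_t^2\partial_x^2u=\partial_x^2(u^k),\qquad (u,\partial_tu)|_{t=0}=(u_0,u_1),\tag{1}$$ for complex-valued functions $u$ of time $t$ and of $x\in\mathcal M$. Let $\widehat f(\xi)=\int_{\mathcal M} e^{-2\pi i x\xi}f(x)\,dx$ for $\xi\in\widehat{\mathcal M}$, extended to (tempered) distributions, and $\langle\xi\rangle=(1+|\xi|^2)^{1/2}$. Fix a smooth $\rho:\mathbb R\to[0,1]$ with $\rho(\xi)=1$ for $|\xi|\le\frac12$ and $\rho(\xi)=0$ for $|\xi|\ge1$; put $\sigma_n(\xi)=\rho(\xi-n)/\sum_{l\in\mathbb Z}\rho(\xi-l)$ and $\widehat{P_nf}=\sigma_n\widehat f$ for $n\in\mathbb Z$. For $s\in\mathbb R$ and $1\le q\le\infty$, let $\mathcal F L^{s,q}(\mathcal M)$,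 $M^{2,q}_s(\mathbb R)$ and $W^{2,q}_s(\mathbb R)$ be the completions of the Schwartz functions (on $\mathbb T$: of $C^\infty(\mathbb T)$), realized as spaces of (tempered) distributions, for the norms $$\|f\|_{\mathcal F L^{s,q}}=\|\langle\xi\rangle^s\widehat f(\xi)\|_{L^q_\xi(\widehat{\mathcal M})},\qquad \|f\|_{M^{2,q}_s}=\big\|(1+|n|)^s\|P_nf\|_{L^2_x}\big\|_{\ell^q_n(\mathbb Z)},\qquad \|f\|_{W^{2,q}_s}=\big\|\|(1+|n|)^sP_nf(x)\|_{\ell^q_n(\mathbb Z)}\big\|_{L^2_x}.$$ By a solution of (1) on $[0,T]$ we mean $u\in C^2([0,T];\mathcal F L^{0,1}(\mathcal M))$ such that the equation holds in the sense of distributions on $\mathcal M$ at every $t\in[0,T]$; here $u(t)$ is a bounded continuous function, so $u(t)^k$ is its pointwise power. **Theorem.** Let $k\ge2$ be an integer, $s<0$, $\theta\in\mathbb R$ and $1\le q\le\infty$, and let $(Z^q_r)_{r\in\mathbb R}$ be one of the scales $\mathcal F L^{r,q}(\mathbb R)$, $\mathcal F L^{r,q}(\mathbb T)$, $M^{2,q}_r(\mathbb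 R)$, $W^{2,q}_r(\mathbb R)$. Then for every $(u_0,u_1)\in Z^q_s\times Z^q_s$ and every $\varepsilon>0$ there exist $T>0$, a solution $u_\varepsilon$ of (1) on $[0,T]$ (with its own initial data) that lies in $C([0,T];Z^q_s)$ with $\partial_tu_\varepsilon(0)\in Z^q_s$, and a time $t_\varepsilon\in(0,\varepsilon)$ with $t_\varepsilon\le T$, such that $$\|u_\varepsilon(0)-u_0\|_{Z^q_s}+\|\partial_tu_\varepsilon(0)-u_1\|_{Z^q_s}<\varepsilon\qquad\text{and}\qquad\|u_\varepsilon(t_\varepsilon)\|_{Z^q_\theta}>\varepsilon^{-1},$$ where the last norm is understood as $+\infty$ if $u_\varepsilon(t_\varepsilon)$ does not have a finite $Z^q_\theta$ norm. -/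

import Mathlib

open MeasureTheory Set Filter Topology SchwartzMap FourierTransform
open scoped ENNReal ContDiff

namespace GIBq

noncomputable section

/-! ### Notions shared by the line and the circle

`D` is the space of distributions on the line or on the circle, `N : D → ℝ≥0∞` is an extended
norm on `D`, and `S` is the set of distributions given by test functions. -/

section Abstract

variable {D : Type*} [AddCommGroup D] [Module ℂ D]

/-- `f` belongs to the completion of the test functions `S` for the norm `N`, realized inside the
space of distributions: `f` is the limit, in the norm `N`, of elements of `S`. -/
def InCompletion (N : D → ℝ≥0∞) (S : Set D) (f : D) : Prop :=
  ∀ ε : ℝ, 0 < ε → ∃ φ ∈ S, N (f - φ) < ENNReal.ofReal ε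

/-- `u ∈ C([0,T]; Z)`, where `Z` is the completion of `S` for the norm `N`. -/
def InContinuous (N : D → ℝ≥0∞) (S : Set D) (T : ℝ) (u : ℝ → D) : Prop :=
  (∀ t ∈ Icc 0 T, InCompletion N S (u t)) ∧
    ∀ t ∈ Icc 0 T, Tendsto (fun r => N (u r - u t)) (𝓝[Icc 0 T] t) (𝓝 0)

/-- `∂ₜ u = v` on `[0,T]`, where the difference quotients converge in the norm `N`
(one-sided at the two end points). -/
def HasTimeDeriv (N : D → ℝ≥0∞) (T : ℝ) (u v : ℝ → D) : Prop :=
  ∀ t ∈ Icc 0 T,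
    Tendsto (fun r => N (((r - t : ℝ) : ℂ)⁻¹ • (u r - u t) - v t)) (𝓝[Icc 0 T \ {t}] t) (𝓝 0)

/-- `u` is a solution on `[0,T]` of `∂ₜ²u - ∂ₓ²u - ∂ₜ²∂ₓ²u = ∂ₓ²(u ^ k)` with `∂ₜ u = v`:
`u` is twice continuously differentiable in time with values in the Wiener algebra (whose norm
is `wiener`), and the equation holds in the sense of distributions at each time.
`dxx` is `∂ₓ²` on distributions and `IsPow k f w` says `w = f ^ k`. -/
def IsSolution (S : Set D) (wiener : D → ℝ≥0∞) (dxx : D → D) (IsPow : ℕ → D → D → Prop)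
    (k : ℕ) (T : ℝ) (u v : ℝ → D) : Prop :=
  ∃ a w : ℝ → D,
    InContinuous wiener S T u ∧ InContinuous wiener S T v ∧ InContinuous wiener S T a ∧
    HasTimeDeriv wiener T u v ∧ HasTimeDeriv wiener T v a ∧
    ∀ t ∈ Icc 0 T, IsPow k (u t) (w t) ∧ a t - dxx (u t) - dxx (a t) = dxx (w t)

/-- Norm inflation with infinite loss of regularity at every initial datum, for the scale of
norms `Z s`, `s : ℝ`: arbitrarily close in `Z s` to any pair of data there are initial data of a
solution which is large in `Z θ` after an arbitrarily short time. -/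
def NormInflation (S : Set D) (wiener : D → ℝ≥0∞) (dxx : D → D) (IsPow : ℕ → D → D → Prop)
    (Z : ℝ → D → ℝ≥0∞) (k : ℕ) (s θ : ℝ) : Prop :=
  ∀ u₀ u₁ : D, InCompletion (Z s) S u₀ → InCompletion (Z s) S u₁ →
    ∀ ε : ℝ, 0 < ε →
      ∃ T : ℝ, 0 < T ∧ ∃ u v : ℝ → D,
        IsSolution S wiener dxx IsPow k T u v ∧
        InContinuous (Z s) S T u ∧ InCompletion (Z s) S (v 0) ∧
        Z s (u 0 - u₀) + Z s (v 0 - u₁) < ENNReal.ofReal ε ∧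
        ∃ t : ℝ, 0 < t ∧ t < ε ∧ t ≤ T ∧ ENNReal.ofReal ε⁻¹ < Z θ (u t)

end Abstract

/-- The bracket `⟨ξ⟩ = (1 + |ξ|²)^(1/2)`. -/
def bracket (ξ : ℝ) : ℝ := Real.sqrt (1 + ξ ^ 2)

/-! ### The line: distributions are the tempered distributions -/

/-- The tempered distribution `f` is given by the function `g`. -/
def Represents (g : ℝ → ℂ) (f : 𝓢'(ℝ, ℂ)) : Prop :=
  ∀ φ : 𝓢(ℝ, ℂ), Integrable (fun x => φ x * g x) ∧ f φ = ∫ x, φ x * g x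

/-- The Schwartz functions, as tempered distributions. -/
def testLine : Set 𝓢'(ℝ, ℂ) :=
  Set.range fun φ : 𝓢(ℝ, ℂ) => SchwartzMap.toTemperedDistributionCLM ℝ ℂ volume φ

/-- `∂ₓ²` on tempered distributions. -/
def dxxLine (f : 𝓢'(ℝ, ℂ)) : 𝓢'(ℝ, ℂ) :=
  TemperedDistribution.derivCLM ℂ (TemperedDistribution.derivCLM ℂ f)

/-- `w = f ^ k`, the pointwise power of a distribution `f` which is given by a function. -/
def IsPowLine (k : ℕ) (f w : 𝓢'(ℝ, ℂ)) : Prop :=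
  ∃ g : ℝ → ℂ, Represents g f ∧ Represents (fun x => g x ^ k) w

/-- The Fourier–Lebesgue norm `‖⟨ξ⟩ ^ s f̂(ξ)‖_{L^q_ξ(ℝ)}`; it is `∞` if `f̂` is not a function. -/
def flLine (q : ℝ≥0∞) (s : ℝ) (f : 𝓢'(ℝ, ℂ)) : ℝ≥0∞ :=
  ⨅ g : ℝ → ℂ, ⨅ _ : Represents g (𝓕 f),
    eLpNorm (fun ξ => ((bracket ξ ^ s : ℝ) : ℂ) * g ξ) q volume

/-- The `L^p(ℝ)` norm of a tempered distribution; it is `∞` if `f` is not a function. -/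
def lpLine (p : ℝ≥0∞) (f : 𝓢'(ℝ, ℂ)) : ℝ≥0∞ :=
  ⨅ g : ℝ → ℂ, ⨅ _ : Represents g f, eLpNorm g p volume

/-- The smooth cut-offs from which the frequency-uniform partition of unity is built. -/
structure IsCutoff (ρ : ℝ → ℝ) : Prop where
  smooth : ContDiff ℝ ∞ ρ
  mem_Icc : ∀ ξ, ρ ξ ∈ Icc (0 : ℝ) 1
  eq_one : ∀ ξ, |ξ| ≤ 1 / 2 → ρ ξ = 1
  eq_zero : ∀ ξ, 1 ≤ |ξ| → ρ ξ = 0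

/-- `σ_n = ρ(· - n) / ∑_l ρ(· - l)`. -/
def sigma (ρ : ℝ → ℝ) (n : ℤ) (ξ : ℝ) : ℝ := ρ (ξ - n) / ∑' l : ℤ, ρ (ξ - l)

/-- `P_n f = 𝓕⁻¹ (σ_n 𝓕 f)`. -/
def freqProj (ρ : ℝ → ℝ) (n : ℤ) (f : 𝓢'(ℝ, ℂ)) : 𝓢'(ℝ, ℂ) :=
  TemperedDistribution.fourierMultiplierCLM ℂ (fun ξ => (sigma ρ n ξ : ℂ)) f

/-- The modulation norm `‖ (1 + |n|) ^ s ‖P_n f‖_{L^p_x} ‖_{ℓ^q_n}`. -/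
def modulation (ρ : ℝ → ℝ) (p q : ℝ≥0∞) (s : ℝ) (f : 𝓢'(ℝ, ℂ)) : ℝ≥0∞ :=
  eLpNorm (fun n : ℤ => ENNReal.ofReal ((1 + |(n : ℝ)|) ^ s) * lpLine p (freqProj ρ n f))
    q Measure.count

/-- The Wiener amalgam norm `‖ ‖(1 + |n|) ^ s P_n f(x)‖_{ℓ^q_n} ‖_{L^p_x}`, where `g n` is the
function `P_n f`. -/
def wienerAmalgam (ρ : ℝ → ℝ) (p q : ℝ≥0∞) (s : ℝ) (f : 𝓢'(ℝ, ℂ)) : ℝ≥0∞ :=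
  ⨅ g : ℤ → ℝ → ℂ, ⨅ _ : ∀ n, Represents (g n) (freqProj ρ n f),
    eLpNorm (fun x : ℝ =>
      eLpNorm (fun n : ℤ => (((1 + |(n : ℝ)|) ^ s : ℝ) : ℂ) * g n x) q Measure.count) p volume

/-- Norm inflation for the equation posed on the line. -/
def NormInflationLine (Z : ℝ → 𝓢'(ℝ, ℂ) → ℝ≥0∞) (k : ℕ) (s θ : ℝ) : Prop :=
  NormInflation testLine (flLine 1 0) dxxLine IsPowLine Z k s θ

/-! ### The circle `ℝ / ℤ`: a distribution is identified with its Fourier coefficients `ℤ → ℂ` -/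

/-- The smooth functions on the circle, given by their Fourier coefficients. -/
def testCircle : Set (ℤ → ℂ) :=
  {c | ∃ φ : C(UnitAddCircle, ℂ), ContDiff ℝ ∞ (fun x : ℝ => φ (x : UnitAddCircle)) ∧
    c = fourierCoeff φ}

/-- `∂ₓ²` on the circle. -/
def dxxCircle (c : ℤ → ℂ) : ℤ → ℂ := fun n => (2 * Real.pi * Complex.I * n) ^ 2 * c n

/-- `w = f ^ k`, the pointwise power of a continuous function on the circle. -/
def IsPowCircle (k : ℕ) (f w : ℤ → ℂ) : Prop :=
  ∃ g : C(UnitAddCircle, ℂ), f = fourierCoeff g ∧ w = fourierCoeff (fun x => g x ^ k)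

/-- The Fourier–Lebesgue norm `‖⟨n⟩ ^ s f̂(n)‖_{ℓ^q_n(ℤ)}`. -/
def flCircle (q : ℝ≥0∞) (s : ℝ) (c : ℤ → ℂ) : ℝ≥0∞ :=
  eLpNorm (fun n : ℤ => ((bracket n ^ s : ℝ) : ℂ) * c n) q Measure.count

/-- Norm inflation for the equation posed on the circle. -/
def NormInflationCircle (Z : ℝ → (ℤ → ℂ) → ℝ≥0∞) (k : ℕ) (s θ : ℝ) : Prop :=
  NormInflation testCircle (flCircle 1 0) dxxCircle IsPowCircle Z k s θ

end

end GIBq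

/-! Inverting `1 - ∂ₓ²` turns the equation into `u'' = -M (u + u ^ k)`, where `M` is the Fourier
multiplier with the bounded symbol `4π²ξ² / (1 + 4π²ξ²)`. In a Banach algebra `X` on which `M` is
bounded this is an ordinary differential equation with a locally Lipschitz right-hand side, so there
is no dispersive difficulty; inflation comes from a high-to-low frequency resonance.

Approximate the data by test functions `φ₀`, `φ₁` and start from `φ₀ + A • p n`, `φ₁`. Here `p n`
has two bumps, near the frequencies `n` and `-(k - 1) n`. It is bounded in `X`, but small in `Z s`
for large `n` because `s < 0`. Its `k`-th power contains, with multiplicity `k`, a low-frequency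
part that does not depend on `n` (`k - 1` factors from the first bump and one from the second). A
functional `Λ` that tests a fixed low frequency therefore misses `p n` in the limit but sees `M (p n
^ k)`, and it is bounded by the `Z θ` norm for every real `θ`; hence the infinite loss of
regularity.

By Taylor's formula `Λ (u T)` has main term `-(T² / 2) A ^ k Λ (M (p n ^ k))`. With `T² A ^ (k - 1)
= d` small and fixed, the solution exists up to `T`, the main term has size `d A`, the Taylor
remainder grows at most like `d² A`, and the rest is bounded. Choose `d`, then `A`, and finally `n`.
This is `eventually_exists_large_solution`; `normInflation_of_model` transfers it to distributions.

On the circle, `X` is the Wiener algebra. On the line, integrability of the Fourier transform would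
not put it into `L^q`, so `X` consists of functions whose Fourier transform and its derivative are
integrable. This is still an algebra, and it embeds into all the spaces in question when `s ≤ 0`:
for `flLine` because such a transform lies in every `L^q`, for the other two scales because the `L²`
norms of the pieces `P_n f` are summable (`exists_sum_norm_piece_le`). -/

namespace GIBq

/-! ### Second-order differential equations in Banach spaces -/

section ODE

variable {X : Type*} [NormedAddCommGroup X] [NormedSpace ℝ X]

open ODE in
/-- Picard–Lindelöf, keeping track of the ball in which the solution lives. -/
theorem exists_hasDerivWithinAt_mem_closedBall [CompleteSpace X] {f : ℝ → X → X} {tmin tmax : ℝ}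
    {t₀ : Icc tmin tmax} {x₀ : X} {a L K : NNReal} (hf : IsPicardLindelof f t₀ x₀ a 0 L K) :
    ∃ α : ℝ → X, α t₀ = x₀ ∧ ∀ t ∈ Icc tmin tmax,
      HasDerivWithinAt α (f t (α t)) (Icc tmin tmax) t ∧ α t ∈ Metric.closedBall x₀ a := by
  have hx : x₀ ∈ Metric.closedBall x₀ ((0 : NNReal) : ℝ) := Metric.mem_closedBall_self le_rfl
  obtain ⟨α, hα⟩ := FunSpace.exists_isFixedPt_next hf hx
  refine ⟨α.compProj, by rw [FunSpace.compProj_val, ← hα, FunSpace.next_apply₀], fun t ht ↦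
    ⟨?_, α.compProj_mem_closedBall hf.mul_max_le⟩⟩
  apply hasDerivWithinAt_picard_Icc t₀.2 hf.continuousOn_uncurry
    α.continuous_compProj.continuousOn (fun _ ht' ↦ α.compProj_mem_closedBall hf.mul_max_le)
    x₀ ht |>.congr_of_mem _ ht
  intro t' ht'
  nth_rw 1 [← hα]
  rw [FunSpace.compProj_of_mem ht', FunSpace.next_apply]

/-- Local existence for `u'' = F u`, with a quantitative time of existence. -/
theorem exists_second_order_solution [CompleteSpace X] {F : X → X} {u₀ u₁ : X} {R L T : ℝ}
    (hR : 0 < R) (hL : 0 ≤ L)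
    (hT : 0 < T)
    (hF : ∀ x ∈ Metric.closedBall u₀ R, ∀ y ∈ Metric.closedBall u₀ R, ‖F x - F y‖ ≤ L * ‖x - y‖)
    (h₁ : T * ‖u₁‖ ≤ R / 2) (h₂ : 4 * T ^ 2 * (‖F u₀‖ + L * R) ≤ R) :
    ∃ u v : ℝ → X, u 0 = u₀ ∧ v 0 = u₁ ∧ ∀ t ∈ Icc 0 T,
      HasDerivWithinAt u (v t) (Icc 0 T) t ∧ HasDerivWithinAt v (F (u t)) (Icc 0 T) t ∧
        u t ∈ Metric.closedBall u₀ R := by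
  -- The first-order system is written for `(u, c u')`. The choice `c = 4 T` balances the two
  -- components: over time `T` the first moves by at most `R / 4 + T ‖u₁‖` and the second by at most
  -- `4 T² (‖F u₀‖ + L R)`, so both stay within `R`.
  set c : ℝ := 4 * T with hc
  have hc0 : 0 < c := by positivity
  let f : ℝ → X × X → X × X := fun _ z => (c⁻¹ • z.2, c • F z.1)
  have hfst : ∀ z ∈ Metric.closedBall (u₀, c • u₁) R, z.1 ∈ Metric.closedBall u₀ R := by
    intro z hz
    rw [← closedBall_prod_same] at hz
    exact hz.1
  have hsnd : ∀ z ∈ Metric.closedBall (u₀, c • u₁) R, ‖z.2 - c • u₁‖ ≤ R := by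
    intro z hz
    rw [← closedBall_prod_same] at hz
    simpa [dist_eq_norm] using hz.2
  have hu₀ : u₀ ∈ Metric.closedBall u₀ R := Metric.mem_closedBall_self hR.le
  obtain ⟨a, ha⟩ : ∃ a : NNReal, (a : ℝ) = R := ⟨⟨R, hR.le⟩, rfl⟩
  obtain ⟨b, hb⟩ : ∃ b : NNReal, (b : ℝ) = R / T := ⟨⟨R / T, by positivity⟩, rfl⟩
  obtain ⟨K, hK⟩ : ∃ K : NNReal, (K : ℝ) = max c⁻¹ (c * L) :=
    ⟨⟨max c⁻¹ (c * L), le_max_of_le_left (by positivity)⟩, rfl⟩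
  have hpl : IsPicardLindelof f (tmin := 0) (tmax := T) ⟨0, by simp [hT.le]⟩ (u₀, c • u₁)
      a 0 b K := by
    constructor
    · intro t _
      refine LipschitzOnWith.of_dist_le_mul fun z hz w hw => ?_
      rw [ha] at hz hw
      rw [hK]
      rw [Prod.dist_eq, dist_eq_norm, dist_eq_norm, dist_eq_norm]
      have e1 : ‖z.1 - w.1‖ ≤ ‖z - w‖ := norm_fst_le (z - w)
      have e2 : ‖z.2 - w.2‖ ≤ ‖z - w‖ := norm_snd_le (z - w)
      have hK1 : c⁻¹ ≤ max c⁻¹ (c * L) := le_max_left _ _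
      have hK2 : c * L ≤ max c⁻¹ (c * L) := le_max_right _ _
      change max ‖c⁻¹ • z.2 - c⁻¹ • w.2‖ ‖c • F z.1 - c • F w.1‖ ≤ max c⁻¹ (c * L) * ‖z - w‖
      rw [← smul_sub, ← smul_sub, norm_smul, norm_smul, Real.norm_of_nonneg hc0.le,
        Real.norm_of_nonneg (inv_nonneg.2 hc0.le)]
      refine max_le (by gcongr) ?_
      calc c * ‖F z.1 - F w.1‖ ≤ c * (L * ‖z.1 - w.1‖) := by
            gcongr; exact hF _ (hfst z hz) _ (hfst w hw)
        _ = (c * L) * ‖z.1 - w.1‖ := by ring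
        _ ≤ _ := by gcongr
    · exact fun z _ => continuousOn_const
    · intro t _ z hz
      rw [ha] at hz
      rw [hb]
      change max ‖c⁻¹ • z.2‖ ‖c • F z.1‖ ≤ R / T
      rw [norm_smul, norm_smul, Real.norm_of_nonneg hc0.le,
        Real.norm_of_nonneg (inv_nonneg.2 hc0.le), le_div_iff₀ hT, max_mul_of_nonneg _ _ hT.le]
      refine max_le ?_ ?_
      · have : ‖z.2‖ ≤ R + c * ‖u₁‖ := by
          calc ‖z.2‖ = ‖(z.2 - c • u₁) + c • u₁‖ := by simp
            _ ≤ ‖z.2 - c • u₁‖ + ‖c • u₁‖ := norm_add_le _ _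
            _ ≤ R + c * ‖u₁‖ := by
              rw [norm_smul, Real.norm_of_nonneg hc0.le]; gcongr; exact hsnd z hz
        calc c⁻¹ * ‖z.2‖ * T ≤ c⁻¹ * (R + c * ‖u₁‖) * T := by gcongr
          _ = R / 4 + T * ‖u₁‖ := by rw [hc]; field_simp
          _ ≤ R := by linarith
      · have : ‖F z.1‖ ≤ ‖F u₀‖ + L * R := by
          calc ‖F z.1‖ = ‖F u₀ + (F z.1 - F u₀)‖ := by simp
            _ ≤ ‖F u₀‖ + ‖F z.1 - F u₀‖ := norm_add_le _ _
            _ ≤ ‖F u₀‖ + L * ‖z.1 - u₀‖ := by gcongr; exact hF _ (hfst z hz) _ hu₀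
            _ ≤ _ := by gcongr; simpa [dist_eq_norm] using hfst z hz
        calc c * ‖F z.1‖ * T ≤ c * (‖F u₀‖ + L * R) * T := by gcongr
          _ = 4 * T ^ 2 * (‖F u₀‖ + L * R) := by rw [hc]; ring
          _ ≤ R := h₂
    · rw [ha, hb]
      simp only [sub_zero, NNReal.coe_zero]
      rw [max_eq_left hT.le, div_mul_cancel₀ _ hT.ne']
  obtain ⟨α, hα0, hα⟩ := exists_hasDerivWithinAt_mem_closedBall hpl
  refine ⟨fun t => (α t).1, fun t => c⁻¹ • (α t).2, by simp [hα0], ?_, fun t ht => ?_⟩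
  · simp only at hα0
    simp [hα0, hc0.ne']
  · obtain ⟨hd, hbt⟩ := hα t ht
    rw [ha] at hbt
    refine ⟨?_, ?_, hfst _ hbt⟩
    · exact (hasFDerivAt_fst.comp_hasDerivWithinAt t hd)
    · have := ((hasFDerivAt_snd (𝕜 := ℝ)).comp_hasDerivWithinAt t hd).const_smul c⁻¹
      refine this.congr_deriv ?_
      simp [f, smul_smul, hc0.ne']

/-- Second-order Taylor expansion of a solution of `u'' = F u`. -/
theorem norm_taylor_second_order_le {F : X → X} {u v : ℝ → X} {R L T : ℝ} (hR : 0 ≤ R)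
    (hL : 0 ≤ L) (hT : 0 ≤ T)
    (hF : ∀ x ∈ Metric.closedBall (u 0) R, ‖F x - F (u 0)‖ ≤ L * ‖x - u 0‖)
    (hu : ∀ t ∈ Icc 0 T, HasDerivWithinAt u (v t) (Icc 0 T) t)
    (hv : ∀ t ∈ Icc 0 T, HasDerivWithinAt v (F (u t)) (Icc 0 T) t)
    (hb : ∀ t ∈ Icc 0 T, u t ∈ Metric.closedBall (u 0) R) :
    ‖u T - u 0 - T • v 0 - (T ^ 2 / 2) • F (u 0)‖ ≤
      L * T ^ 2 * (T * ‖v 0‖ + T ^ 2 * (‖F (u 0)‖ + L * R)) := by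
  have h0 : (0 : ℝ) ∈ Icc 0 T := ⟨le_rfl, hT⟩
  have hTT : T ∈ Icc 0 T := ⟨hT, le_rfl⟩
  set B := ‖F (u 0)‖ + L * R with hBdef
  have hB0 : 0 ≤ B := by positivity
  have hFb : ∀ t ∈ Icc 0 T, ‖F (u t)‖ ≤ B := fun t ht => by
    calc ‖F (u t)‖ = ‖F (u 0) + (F (u t) - F (u 0))‖ := by simp
      _ ≤ ‖F (u 0)‖ + ‖F (u t) - F (u 0)‖ := norm_add_le _ _
      _ ≤ ‖F (u 0)‖ + L * ‖u t - u 0‖ := by gcongr; exact hF _ (hb t ht)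
      _ ≤ B := by rw [hBdef]; gcongr; simpa [dist_eq_norm] using hb t ht
  -- The mean value inequality is used four times: for `v`, for `u`, then for `v` and `u` minus
  -- their Taylor polynomials. The last two use the Lipschitz bound at the displacement `D` just
  -- obtained.
  have hvb : ∀ t ∈ Icc 0 T, ‖v t - v 0‖ ≤ B * T := fun t ht =>
    (norm_image_sub_le_of_norm_deriv_le_segment' (f := v) (f' := fun t => F (u t)) (C := B) hv
      (fun x hx => hFb x ⟨hx.1, hx.2.le⟩) t ht).trans (by
        have := ht.2; gcongr; linarith)
  have hub : ∀ t ∈ Icc 0 T, ‖u t - u 0‖ ≤ T * ‖v 0‖ + T ^ 2 * B := fun t ht =>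
    (norm_image_sub_le_of_norm_deriv_le_segment' (f := u) (f' := v) (C := ‖v 0‖ + B * T) hu
      (fun x hx => by
        calc ‖v x‖ = ‖v 0 + (v x - v 0)‖ := by simp
          _ ≤ ‖v 0‖ + ‖v x - v 0‖ := norm_add_le _ _
          _ ≤ _ := by gcongr; exact hvb x ⟨hx.1, hx.2.le⟩) t ht).trans (by
        have := ht.2
        calc (‖v 0‖ + B * T) * (t - 0) ≤ (‖v 0‖ + B * T) * T := by gcongr; linarith
          _ = _ := by ring)
  set D := T * ‖v 0‖ + T ^ 2 * B with hD
  have hD0 : 0 ≤ D := by positivity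
  have hw : ∀ t ∈ Icc 0 T, ‖v t - v 0 - t • F (u 0)‖ ≤ L * D * T := fun t ht => by
    have key := norm_image_sub_le_of_norm_deriv_le_segment' (f := fun t => v t - t • F (u 0))
      (f' := fun t => F (u t) - F (u 0)) (C := L * D) (a := 0) (b := T)
      (fun x hx => by
        have := (hv x hx).sub ((hasDerivWithinAt_id x (Icc 0 T)).smul_const (F (u 0)))
        simpa using! this)
      (fun x hx => (hF _ (hb x ⟨hx.1, hx.2.le⟩)).trans (by
        gcongr; exact hub x ⟨hx.1, hx.2.le⟩)) t ht
    have e : v t - v 0 - t • F (u 0) = v t - t • F (u 0) - (v 0 - (0 : ℝ) • F (u 0)) := by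
      simp; abel
    rw [e]
    refine key.trans ?_
    have := ht.2
    gcongr; linarith
  have key := norm_image_sub_le_of_norm_deriv_le_segment'
    (f := fun t => u t - t • v 0 - (t ^ 2 / 2) • F (u 0))
    (f' := fun t => v t - v 0 - t • F (u 0)) (C := L * D * T) (a := 0) (b := T)
    (fun x hx => by
      have h1 := (hu x hx).sub ((hasDerivWithinAt_id x (Icc 0 T)).smul_const (v 0))
      have h2 : HasDerivWithinAt (fun t : ℝ => t ^ 2 / 2) x (Icc 0 T) x := by
        have := ((hasDerivWithinAt_id x (Icc 0 T)).pow 2).div_const 2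
        simpa using! this
      have := h1.sub (h2.smul_const (F (u 0)))
      simpa using! this)
    (fun x hx => hw x ⟨hx.1, hx.2.le⟩) T hTT
  have e : u T - u 0 - T • v 0 - (T ^ 2 / 2) • F (u 0) =
      u T - T • v 0 - (T ^ 2 / 2) • F (u 0) -
        (u 0 - (0 : ℝ) • v 0 - ((0 : ℝ) ^ 2 / 2) • F (u 0)) := by
    simp; abel
  rw [e]
  refine key.trans (le_of_eq ?_)
  ring

end ODE

/-! ### Norm inflation in an abstract Banach space model -/

section Model

variable {X : Type*} [NormedAddCommGroup X] [NormedSpace ℂ X]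

set_option maxHeartbeats 1600000 in
/-- The inflation mechanism: if the data are perturbed by `A • p n` with `p n` bounded, and the
functional `Λ` sees `M (P (p n))` but not `p n` in the limit, then the solution of
`u'' = -M (u + P u)` is large when tested against `Λ`, after a short time depending only on `A`. -/
theorem eventually_exists_large_solution [CompleteSpace X] {k : ℕ} (hk : 2 ≤ k) (P : X → X)
    (M : X →L[ℂ] X) (Λ : X →L[ℂ] ℂ) (p : ℕ → X) {K : ℝ} (hP0 : P 0 = 0)
    (hP : ∀ R x y, ‖x‖ ≤ R → ‖y‖ ≤ R → ‖P x - P y‖ ≤ K * R ^ (k - 1) * ‖x - y‖)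
    (hPsmul : ∀ (a : ℂ) x, P (a • x) = a ^ k • P x) {c : ℝ} (hp : ∀ n, ‖p n‖ ≤ c)
    (hpΛ : Tendsto (fun n => Λ (p n)) atTop (𝓝 0)) {γ : ℂ} (hγ : γ ≠ 0)
    (hpM : Tendsto (fun n => Λ (M (P (p n)))) atTop (𝓝 γ)) (φ₀ φ₁ : X) (H : ℝ) {ε : ℝ}
    (hε : 0 < ε) :
    ∃ A T : ℝ, 0 < T ∧ T < ε ∧ ∀ᶠ n in atTop, ∃ u v : ℝ → X,
      u 0 = φ₀ + (A : ℂ) • p n ∧ v 0 = φ₁ ∧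
      (∀ t ∈ Icc 0 T, HasDerivWithinAt u (v t) (Icc 0 T) t ∧
        HasDerivWithinAt v (-M (u t + P (u t))) (Icc 0 T) t) ∧ H < ‖Λ (u T)‖ := by
  have hc : 0 ≤ c := (norm_nonneg _).trans (hp 0)
  set μ := ‖M‖ with hμ
  set l := ‖Λ‖ with hl
  have hμ0 : 0 ≤ μ := norm_nonneg _
  have hl0 : 0 ≤ l := norm_nonneg _
  -- we may assume that `K` is nonnegative
  wlog hK : 0 ≤ K generalizing K
  · exact this (K := |K|) (fun R x y hx hy => (hP R x y hx hy).trans (by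
      have : 0 ≤ R := (norm_nonneg _).trans hx
      gcongr; exact le_abs_self K)) (abs_nonneg K)
  have hγ0 : 0 < ‖γ‖ := norm_pos_iff.2 hγ
  set C₁ := μ * (1 + K * (2 + c) ^ (k - 1)) with hC₁
  have hC₁0 : 0 ≤ C₁ := by positivity
  set C₂ := C₁ * (2 + c) with hC₂
  have hC₂0 : 0 ≤ C₂ := by positivity
  -- the size of `T² A ^ (k - 1)`
  obtain ⟨d, hd0, hd1, hd2, hd3⟩ : ∃ d : ℝ, 0 < d ∧ d ≤ 1 / 4 ∧ 4 * d * C₂ ≤ 1 ∧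
      8 * d * (l * C₁ * C₂) ≤ ‖γ‖ := by
    have h1 : ∃ d : ℝ, 0 < d ∧ 4 * d * C₂ ≤ 1 := by
      refine ⟨1 / (4 * (C₂ + 1)), by positivity, ?_⟩
      rw [show 4 * (1 / (4 * (C₂ + 1))) * C₂ = C₂ / (C₂ + 1) by field_simp]
      rw [div_le_one (by positivity)]; linarith
    have h2 : ∃ d : ℝ, 0 < d ∧ 8 * d * (l * C₁ * C₂) ≤ ‖γ‖ := by
      have h0 : 0 ≤ l * C₁ * C₂ := by positivity
      refine ⟨‖γ‖ / (8 * (l * C₁ * C₂ + 1)), by positivity, ?_⟩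
      rw [show 8 * (‖γ‖ / (8 * (l * C₁ * C₂ + 1))) * (l * C₁ * C₂) =
        ‖γ‖ * ((l * C₁ * C₂) / (l * C₁ * C₂ + 1)) by field_simp]
      refine mul_le_of_le_one_right hγ0.le ?_
      rw [div_le_one (by positivity)]; linarith
    obtain ⟨d1, h10, h1⟩ := h1
    obtain ⟨d2, h20, h2⟩ := h2
    have e1 : min (1 / 4) (min d1 d2) ≤ d1 := (min_le_right _ _).trans (min_le_left _ _)
    have e2 : min (1 / 4) (min d1 d2) ≤ d2 := (min_le_right _ _).trans (min_le_right _ _)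
    refine ⟨min (1 / 4) (min d1 d2), by positivity, min_le_left _ _, ?_, ?_⟩
    · refine le_trans ?_ h1; gcongr
    · refine le_trans ?_ h2; gcongr
  -- `Q` collects the contributions to `Λ (u T)` that stay bounded as `A` grows; the interaction of
  -- `φ₀` with `A • p n` costs at most `A ^ (k - 1)`, which `T²` absorbs. The main term is at least
  -- `d ‖γ‖ A / 4` and the remainder takes at most half of it, which leaves the `d ‖γ‖ A / 8`
  -- required below to exceed `H + Q`.
  set Q := l * μ * ((1 + c) + K * (1 + c) ^ (k - 1) * ‖φ₀‖) + l * ‖φ₀‖ + 1 + l * ‖φ₁‖ +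
    l * C₁ * ‖φ₁‖ with hQ
  -- the amplitude
  obtain ⟨A, hA1, hAφ₀, hAφ₁, hAε, hAH⟩ : ∃ A : ℝ, 1 ≤ A ∧ ‖φ₀‖ ≤ A ∧ ‖φ₁‖ ≤ A ∧
      1 / ε ^ 2 < A ∧ H + Q < d * ‖γ‖ / 8 * A := by
    have := ((eventually_ge_atTop (1 : ℝ)).and <| (eventually_ge_atTop ‖φ₀‖).and <|
      (eventually_ge_atTop ‖φ₁‖).and <| (eventually_gt_atTop (1 / ε ^ 2)).and <|
      (tendsto_id.const_mul_atTop (by positivity : 0 < d * ‖γ‖ / 8)).eventually_gt_atTop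
        (H + Q)).exists
    exact this
  have hA0 : 0 < A := by linarith
  have hAk : 1 ≤ A ^ (k - 1) := one_le_pow₀ hA1
  have hAAk : A ≤ A ^ (k - 1) := le_self_pow₀ hA1 (by omega)
  have hAk0 : 0 < A ^ (k - 1) := by positivity
  have hAkk : A ^ k = A ^ (k - 1) * A := by rw [← pow_succ]; congr 1; omega
  -- On balls of radius comparable to `A` the Lipschitz constant of `F` is of order `A ^ (k - 1)`,
  -- so this is the longest time scale on which existence and Taylor's formula are under control. It
  -- does not depend on `n`.
  set T := Real.sqrt (d / A ^ (k - 1)) with hT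
  have hT2 : T ^ 2 = d / A ^ (k - 1) := Real.sq_sqrt (by positivity)
  have hT0 : 0 < T := Real.sqrt_pos.2 (by positivity)
  have hTA : T ^ 2 * A ^ (k - 1) = d := by rw [hT2]; field_simp
  have hTA' : T ^ 2 * A ^ k = d * A := by rw [hAkk, ← mul_assoc, hTA]
  have hT12 : T ≤ 1 / 2 := by
    refine (Real.sqrt_le_left (by norm_num)).2 ?_
    rw [div_le_iff₀ hAk0]; nlinarith
  have hTε : T < ε := by
    refine (Real.sqrt_lt' hε).2 ?_
    rw [div_lt_iff₀ hAk0]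
    rw [div_lt_iff₀ (by positivity)] at hAε
    nlinarith [sq_nonneg ε, mul_le_mul_of_nonneg_right hAAk (sq_nonneg ε)]
  set F : X → X := fun x => -M (x + P x) with hF
  set L := C₁ * A ^ (k - 1) with hL
  have hL0 : 0 ≤ L := by positivity
  have hFlip : ∀ x y, ‖x‖ ≤ (2 + c) * A → ‖y‖ ≤ (2 + c) * A → ‖F x - F y‖ ≤ L * ‖x - y‖ := by
    intro x y hx hy
    have e : F x - F y = -M ((x - y) + (P x - P y)) := by
      simp only [hF, map_add, map_sub]; abel
    rw [e, norm_neg]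
    calc ‖M ((x - y) + (P x - P y))‖ ≤ μ * ‖(x - y) + (P x - P y)‖ := M.le_opNorm _
      _ ≤ μ * (‖x - y‖ + K * ((2 + c) * A) ^ (k - 1) * ‖x - y‖) := by
          gcongr; exact (norm_add_le _ _).trans (by gcongr; exact hP _ _ _ hx hy)
      _ = μ * (1 + K * (2 + c) ^ (k - 1) * A ^ (k - 1)) * ‖x - y‖ := by rw [mul_pow]; ring
      _ ≤ μ * (A ^ (k - 1) + K * (2 + c) ^ (k - 1) * A ^ (k - 1)) * ‖x - y‖ := by gcongr
      _ = L * ‖x - y‖ := by rw [hL, hC₁]; ring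
  refine ⟨A, T, hT0, hTε, ?_⟩
  -- `A` and `T` are fixed from here on, so taking `n` large makes the direct contribution of `A • p
  -- n` harmless.
  have ev1 : ∀ᶠ n in atTop, A * ‖Λ (p n)‖ < 1 := by
    have : Tendsto (fun n => A * ‖Λ (p n)‖) atTop (𝓝 (A * ‖(0 : ℂ)‖)) := hpΛ.norm.const_mul A
    rw [norm_zero, mul_zero] at this
    exact this.eventually_lt_const one_pos
  have ev2 : ∀ᶠ n in atTop, ‖γ‖ / 2 < ‖Λ (M (P (p n)))‖ :=
    hpM.norm.eventually_const_lt (by linarith)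
  filter_upwards [ev1, ev2] with n hn1 hn2
  set u₀ := φ₀ + (A : ℂ) • p n with hu₀
  have hAp : ‖(A : ℂ) • p n‖ ≤ c * A := by
    rw [norm_smul, Complex.norm_real, Real.norm_of_nonneg hA0.le, mul_comm]
    gcongr; exact hp n
  have hu₀n : ‖u₀‖ ≤ (1 + c) * A := (norm_add_le _ _).trans (by linarith)
  have hu₀n' : ‖u₀‖ ≤ (2 + c) * A := hu₀n.trans (by gcongr; norm_num)
  have hball : ∀ x ∈ Metric.closedBall u₀ A, ‖x‖ ≤ (2 + c) * A := fun x hx => by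
    have h1 : ‖x - u₀‖ ≤ A := by simpa [dist_eq_norm] using hx
    calc ‖x‖ = ‖u₀ + (x - u₀)‖ := by simp
      _ ≤ ‖u₀‖ + ‖x - u₀‖ := norm_add_le _ _
      _ ≤ _ := by linarith
  have hFu₀ : ‖F u₀‖ ≤ L * ((1 + c) * A) := by
    have h0 : F 0 = 0 := by simp [hF, hP0]
    have := hFlip u₀ 0 hu₀n' (by rw [norm_zero]; positivity)
    rw [h0, sub_zero, sub_zero] at this
    exact this.trans (by gcongr)
  have hB : ‖F u₀‖ + L * A ≤ C₂ * A ^ k := by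
    calc ‖F u₀‖ + L * A ≤ L * ((1 + c) * A) + L * A := by gcongr
      _ = C₂ * A ^ k := by rw [hAkk, hL, hC₂]; ring
  have hTB : T ^ 2 * (‖F u₀‖ + L * A) ≤ C₂ * d * A := by
    calc T ^ 2 * (‖F u₀‖ + L * A) ≤ T ^ 2 * (C₂ * A ^ k) := by gcongr
      _ = C₂ * (T ^ 2 * A ^ k) := by ring
      _ = _ := by rw [hTA']; ring
  obtain ⟨u, v, hu0, hv0, huv⟩ := exists_second_order_solution (X := X) (F := F) (u₀ := u₀)
    (u₁ := φ₁) (R := A) (L := L) (T := T) hA0 hL0 hT0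
    (fun x hx y hy => hFlip x y (hball x hx) (hball y hy))
    (by
      have : T * ‖φ₁‖ ≤ 1 / 2 * A := by gcongr
      linarith)
    (by
      have : 4 * d * C₂ * A ≤ 1 * A := by gcongr
      linarith)
  refine ⟨u, v, hu0, hv0, fun t ht => ⟨(huv t ht).1, (huv t ht).2.1⟩, ?_⟩
  have htaylor := norm_taylor_second_order_le (F := F) (u := u) (v := v) (R := A) (L := L) (T := T)
    hA0.le hL0 hT0.le
    (fun x hx => by
      rw [hu0] at hx ⊢
      exact hFlip x u₀ (hball x hx) hu₀n')
    (fun t ht => (huv t ht).1) (fun t ht => (huv t ht).2.1)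
    (fun t ht => by rw [hu0]; exact (huv t ht).2.2)
  rw [hu0, hv0] at htaylor
  set E := u T - u₀ - T • φ₁ - (T ^ 2 / 2) • F u₀ with hE
  have hEb : ‖E‖ ≤ C₁ * ‖φ₁‖ + C₁ * C₂ * d * d * A := by
    have hLT : L * T ^ 2 = C₁ * d := by rw [hL, ← hTA]; ring
    calc ‖E‖ ≤ L * T ^ 2 * (T * ‖φ₁‖ + T ^ 2 * (‖F u₀‖ + L * A)) := htaylor
      _ ≤ C₁ * d * (1 * ‖φ₁‖ + C₂ * d * A) := by rw [hLT]; gcongr; linarith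
      _ = C₁ * d * ‖φ₁‖ + C₁ * C₂ * d * d * A := by ring
      _ ≤ C₁ * 1 * ‖φ₁‖ + C₁ * C₂ * d * d * A := by gcongr; linarith
      _ = _ := by ring
  -- the leading part of the nonlinearity
  set G := P u₀ - P ((A : ℂ) • p n) with hG
  have hGb : ‖G‖ ≤ K * (1 + c) ^ (k - 1) * A ^ (k - 1) * ‖φ₀‖ := by
    have := hP ((1 + c) * A) u₀ ((A : ℂ) • p n) hu₀n (hAp.trans (by gcongr; linarith))
    rw [mul_pow, hu₀, add_sub_cancel_right] at this
    linarith
  have hdecomp : Λ (u T) = -((T ^ 2 / 2 * A ^ k : ℝ) : ℂ) * Λ (M (P (p n))) +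
      (Λ φ₀ + (A : ℂ) * Λ (p n) + (T : ℂ) * Λ φ₁ -
        ((T ^ 2 / 2 : ℝ) : ℂ) * Λ (M (u₀ + G)) + Λ E) := by
    have e1 : u T = E + u₀ + (T : ℂ) • φ₁ + ((T ^ 2 / 2 : ℝ) : ℂ) • F u₀ := by
      rw [hE, Complex.coe_smul, Complex.coe_smul]; abel
    have e2 : F u₀ = -M (u₀ + G) - ((A : ℂ) ^ k) • M (P (p n)) := by
      rw [← map_smul, ← hPsmul, hG]; simp only [hF, map_add, map_sub]; abel
    rw [e1, e2, hu₀]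
    simp only [map_add, map_sub, map_smul, map_neg, smul_eq_mul]
    push_cast
    ring
  have hbad : ‖Λ φ₀ + (A : ℂ) * Λ (p n) + (T : ℂ) * Λ φ₁ -
        ((T ^ 2 / 2 : ℝ) : ℂ) * Λ (M (u₀ + G)) + Λ E‖ ≤
      Q + l * C₁ * C₂ * d * d * A := by
    have b1 : ‖Λ φ₀‖ ≤ l * ‖φ₀‖ := Λ.le_opNorm _
    have b2 : ‖(A : ℂ) * Λ (p n)‖ ≤ 1 := by
      rw [norm_mul, Complex.norm_real, Real.norm_of_nonneg hA0.le]; exact hn1.le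
    have b3 : ‖(T : ℂ) * Λ φ₁‖ ≤ l * ‖φ₁‖ := by
      rw [norm_mul, Complex.norm_real, Real.norm_of_nonneg hT0.le]
      calc T * ‖Λ φ₁‖ ≤ 1 * (l * ‖φ₁‖) := by
            gcongr
            · linarith
            · exact Λ.le_opNorm _
        _ = _ := one_mul _
    have b4 : ‖((T ^ 2 / 2 : ℝ) : ℂ) * Λ (M (u₀ + G))‖ ≤
        l * μ * ((1 + c) + K * (1 + c) ^ (k - 1) * ‖φ₀‖) := by
      rw [norm_mul, Complex.norm_real, Real.norm_of_nonneg (by positivity)]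
      have h1 : ‖Λ (M (u₀ + G))‖ ≤ l * (μ * ((1 + c) * A +
          K * (1 + c) ^ (k - 1) * A ^ (k - 1) * ‖φ₀‖)) :=
        (Λ.le_opNorm _).trans (by
          gcongr
          exact (M.le_opNorm _).trans (by
            gcongr; exact (norm_add_le _ _).trans (add_le_add hu₀n hGb)))
      calc T ^ 2 / 2 * ‖Λ (M (u₀ + G))‖
          ≤ T ^ 2 / 2 * (l * (μ * ((1 + c) * A ^ (k - 1) +
            K * (1 + c) ^ (k - 1) * A ^ (k - 1) * ‖φ₀‖))) := by
              gcongr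
              exact h1.trans (by gcongr)
        _ = (T ^ 2 * A ^ (k - 1)) / 2 *
            (l * μ * ((1 + c) + K * (1 + c) ^ (k - 1) * ‖φ₀‖)) := by ring
        _ ≤ 1 * (l * μ * ((1 + c) + K * (1 + c) ^ (k - 1) * ‖φ₀‖)) := by
              rw [hTA]; gcongr; linarith
        _ = _ := one_mul _
    have b5 : ‖Λ E‖ ≤ l * (C₁ * ‖φ₁‖ + C₁ * C₂ * d * d * A) :=
      (Λ.le_opNorm _).trans (by gcongr)
    refine (norm_add_le _ _).trans ?_
    refine (add_le_add ((norm_sub_le _ _).trans (add_le_add ((norm_add_le _ _).trans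
      (add_le_add ((norm_add_le _ _).trans (add_le_add b1 b2)) b3)) b4)) b5).trans (le_of_eq ?_)
    rw [hQ]; ring
  have hmain : d * ‖γ‖ / 4 * A ≤ ‖-((T ^ 2 / 2 * A ^ k : ℝ) : ℂ) * Λ (M (P (p n)))‖ := by
    rw [norm_mul, norm_neg, Complex.norm_real, Real.norm_of_nonneg (by positivity)]
    calc d * ‖γ‖ / 4 * A = (T ^ 2 * A ^ k) / 2 * (‖γ‖ / 2) := by rw [hTA']; ring
      _ ≤ T ^ 2 / 2 * A ^ k * ‖Λ (M (P (p n)))‖ := by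
        rw [show T ^ 2 * A ^ k / 2 = T ^ 2 / 2 * A ^ k by ring]; gcongr
  have hrev : ‖-((T ^ 2 / 2 * A ^ k : ℝ) : ℂ) * Λ (M (P (p n)))‖ -
      ‖Λ φ₀ + (A : ℂ) * Λ (p n) + (T : ℂ) * Λ φ₁ -
        ((T ^ 2 / 2 : ℝ) : ℂ) * Λ (M (u₀ + G)) + Λ E‖ ≤ ‖Λ (u T)‖ := by
    rw [hdecomp]
    have := norm_sub_le_norm_add (-((T ^ 2 / 2 * A ^ k : ℝ) : ℂ) * Λ (M (P (p n))))
      (Λ φ₀ + (A : ℂ) * Λ (p n) + (T : ℂ) * Λ φ₁ -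
        ((T ^ 2 / 2 : ℝ) : ℂ) * Λ (M (u₀ + G)) + Λ E)
    exact this
  have hd3A : l * C₁ * C₂ * d * d * A ≤ d * ‖γ‖ / 8 * A := by
    have : 8 * d * (l * C₁ * C₂) * d * A ≤ ‖γ‖ * d * A := by gcongr
    linarith
  linarith

end Model

/-! ### Transfer from the Banach space model to spaces of distributions -/

section Transfer

variable {X : Type*} [NormedAddCommGroup X] [NormedSpace ℂ X]
  {D : Type*} [AddCommGroup D] [Module ℂ D]

/-- The linear map `ι` is bounded for the extended norm `N`. -/
def BoundedInto (N : D → ℝ≥0∞) (ι : X →ₗ[ℂ] D) : Prop :=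
  ∃ C : NNReal, ∀ x, N (ι x) ≤ C * ‖x‖ₑ

/-- Every vector of `X` is a limit of vectors which `ι` maps into the set `S`. -/
def DensePreimage (S : Set D) (ι : X →ₗ[ℂ] D) : Prop :=
  ∀ x : X, ∀ ε : ℝ, 0 < ε → ∃ y, ι y ∈ S ∧ ‖x - y‖ < ε

theorem BoundedInto.tendsto {N : D → ℝ≥0∞} {ι : X →ₗ[ℂ] D} (h : BoundedInto N ι) {α : Type*}
    {l : Filter α} {f : α → X} (hf : Tendsto f l (𝓝 0)) :
    Tendsto (fun a => N (ι (f a))) l (𝓝 0) := by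
  obtain ⟨C, hC⟩ := h
  have h1 : Tendsto (fun a => (C : ℝ≥0∞) * ‖f a‖ₑ) l (𝓝 0) := by
    have := ENNReal.Tendsto.const_mul (a := (C : ℝ≥0∞)) hf.enorm (Or.inr ENNReal.coe_ne_top)
    simpa using this
  exact tendsto_of_tendsto_of_tendsto_of_le_of_le tendsto_const_nhds h1 (fun _ => zero_le)
    (fun a => hC (f a))

theorem BoundedInto.inCompletion {N : D → ℝ≥0∞} {S : Set D} {ι : X →ₗ[ℂ] D} (h : BoundedInto N ι)
    (hd : DensePreimage S ι) (x : X) : InCompletion N S (ι x) := by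
  intro ε hε
  have : ∃ y : ℕ → X, (∀ n, ι (y n) ∈ S) ∧ Tendsto (fun n => x - y n) atTop (𝓝 0) := by
    choose y hy hxy using fun n : ℕ => hd x (1 / ((n : ℝ) + 1)) (by positivity)
    exact ⟨y, hy, squeeze_zero_norm (fun n => (hxy n).le) tendsto_one_div_add_atTop_nhds_zero_nat⟩
  obtain ⟨y, hy, hxy⟩ := this
  obtain ⟨n, hn⟩ := ((h.tendsto hxy).eventually_lt_const
    (by simpa using hε : 0 < ENNReal.ofReal ε)).exists
  exact ⟨ι (y n), hy n, by simpa using hn⟩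

theorem BoundedInto.inContinuous {N : D → ℝ≥0∞} {S : Set D} {ι : X →ₗ[ℂ] D} (h : BoundedInto N ι)
    (hd : DensePreimage S ι) {T : ℝ} {u : ℝ → X} (hu : ContinuousOn u (Icc 0 T)) :
    InContinuous N S T (fun t => ι (u t)) := by
  refine ⟨fun t _ => h.inCompletion hd _, fun t ht => ?_⟩
  have : Tendsto (fun r => u r - u t) (𝓝[Icc 0 T] t) (𝓝 0) := by
    have := (hu t ht).tendsto.sub_const (u t)
    simpa using this
  simpa using h.tendsto this

theorem BoundedInto.hasTimeDeriv {N : D → ℝ≥0∞} {ι : X →ₗ[ℂ] D} (h : BoundedInto N ι)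
    {T : ℝ} {u v : ℝ → X} (hu : ∀ t ∈ Icc 0 T, HasDerivWithinAt u (v t) (Icc 0 T) t) :
    HasTimeDeriv N T (fun t => ι (u t)) (fun t => ι (v t)) := by
  intro t ht
  have h1 := (hasDerivWithinAt_iff_tendsto_slope.1 (hu t ht)).sub_const (v t)
  rw [sub_self] at h1
  refine (h.tendsto h1).congr fun r => ?_
  rw [slope_def_module, map_sub, ← Complex.coe_smul, map_smul, map_sub]
  push_cast
  rfl

/-- Norm inflation, for an equation which becomes an ordinary differential equation
`u'' = -M (u + P u)` in the Banach space `X`. -/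
theorem normInflation_of_model [CompleteSpace X] {S : Set D} {wiener : D → ℝ≥0∞} {dxx : D → D}
    {IsPow : ℕ → D → D → Prop} {Z : ℝ → D → ℝ≥0∞} {k : ℕ} {s θ : ℝ} (hk : 2 ≤ k)
    (ι : X →ₗ[ℂ] D) (P : X → X) (M : X →L[ℂ] X) (Λ : X →L[ℂ] ℂ) (p : ℕ → X)
    (hdxx : ∀ f g, dxx (f + g) = dxx f + dxx g)
    (hw : BoundedInto wiener ι) (hZ : BoundedInto (Z s) ι) (hd : DensePreimage S ι)
    (hS : ∀ φ ∈ S, ∃ x, ι x = φ) (hpow : ∀ x, IsPow k (ι x) (ι (P x)))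
    (hM : ∀ x, ι (M x) - dxx (ι (M x)) = -dxx (ι x))
    (hZadd : ∀ f g, Z s (f + g) ≤ Z s f + Z s g) (hZneg : ∀ f, Z s (-f) = Z s f)
    (hΛ : ∃ C : NNReal, ∀ x, ‖Λ x‖ₑ ≤ C * Z θ (ι x))
    {K : ℝ} (hP0 : P 0 = 0)
    (hP : ∀ R x y, ‖x‖ ≤ R → ‖y‖ ≤ R → ‖P x - P y‖ ≤ K * R ^ (k - 1) * ‖x - y‖)
    (hPsmul : ∀ (a : ℂ) x, P (a • x) = a ^ k • P x) {c : ℝ} (hp : ∀ n, ‖p n‖ ≤ c)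
    (hpZ : ∀ a : ℂ, Tendsto (fun n => Z s (ι (a • p n))) atTop (𝓝 0))
    (hpΛ : Tendsto (fun n => Λ (p n)) atTop (𝓝 0)) {γ : ℂ} (hγ : γ ≠ 0)
    (hpM : Tendsto (fun n => Λ (M (P (p n)))) atTop (𝓝 γ)) :
    NormInflation S wiener dxx IsPow Z k s θ := by
  intro u₀ u₁ hu₀ hu₁ ε hε
  -- One third of `ε` for each approximation by test functions, and one third for the perturbation
  -- `A • p n`.
  obtain ⟨_, hφ₀S, hφ₀⟩ := hu₀ (ε / 3) (by positivity)
  obtain ⟨_, hφ₁S, hφ₁⟩ := hu₁ (ε / 3) (by positivity)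
  obtain ⟨φ₀, rfl⟩ := hS _ hφ₀S
  obtain ⟨φ₁, rfl⟩ := hS _ hφ₁S
  obtain ⟨C, hC⟩ := hΛ
  -- The height `C * ε⁻¹` compensates for the constant in `‖Λ x‖ₑ ≤ C * Z θ (ι x)`.
  obtain ⟨A, T, hT0, hTε, hev⟩ := eventually_exists_large_solution hk P M Λ p hP0 hP hPsmul hp hpΛ
    hγ hpM φ₀ φ₁ (C * ε⁻¹) hε
  obtain ⟨n, ⟨u, v, hu0, hv0, huv, hbig⟩, hsmall⟩ := (hev.and ((hpZ A).eventually_lt_const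
    (by simpa using (by positivity : 0 < ε / 3) : 0 < ENNReal.ofReal (ε / 3)))).exists
  have hcu : ContinuousOn u (Icc 0 T) := fun t ht => (huv t ht).1.continuousWithinAt
  have hcv : ContinuousOn v (Icc 0 T) := fun t ht => (huv t ht).2.continuousWithinAt
  have hPc : Continuous P := by
    rw [continuous_iff_continuousAt]
    intro x
    have hlip : LipschitzOnWith (Real.toNNReal (K * (‖x‖ + 1) ^ (k - 1))) P
        (Metric.ball x 1) := by
      refine LipschitzOnWith.of_dist_le_mul fun y hy z hz => ?_
      have hb : ∀ w ∈ Metric.ball x 1, ‖w‖ ≤ ‖x‖ + 1 := fun w hw => by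
        have : ‖w - x‖ < 1 := by simpa [dist_eq_norm] using hw
        calc ‖w‖ = ‖x + (w - x)‖ := by simp
          _ ≤ ‖x‖ + ‖w - x‖ := norm_add_le _ _
          _ ≤ _ := by linarith
      rw [dist_eq_norm, dist_eq_norm]
      refine (hP _ y z (hb y hy) (hb z hz)).trans ?_
      gcongr
      exact Real.le_coe_toNNReal _
    exact hlip.continuousOn.continuousAt (Metric.ball_mem_nhds x one_pos)
  have hca : ContinuousOn (fun t => -M (u t + P (u t))) (Icc 0 T) :=
    (M.continuous.comp_continuousOn (hcu.add (hPc.comp_continuousOn hcu))).neg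
  refine ⟨T, hT0, fun t => ι (u t), fun t => ι (v t), ⟨fun t => ι (-M (u t + P (u t))),
    fun t => ι (P (u t)), hw.inContinuous hd hcu, hw.inContinuous hd hcv, hw.inContinuous hd hca,
    hw.hasTimeDeriv fun t ht => (huv t ht).1, hw.hasTimeDeriv fun t ht => (huv t ht).2,
    fun t _ => ⟨hpow _, ?_⟩⟩, hZ.inContinuous hd hcu, hZ.inCompletion hd _, ?_, T, hT0, hTε,
    le_rfl, ?_⟩
  -- With `a = -M (u + P u)`, `hM` says `(1 - ∂ₓ²) a = ∂ₓ² (u + P u)`, which is the equation.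
  · have h1 := hM (u t + P (u t))
    have h2 : dxx (-ι (M (u t + P (u t)))) = -dxx (ι (M (u t + P (u t)))) :=
      (AddMonoidHom.mk' dxx hdxx).map_neg _
    have h3 : dxx (ι (u t + P (u t))) = dxx (ι (u t)) + dxx (ι (P (u t))) := by
      rw [map_add, hdxx]
    beta_reduce
    rw [map_neg, h2]
    rw [h3] at h1
    calc -ι (M (u t + P (u t))) - dxx (ι (u t)) - -dxx (ι (M (u t + P (u t))))
        = -(ι (M (u t + P (u t))) - dxx (ι (M (u t + P (u t))))) - dxx (ι (u t)) := by abel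
      _ = _ := by rw [h1]; abel
  · have h1 : Z s (ι (u 0) - u₀) < ENNReal.ofReal (ε / 3) + ENNReal.ofReal (ε / 3) := by
      have e : ι (u 0) - u₀ = -(u₀ - ι φ₀) + ι ((A : ℂ) • p n) := by
        rw [hu0, map_add]; abel
      rw [e]
      refine (hZadd _ _).trans_lt ?_
      rw [hZneg]
      exact ENNReal.add_lt_add hφ₀ hsmall
    have h2 : Z s (ι (v 0) - u₁) < ENNReal.ofReal (ε / 3) := by
      rw [hv0, ← hZneg, neg_sub]; exact hφ₁
    calc Z s (ι (u 0) - u₀) + Z s (ι (v 0) - u₁)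
        < ENNReal.ofReal (ε / 3) + ENNReal.ofReal (ε / 3) + ENNReal.ofReal (ε / 3) :=
          ENNReal.add_lt_add h1 h2
      _ = ENNReal.ofReal ε := by
          rw [← ENNReal.ofReal_add (by positivity) (by positivity),
            ← ENNReal.ofReal_add (by positivity) (by positivity)]
          congr 1; ring
  · by_contra hcon
    rw [not_lt] at hcon
    have h1 : ‖Λ (u T)‖ₑ ≤ C * ENNReal.ofReal ε⁻¹ := (hC _).trans (by gcongr)
    have h2 : (C : ℝ≥0∞) * ENNReal.ofReal ε⁻¹ = ENNReal.ofReal (C * ε⁻¹) := by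
      rw [ENNReal.ofReal_mul C.coe_nonneg, ENNReal.ofReal_coe_nnreal]
    rw [h2, ← ofReal_norm, ENNReal.ofReal_le_ofReal_iff (by positivity)] at h1
    linarith

end Transfer

/-! ### Powers for a bounded bilinear product -/

section Power

variable {X : Type*} [NormedAddCommGroup X] [NormedSpace ℂ X]

/-- The `(n + 1)`-st power of `x` for the bilinear product `B`. -/
noncomputable def bilinPow (B : X →L[ℂ] X →L[ℂ] X) (n : ℕ) (x : X) : X := (B x)^[n] x

variable {B : X →L[ℂ] X →L[ℂ] X}

theorem bilinPow_zero (x : X) : bilinPow B 0 x = x := rfl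

theorem bilinPow_succ (n : ℕ) (x : X) : bilinPow B (n + 1) x = B x (bilinPow B n x) := by
  simp [bilinPow, Function.iterate_succ_apply']

theorem bilinPow_smul (n : ℕ) (a : ℂ) (x : X) :
    bilinPow B n (a • x) = a ^ (n + 1) • bilinPow B n x := by
  induction n with
  | zero => simp [bilinPow_zero]
  | succ n ih =>
    rw [bilinPow_succ, ih, bilinPow_succ, map_smul, map_smul, smul_apply,
      smul_smul]
    ring_nf

theorem norm_bilinPow_le (hB : ∀ x y, ‖B x y‖ ≤ ‖x‖ * ‖y‖) (n : ℕ) (x : X) :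
    ‖bilinPow B n x‖ ≤ ‖x‖ ^ (n + 1) := by
  induction n with
  | zero => simp [bilinPow_zero]
  | succ n ih =>
    rw [bilinPow_succ, pow_succ']
    exact (hB _ _).trans (by gcongr)

theorem norm_bilinPow_sub_le (hB : ∀ x y, ‖B x y‖ ≤ ‖x‖ * ‖y‖) (n : ℕ) {R : ℝ} {x y : X}
    (hx : ‖x‖ ≤ R) (hy : ‖y‖ ≤ R) :
    ‖bilinPow B n x - bilinPow B n y‖ ≤ (n + 1) * R ^ n * ‖x - y‖ := by
  have hR : 0 ≤ R := (norm_nonneg _).trans hx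
  induction n with
  | zero => simp [bilinPow_zero]
  | succ n ih =>
    have e : bilinPow B (n + 1) x - bilinPow B (n + 1) y =
        B (x - y) (bilinPow B n x) + B y (bilinPow B n x - bilinPow B n y) := by
      simp [bilinPow_succ]
    rw [e]
    calc _ ≤ ‖x - y‖ * ‖bilinPow B n x‖ + ‖y‖ * ‖bilinPow B n x - bilinPow B n y‖ :=
          (norm_add_le _ _).trans (add_le_add (hB _ _) (hB _ _))
      _ ≤ ‖x - y‖ * R ^ (n + 1) + R * ((n + 1) * R ^ n * ‖x - y‖) := by
          gcongr
          exact (norm_bilinPow_le hB n x).trans (by gcongr)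
      _ = _ := by push_cast; ring

end Power

/-- A function which is bounded by `K` and has `L¹` norm at most `K` has `L^q` norm at most `K`. -/
theorem eLpNorm_le_of_enorm_le_of_lintegral_le {α E : Type*} [MeasurableSpace α] {μ : Measure α}
    [TopologicalSpace E] [ESeminormedAddMonoid E] {f : α → E} {q K : ℝ≥0∞} (hq : 1 ≤ q)
    (h₁ : ∀ᵐ x ∂μ, ‖f x‖ₑ ≤ K) (h₂ : ∫⁻ x, ‖f x‖ₑ ∂μ ≤ K) : eLpNorm f q μ ≤ K := by
  have hq0 : q ≠ 0 := (zero_lt_one.trans_le hq).ne'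
  rcases eq_or_ne q ∞ with rfl | hqt
  · rw [eLpNorm_exponent_top]
    exact essSup_le_of_ae_le _ h₁
  rcases eq_or_ne K ∞ with rfl | hK
  · exact le_top
  have hq1 : 1 ≤ q.toReal := by simpa using ENNReal.toReal_mono hqt hq
  rw [eLpNorm_eq_lintegral_rpow_enorm_toReal hq0 hqt]
  have h : ∫⁻ x, ‖f x‖ₑ ^ q.toReal ∂μ ≤ K ^ q.toReal := by
    calc ∫⁻ x, ‖f x‖ₑ ^ q.toReal ∂μ ≤ ∫⁻ x, K ^ (q.toReal - 1) * ‖f x‖ₑ ∂μ := by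
          refine lintegral_mono_ae (h₁.mono fun x hx => ?_)
          calc ‖f x‖ₑ ^ q.toReal = ‖f x‖ₑ ^ (q.toReal - 1) * ‖f x‖ₑ := by
                conv_lhs => rw [← sub_add_cancel q.toReal 1,
                  ENNReal.rpow_add_of_nonneg _ _ (by linarith) zero_le_one, ENNReal.rpow_one]
            _ ≤ _ := by gcongr
      _ = K ^ (q.toReal - 1) * ∫⁻ x, ‖f x‖ₑ ∂μ :=
          lintegral_const_mul' _ _ (ENNReal.rpow_ne_top_of_nonneg (by linarith) hK)
      _ ≤ K ^ (q.toReal - 1) * K := by gcongr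
      _ = K ^ q.toReal := by
          conv_rhs => rw [← sub_add_cancel q.toReal 1,
            ENNReal.rpow_add_of_nonneg _ _ (by linarith) zero_le_one, ENNReal.rpow_one]
  calc (∫⁻ x, ‖f x‖ₑ ^ q.toReal ∂μ) ^ (1 / q.toReal) ≤ (K ^ q.toReal) ^ (1 / q.toReal) := by
        gcongr
    _ = K := by rw [← ENNReal.rpow_mul, mul_one_div_cancel (by linarith), ENNReal.rpow_one]

/-! ### The circle -/

section Circle

/-- The Wiener algebra of the circle, as a space of sequences of Fourier coefficients. -/
abbrev WienerSeq : Type := lp (fun _ : ℤ => ℂ) 1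

namespace WienerSeq

theorem summable_norm (x : WienerSeq) : Summable fun n => ‖x n‖ := by
  simpa using (lp.memℓp x).summable (by simp)

theorem norm_eq (x : WienerSeq) : ‖x‖ = ∑' n, ‖x n‖ := by
  have := lp.norm_eq_tsum_rpow (p := 1) (by simp) x
  simpa using this

theorem memℓp {f : ℤ → ℂ} (hf : Summable fun n => ‖f n‖) : Memℓp f 1 :=
  memℓp_gen (by simpa using hf)

theorem enorm_eq (x : WienerSeq) : ‖x‖ₑ = ∑' n, ‖x n‖ₑ := by
  rw [← ofReal_norm, norm_eq, ENNReal.ofReal_tsum_of_nonneg (fun _ => norm_nonneg _)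
    (summable_norm x)]
  simp only [ofReal_norm]

/-- The function on the circle with given Fourier coefficients. -/
noncomputable def toFun : WienerSeq →L[ℂ] C(UnitAddCircle, ℂ) :=
  LinearMap.mkContinuous
    { toFun := fun x => ∑' n, x n • fourier n
      map_add' := fun x y => by
        rw [← Summable.tsum_add]
        · have h (a b : ℂ) (f : C(UnitAddCircle, ℂ)) : (a + b) • f = a • f + b • f := add_smul a b f
          exact tsum_congr fun n => h (x n) (y n) _
        · exact Summable.of_norm (by simpa [norm_smul, fourier_norm] using summable_norm x)
        · exact Summable.of_norm (by simpa [norm_smul, fourier_norm] using summable_norm y)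
      map_smul' := fun a x => by
        rw [RingHom.id_apply, ← tsum_const_smul'']
        simp only [lp.coeFn_smul, Pi.smul_apply, smul_assoc] } 1 fun x => by
      have h : Summable fun n => ‖x n • (fourier n : C(UnitAddCircle, ℂ))‖ := by
        simpa [norm_smul, fourier_norm] using summable_norm x
      rw [one_mul, norm_eq]
      simpa [norm_smul, fourier_norm] using norm_tsum_le_tsum_norm h

theorem hasSum_toFun (x : WienerSeq) :
    HasSum (fun n => x n • (fourier n : C(UnitAddCircle, ℂ))) (toFun x) :=
  (Summable.of_norm (by simpa [norm_smul, fourier_norm] using summable_norm x)).hasSum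

/-- The `n`-th Fourier coefficient, as a functional on continuous functions. -/
noncomputable def coeffCLM (n : ℤ) : C(UnitAddCircle, ℂ) →L[ℂ] ℂ :=
  LinearMap.mkContinuous
    { toFun := fun f => fourierCoeff f n
      map_add' := fun f g => by
        rw [ContinuousMap.coe_add, fourierCoeff.add]
        · rfl
        · exact f.continuous.integrable_of_hasCompactSupport (HasCompactSupport.of_compactSpace _)
        · exact g.continuous.integrable_of_hasCompactSupport (HasCompactSupport.of_compactSpace _)
      map_smul' := fun a f => fourierCoeff.const_smul f a n } 1 fun f => by
      rw [one_mul]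
      change ‖∫ t, _ ∂_‖ ≤ _
      refine (norm_integral_le_of_norm_le_const (C := ‖f‖) (Eventually.of_forall fun t => ?_)).trans
        (by simp)
      rw [norm_smul]
      have h1 : ‖(fourier (-n) t : ℂ)‖ = 1 := Circle.norm_coe _
      rw [h1, one_mul]
      exact f.norm_coe_le_norm t

theorem coeffCLM_apply (n : ℤ) (f : C(UnitAddCircle, ℂ)) : coeffCLM n f = fourierCoeff f n := rfl

theorem fourierCoeff_fourier (m n : ℤ) :
    fourierCoeff (fourier m : C(UnitAddCircle, ℂ)) n = if m = n then 1 else 0 := by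
  have h := (orthonormal_iff_ite.1 (orthonormal_fourier (T := 1))) n m
  rw [ContinuousMap.inner_toLp] at h
  rw [fourierCoeff]
  simp only [eq_comm (a := m)]
  rw [← h]
  refine integral_congr_ae (Eventually.of_forall fun t => ?_)
  simp only [smul_eq_mul]
  rw [fourier_neg, mul_comm]

theorem fourierCoeff_toFun (x : WienerSeq) : fourierCoeff (toFun x) = x := by
  funext n
  have h := (coeffCLM n).hasSum (hasSum_toFun x)
  simp only [map_smul, coeffCLM_apply, fourierCoeff_fourier] at h
  refine h.unique ?_
  convert! hasSum_ite_eq n (x n) using 2 with m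
  split_ifs with hm
  · simp [hm]
  · simp

/-- Multiplication by `fourier m`, on Fourier coefficients. -/
noncomputable def shift (m : ℤ) : WienerSeq →ₗᵢ[ℂ] WienerSeq where
  toFun x := ⟨fun n => x (n - m), memℓp ((Equiv.subRight m).summable_iff.2 (summable_norm x))⟩
  map_add' _ _ := rfl
  map_smul' _ _ := rfl
  norm_map' x := by
    rw [norm_eq, norm_eq]
    exact (Equiv.subRight m).tsum_eq fun n => ‖x n‖

theorem shift_apply (m n : ℤ) (x : WienerSeq) : shift m x n = x (n - m) := rfl

theorem toFun_shift (m : ℤ) (x : WienerSeq) : toFun (shift m x) = fourier m * toFun x := by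
  have h1 := hasSum_toFun (shift m x)
  have h2 := (hasSum_toFun x).mul_left (fourier m)
  rw [← (Equiv.subRight m).hasSum_iff] at h2
  refine h1.unique (h2.congr_fun fun n => ?_)
  ext t
  simp only [Function.comp, Equiv.subRight_apply, shift_apply, ContinuousMap.mul_apply,
    ContinuousMap.smul_apply, smul_eq_mul]
  rw [mul_left_comm, ← fourier_add, add_sub_cancel]

/-- Convolution is built as a series of translates converging absolutely in the Banach space. The
norm bound is then the triangle inequality, and `toFun` turns each translate into multiplication by
a character, so no double series has to be rearranged. -/
theorem summable_smul_shift (x y : WienerSeq) : Summable fun m => x m • shift m y :=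
  Summable.of_norm (by
    simpa [norm_smul, LinearIsometry.norm_map] using (summable_norm x).mul_right ‖y‖)

/-- The convolution product of sequences. -/
noncomputable def conv : WienerSeq →L[ℂ] WienerSeq →L[ℂ] WienerSeq :=
  LinearMap.mkContinuous₂
    (LinearMap.mk₂ ℂ (fun x y => ∑' m, x m • shift m y)
      (fun x x' y => by
        rw [← Summable.tsum_add (summable_smul_shift x y) (summable_smul_shift x' y)]
        simp only [lp.coeFn_add, Pi.add_apply, add_smul])
      (fun a x y => by
        rw [← tsum_const_smul'']
        simp only [lp.coeFn_smul, Pi.smul_apply, smul_assoc])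
      (fun x y y' => by
        rw [← Summable.tsum_add (summable_smul_shift x y) (summable_smul_shift x y')]
        simp only [map_add, smul_add])
      (fun a x y => by
        rw [← tsum_const_smul'']
        simp only [map_smul, smul_comm a])) 1 fun x y => by
    have h : Summable fun m => ‖x m • shift m y‖ := by
      simpa [norm_smul, LinearIsometry.norm_map] using (summable_norm x).mul_right ‖y‖
    rw [one_mul, norm_eq x, ← tsum_mul_right]
    simpa [norm_smul, LinearIsometry.norm_map] using norm_tsum_le_tsum_norm h

theorem norm_conv_le (x y : WienerSeq) : ‖conv x y‖ ≤ ‖x‖ * ‖y‖ := by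
  have := (conv.le_opNorm₂ x y).trans (by
    gcongr
    exact LinearMap.mkContinuous₂_norm_le _ zero_le_one _ : _ ≤ 1 * ‖x‖ * ‖y‖)
  rwa [one_mul] at this

theorem toFun_conv (x y : WienerSeq) : toFun (conv x y) = toFun x * toFun y := by
  have h1 := toFun.hasSum (summable_smul_shift x y).hasSum
  have h2 := (hasSum_toFun x).mul_right (toFun y)
  refine h1.unique (h2.congr_fun fun n => ?_)
  rw [map_smul, toFun_shift, smul_mul_assoc]

theorem toFun_bilinPow (n : ℕ) (x : WienerSeq) : toFun (bilinPow conv n x) = toFun x ^ (n + 1) := by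
  induction n with
  | zero => simp [bilinPow_zero]
  | succ n ih => rw [bilinPow_succ, toFun_conv, ih, pow_succ' _ (n + 1)]

/-- The symbol of `-∂ₓ² (1 - ∂ₓ²)⁻¹`. -/
noncomputable def _root_.GIBq.symbol (ξ : ℝ) : ℝ :=
  4 * Real.pi ^ 2 * ξ ^ 2 / (1 + 4 * Real.pi ^ 2 * ξ ^ 2)

theorem _root_.GIBq.symbol_nonneg (ξ : ℝ) : 0 ≤ symbol ξ := by
  unfold symbol; positivity

theorem _root_.GIBq.symbol_le_one (ξ : ℝ) : symbol ξ ≤ 1 := by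
  unfold symbol
  rw [div_le_one (by positivity)]; linarith

theorem _root_.GIBq.symbol_pos {ξ : ℝ} (hξ : ξ ≠ 0) : 0 < symbol ξ := by
  unfold symbol; positivity

/-- The identity `(1 - ∂ₓ²) M = -∂ₓ²` on the Fourier side, used for both geometries. -/
theorem _root_.GIBq.symbol_add_mul (ξ : ℝ) :
    symbol ξ + 4 * Real.pi ^ 2 * ξ ^ 2 * symbol ξ = 4 * Real.pi ^ 2 * ξ ^ 2 := by
  unfold symbol
  field_simp

/-- The Fourier multiplier `-∂ₓ² (1 - ∂ₓ²)⁻¹` on the circle. -/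
noncomputable def multiplier : WienerSeq →L[ℂ] WienerSeq :=
  have hle : ∀ (x : WienerSeq) (n : ℤ), ‖((symbol n : ℝ) : ℂ) * x n‖ ≤ ‖x n‖ := fun x n => by
    rw [norm_mul, Complex.norm_real, Real.norm_of_nonneg (symbol_nonneg _)]
    exact mul_le_of_le_one_left (norm_nonneg _) (symbol_le_one _)
  have hs : ∀ x : WienerSeq, Summable fun n : ℤ => ‖((symbol n : ℝ) : ℂ) * x n‖ := fun x =>
    Summable.of_nonneg_of_le (fun _ => norm_nonneg _) (hle x) (summable_norm x)
  LinearMap.mkContinuous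
    { toFun := fun x => ⟨fun n => ((symbol n : ℝ) : ℂ) * x n, memℓp (hs x)⟩
      map_add' := fun x y => lp.ext (by funext n; exact mul_add _ _ _)
      map_smul' := fun a x => lp.ext (by funext n; exact mul_left_comm _ _ _) } 1 fun x => by
      rw [one_mul, norm_eq, norm_eq]
      exact (hs x).tsum_le_tsum (hle x) (summable_norm x)

theorem multiplier_apply (x : WienerSeq) (n : ℤ) : multiplier x n = ((symbol n : ℝ) : ℂ) * x n :=
  rfl

end WienerSeq

end Circle

theorem one_le_bracket (ξ : ℝ) : 1 ≤ bracket ξ :=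
  Real.one_le_sqrt.2 (by nlinarith [sq_nonneg ξ])

theorem bracket_pos (ξ : ℝ) : 0 < bracket ξ := zero_lt_one.trans_le (one_le_bracket ξ)

theorem bracket_rpow_pos (ξ s : ℝ) : 0 < bracket ξ ^ s := Real.rpow_pos_of_pos (bracket_pos ξ) s

theorem bracket_rpow_le_one (ξ : ℝ) {s : ℝ} (hs : s ≤ 0) : bracket ξ ^ s ≤ 1 :=
  Real.rpow_le_one_of_one_le_of_nonpos (one_le_bracket ξ) hs

theorem abs_le_bracket (ξ : ℝ) : |ξ| ≤ bracket ξ := by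
  rw [← Real.sqrt_sq_eq_abs]
  exact Real.sqrt_le_sqrt (by linarith)

theorem tendsto_bracket_rpow_cocompact {s : ℝ} (hs : s < 0) :
    Tendsto (fun ξ => bracket ξ ^ s) (cocompact ℝ) (𝓝 0) := by
  have h1 : Tendsto bracket (cocompact ℝ) atTop :=
    tendsto_atTop_mono abs_le_bracket (tendsto_norm_cocompact_atTop (E := ℝ))
  have := (tendsto_rpow_neg_atTop (neg_pos.2 hs)).comp h1
  rwa [neg_neg] at this

section Circle

theorem enorm_bracket_rpow_mul_le (ξ : ℝ) {s : ℝ} (hs : s ≤ 0) (z : ℂ) :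
    ‖((bracket ξ ^ s : ℝ) : ℂ) * z‖ₑ ≤ ‖z‖ₑ := by
  rw [enorm_le_iff_norm_le, norm_mul, Complex.norm_real,
    Real.norm_of_nonneg (bracket_rpow_pos ξ s).le]
  exact mul_le_of_le_one_left (norm_nonneg _) (bracket_rpow_le_one ξ hs)

theorem flCircle_add (q : ℝ≥0∞) (hq : 1 ≤ q) (s : ℝ) (f g : ℤ → ℂ) :
    flCircle q s (f + g) ≤ flCircle q s f + flCircle q s g := by
  unfold flCircle
  refine le_trans (le_of_eq ?_) (eLpNorm_add_le (measurable_of_countable _).aestronglyMeasurable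
    (measurable_of_countable _).aestronglyMeasurable hq)
  simp only [Pi.add_apply, mul_add]
  rfl

theorem flCircle_neg (q : ℝ≥0∞) (s : ℝ) (f : ℤ → ℂ) : flCircle q s (-f) = flCircle q s f := by
  unfold flCircle
  rw [← eLpNorm_neg]
  simp only [Pi.neg_apply, mul_neg, Pi.neg_def, neg_neg]

namespace WienerSeq

/-- The inclusion of the Wiener algebra into the distributions on the circle. -/
noncomputable def incl : WienerSeq →ₗ[ℂ] (ℤ → ℂ) where
  toFun x := x
  map_add' _ _ := rfl
  map_smul' _ _ := rfl

theorem incl_apply (x : WienerSeq) : incl x = x := rfl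

theorem flCircle_le {q : ℝ≥0∞} (hq : 1 ≤ q) {s : ℝ} (hs : s ≤ 0) (x : WienerSeq) :
    flCircle q s x ≤ ‖x‖ₑ := by
  rw [enorm_eq]
  refine eLpNorm_le_of_enorm_le_of_lintegral_le hq (Eventually.of_forall fun n => ?_) ?_
  · exact (enorm_bracket_rpow_mul_le _ hs _).trans (ENNReal.le_tsum n)
  · rw [lintegral_count]
    exact ENNReal.tsum_le_tsum fun n => enorm_bracket_rpow_mul_le _ hs _

theorem boundedInto_flCircle {q : ℝ≥0∞} (hq : 1 ≤ q) {s : ℝ} (hs : s ≤ 0) :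
    BoundedInto (flCircle q s) incl :=
  ⟨1, fun x => by rw [ENNReal.coe_one, one_mul]; exact flCircle_le hq hs x⟩

theorem toFun_single (n : ℤ) (a : ℂ) :
    toFun (lp.single 1 n a) = a • (fourier n : C(UnitAddCircle, ℂ)) := by
  refine (hasSum_toFun _).unique ?_
  convert! hasSum_ite_eq n (a • (fourier n : C(UnitAddCircle, ℂ))) using 2 with m
  split_ifs with hm
  · subst hm; simp
  · rw [lp.single_apply_ne _ _ _ hm]
    exact zero_smul ℂ (fourier m : C(UnitAddCircle, ℂ))

theorem contDiff_fourier (n : ℤ) :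
    ContDiff ℝ ∞ fun x : ℝ => (fourier n : C(UnitAddCircle, ℂ)) (x : UnitAddCircle) := by
  simp only [fourier_coe_apply]
  refine Complex.contDiff_exp.comp ?_
  refine ContDiff.div_const ?_ _
  exact contDiff_const.mul Complex.ofRealCLM.contDiff

theorem densePreimage_incl : DensePreimage testCircle incl := by
  intro x ε hε
  have h := lp.hasSum_single (p := 1) (by simp) x
  obtain ⟨F, hF⟩ := (h.eventually (Metric.ball_mem_nhds x hε)).exists
  refine ⟨∑ n ∈ F, lp.single 1 n (x n), ⟨toFun (∑ n ∈ F, lp.single 1 n (x n)), ?_, ?_⟩, ?_⟩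
  · simp only [map_sum, toFun_single, ContinuousMap.coe_sum, Finset.sum_apply,
      ContinuousMap.coe_smul, Pi.smul_apply]
    exact ContDiff.sum fun n _ => (contDiff_fourier n).const_smul (x n : ℂ)
  · rw [fourierCoeff_toFun, incl_apply]
  · rw [← dist_eq_norm, dist_comm]
    exact hF

/-- Two integrations by parts, with boundary terms cancelling by periodicity, give coefficients of
size `O(|n|⁻²)`. -/
theorem summable_norm_fourierCoeff {φ : C(UnitAddCircle, ℂ)}
    (hφ : ContDiff ℝ 2 fun x : ℝ => φ (x : UnitAddCircle)) :
    Summable fun n => ‖fourierCoeff φ n‖ := by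
  set f : ℝ → ℂ := fun x => φ (x : UnitAddCircle) with hf
  have hper : Function.Periodic f 1 := fun x => by simp [hf]
  have hf1 : ContDiff ℝ 1 (deriv f) := hφ.deriv' (n := 1)
  have hf2 : Continuous (deriv (deriv f)) := hf1.continuous_deriv le_rfl
  have hper1 : deriv f 1 = deriv f 0 := by
    have : deriv f (0 + 1) = deriv f 0 := by
      rw [← deriv_comp_add_const]
      congr 1
      exact funext hper
    simpa using this
  have hper0 : f 1 = f 0 := by simpa using hper 0
  have key : ∀ {n : ℤ}, n ≠ 0 → ∀ {g : ℝ → ℂ}, ContDiff ℝ 1 g → g 1 = g 0 →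
      fourierCoeffOn zero_lt_one g n = 1 / (2 * Real.pi * Complex.I * n) *
        fourierCoeffOn zero_lt_one (deriv g) n := by
    intro n hn g hg hg1
    rw [fourierCoeffOn_of_hasDerivAt zero_lt_one hn
      (fun x _ => (hg.differentiable one_ne_zero x).hasDerivAt)
      ((hg.continuous_deriv le_rfl).intervalIntegrable _ _), hg1]
    have : (n : ℂ) ≠ 0 := by exact_mod_cast hn
    have := Complex.I_ne_zero
    have : (Real.pi : ℂ) ≠ 0 := by exact_mod_cast Real.pi_ne_zero
    push_cast
    field_simp
    ring
  have hco : ∀ n, fourierCoeff φ n = fourierCoeffOn zero_lt_one f n := by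
    intro n
    rw [fourierCoeff_eq_intervalIntegral _ _ 0, fourierCoeffOn_eq_integral]
    simp only [sub_zero, zero_add, hf]
    congr 1
    refine intervalIntegral.integral_congr fun x _ => ?_
    simp only [fourier_coe_apply]
    norm_num
  obtain ⟨C, hC⟩ : ∃ C, ∀ n : ℤ, ‖fourierCoeffOn zero_lt_one (deriv (deriv f)) n‖ ≤ C := by
    obtain ⟨C, hC⟩ := (isCompact_Icc (a := (0 : ℝ)) (b := 1)).exists_bound_of_continuousOn
      hf2.continuousOn
    refine ⟨C, fun n => ?_⟩
    rw [fourierCoeffOn_eq_integral, sub_zero, div_one, one_smul]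
    refine (intervalIntegral.norm_integral_le_of_norm_le_const (C := C) fun x hx => ?_).trans
      (by simp)
    rw [uIoc_of_le zero_le_one] at hx
    rw [norm_smul]
    refine (congrArg (· * _) (Circle.norm_coe _)).trans_le ?_
    rw [one_mul]
    exact hC x ⟨hx.1.le, hx.2⟩
  have hC0 : 0 ≤ C := (norm_nonneg _).trans (hC 0)
  have hsum : Summable fun n : ℤ => C * (1 / |(n : ℝ)| ^ 2) := by
    have := (Real.summable_one_div_int_pow (p := 2)).2 (by norm_num)
    simpa using this.mul_left C
  refine Summable.of_norm_bounded_eventually hsum ?_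
  filter_upwards [(Set.finite_singleton (0 : ℤ)).compl_mem_cofinite] with n hn
  have hn : n ≠ 0 := hn
  have hn' : (0 : ℝ) < |(n : ℝ)| := abs_pos.2 (by exact_mod_cast hn)
  rw [norm_norm, hco, key hn (hφ.of_le one_le_two) hper0, key hn hf1 hper1]
  simp only [norm_mul, norm_div, norm_one, Complex.norm_real, Complex.norm_I, Complex.norm_intCast,
    Complex.norm_ofNat, Real.norm_of_nonneg Real.pi_pos.le, mul_one]
  have hp : 1 ≤ 2 * Real.pi := by linarith [Real.pi_gt_three]
  have h1 : 1 / (2 * Real.pi * |(n : ℝ)|) ≤ 1 / |(n : ℝ)| :=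
    one_div_le_one_div_of_le hn' (le_mul_of_one_le_left hn'.le hp)
  calc _ ≤ 1 / |(n : ℝ)| * (1 / |(n : ℝ)| * C) := by
        gcongr
        exact hC n
    _ = _ := by field_simp

theorem exists_incl_eq_of_mem_testCircle (c : ℤ → ℂ) (hc : c ∈ testCircle) : ∃ x, incl x = c := by
  obtain ⟨φ, hφ, rfl⟩ := hc
  exact ⟨⟨fourierCoeff φ, memℓp (summable_norm_fourierCoeff (hφ.of_le (by norm_cast)))⟩, rfl⟩

theorem incl_multiplier_sub_dxxCircle (x : WienerSeq) :
    incl (multiplier x) - dxxCircle (incl (multiplier x)) = -dxxCircle (incl x) := by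
  funext n
  have h : ((symbol n : ℝ) : ℂ) + 4 * Real.pi ^ 2 * n ^ 2 * (symbol n : ℝ) =
      4 * Real.pi ^ 2 * n ^ 2 := by exact_mod_cast symbol_add_mul n
  simp only [Pi.sub_apply, Pi.neg_apply, dxxCircle, incl_apply, multiplier_apply]
  linear_combination x n * h + (4 * Real.pi ^ 2 * n ^ 2 * x n * (1 - (symbol n : ℝ))) * (Complex.I_sq)

/-- Two frequencies, both large, whose `k`-fold sums have `1` as a resonance. -/
noncomputable def resonantPair (k : ℕ) (n : ℕ) : WienerSeq :=
  lp.single 1 (n : ℤ) 1 + lp.single 1 (1 - (k - 1) * n : ℤ) 1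

theorem norm_resonantPair_le (k n : ℕ) : ‖resonantPair k n‖ ≤ 2 := by
  refine (norm_add_le _ _).trans ?_
  rw [lp.norm_single (by simp), lp.norm_single (by simp)]
  norm_num

theorem fourier_pow (n : ℤ) (j : ℕ) :
    (fourier n : C(UnitAddCircle, ℂ)) ^ j = fourier (j * n) := by
  ext t
  simp [fourier_apply, mul_smul, AddCircle.toCircle_nsmul]

/-- Only one term of the binomial expansion has frequency `1`. The offset `1` in the second
frequency is there because `symbol` vanishes at `0`, so a resonance at the origin would be
invisible. -/
theorem bilinPow_resonantPair {k : ℕ} (hk : 2 ≤ k) (n : ℕ) :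
    bilinPow conv (k - 1) (resonantPair k n) 1 = k := by
  rw [← fourierCoeff_toFun, toFun_bilinPow, Nat.sub_add_cancel (by omega), ← coeffCLM_apply,
    resonantPair, map_add, toFun_single, toFun_single, one_smul, one_smul, add_pow, map_sum]
  have h : ∀ j ∈ Finset.range (k + 1), coeffCLM 1 ((fourier (n : ℤ) : C(UnitAddCircle, ℂ)) ^ j *
      fourier (1 - (k - 1) * n : ℤ) ^ (k - j) * ((k.choose j : ℕ) : C(UnitAddCircle, ℂ))) =
      if j = k - 1 then (k : ℂ) else 0 := by
    intro j hj
    have hj : j ≤ k := Nat.lt_succ_iff.1 (Finset.mem_range.1 hj)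
    have e : (fourier (n : ℤ) : C(UnitAddCircle, ℂ)) ^ j * fourier (1 - (k - 1) * n : ℤ) ^ (k - j) *
        ((k.choose j : ℕ) : C(UnitAddCircle, ℂ)) = (k.choose j : ℂ) •
        (fourier (j * n + (k - j : ℕ) * (1 - (k - 1) * n) : ℤ) : C(UnitAddCircle, ℂ)) := by
      rw [fourier_pow, fourier_pow]
      ext t
      simp [fourier_add, mul_comm]
    rw [e, map_smul, coeffCLM_apply, fourierCoeff_fourier]
    -- With `r = k - j`, the frequency minus one factors as `(1 - r) (k n - 1)`, and `k n = 1` is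
    -- impossible for `k ≥ 2`.
    have h1 : ((j * n + (k - j : ℕ) * (1 - (k - 1) * n) : ℤ) = 1) ↔ j = k - 1 := by
      obtain ⟨r, rfl⟩ := Nat.exists_eq_add_of_le hj
      have e1 : (j * n + (j + r - j : ℕ) * (1 - ((j + r : ℕ) - 1) * n) : ℤ) - 1 =
          (1 - r) * ((j + r : ℕ) * n - 1) := by
        rw [Nat.add_sub_cancel_left]; push_cast; ring
      rw [← sub_eq_zero, e1, mul_eq_zero]
      constructor
      · rintro (h | h)
        · omega
        · have : ((j + r : ℕ) : ℤ) * n = 1 := by linarith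
          have := Int.eq_one_or_neg_one_of_mul_eq_one this
          omega
      · intro h; left; omega
    simp only [h1]
    split_ifs with hjk
    · rw [hjk, Nat.choose_symm (by omega : 1 ≤ k)]; simp
    · simp
  rw [Finset.sum_congr rfl h, Finset.sum_ite_eq' , if_pos (Finset.mem_range.2 (by omega))]

theorem flCircle_smul_single {q : ℝ≥0∞} (hq : 1 ≤ q) (s : ℝ) (m : ℤ) (a : ℂ) :
    flCircle q s (lp.single 1 m a : WienerSeq) ≤ ENNReal.ofReal (bracket m ^ s) * ‖a‖ₑ := by
  have e : (fun n : ℤ => ((bracket n ^ s : ℝ) : ℂ) * (lp.single 1 m a : WienerSeq) n) =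
      fun n => (lp.single 1 m (((bracket m ^ s : ℝ) : ℂ) * a) : WienerSeq) n := by
    funext n
    rcases eq_or_ne n m with rfl | h
    · simp
    · simp [h]
  have e' : flCircle q s (lp.single 1 m a : WienerSeq) =
      flCircle q 0 (lp.single 1 m (((bracket m ^ s : ℝ) : ℂ) * a) : WienerSeq) := by
    unfold flCircle
    rw [e]; simp only [Real.rpow_zero, Complex.ofReal_one, one_mul]
  rw [e']
  refine (flCircle_le hq le_rfl _).trans_eq ?_
  rw [← ofReal_norm, lp.norm_single (by simp), norm_mul, Complex.norm_real,
    Real.norm_of_nonneg (bracket_rpow_pos _ _).le, ENNReal.ofReal_mul (bracket_rpow_pos _ _).le,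
    ofReal_norm]

theorem tendsto_flCircle_single {q : ℝ≥0∞} (hq : 1 ≤ q) {s : ℝ} (hs : s < 0) (a : ℂ) :
    Tendsto (fun m => flCircle q s (lp.single 1 m a : WienerSeq)) cofinite (𝓝 0) := by
  have h1 : Tendsto (fun m : ℤ => bracket m ^ s) cofinite (𝓝 0) := by
    rw [← cocompact_eq_cofinite]
    exact (tendsto_bracket_rpow_cocompact hs).comp Int.isClosedEmbedding_coe_real.tendsto_cocompact
  have h2 := ENNReal.Tendsto.mul_const (b := ‖a‖ₑ) (ENNReal.tendsto_ofReal h1)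
    (Or.inr enorm_ne_top)
  rw [ENNReal.ofReal_zero, zero_mul] at h2
  exact tendsto_of_tendsto_of_tendsto_of_le_of_le tendsto_const_nhds h2 (fun _ => zero_le)
    fun m => flCircle_smul_single hq s m a

theorem injective_resonant {k : ℕ} (hk : 2 ≤ k) :
    Function.Injective fun n : ℕ => (1 - (k - 1) * n : ℤ) := by
  intro a b h
  have h : ((k : ℤ) - 1) * a = (k - 1) * b := by simpa using h
  have := mul_left_cancel₀ (by omega) h
  exact_mod_cast this

end WienerSeq

open WienerSeq in
theorem normInflationCircle_flCircle {k : ℕ} (hk : 2 ≤ k) {s θ : ℝ} (hs : s < 0) {q : ℝ≥0∞}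
    (hq : 1 ≤ q) : NormInflationCircle (flCircle q) k s θ := by
  have hq0 : q ≠ 0 := (zero_lt_one.trans_le hq).ne'
  -- `Λ` is the Fourier coefficient at frequency `1`. A single coefficient is controlled by every
  -- weighted `ℓ^q` norm, and here the limit `γ` is attained for every `n`.
  refine normInflation_of_model hk incl (bilinPow conv (k - 1)) multiplier
    (coeffCLM 1 ∘L toFun) (resonantPair k) (K := k) (c := 2) (γ := (symbol 1 : ℝ) * k)
    (fun f g => ?_) (boundedInto_flCircle le_rfl le_rfl) (boundedInto_flCircle hq hs.le)
    densePreimage_incl exists_incl_eq_of_mem_testCircle (fun x => ?_)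
    incl_multiplier_sub_dxxCircle (flCircle_add q hq s) (flCircle_neg q s) ?_ ?_ ?_ ?_
    (norm_resonantPair_le k) (fun a => ?_) ?_ ?_ ?_
  · funext n; exact mul_add _ _ _
  · refine ⟨toFun x, (fourierCoeff_toFun x).symm, ?_⟩
    have h := fourierCoeff_toFun (bilinPow conv (k - 1) x)
    rw [toFun_bilinPow, Nat.sub_add_cancel (by omega)] at h
    exact h.symm
  · refine ⟨Real.toNNReal ((bracket 1 ^ θ)⁻¹), fun x => ?_⟩
    have h := enorm_le_eLpNorm_count (fun n : ℤ => ((bracket n ^ θ : ℝ) : ℂ) * x n) 1 hq0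
    have h1 : (coeffCLM 1 ∘L toFun) x = x 1 := congrFun (fourierCoeff_toFun x) 1
    have hb := bracket_rpow_pos 1 θ
    calc ‖(coeffCLM 1 ∘L toFun) x‖ₑ =
        ENNReal.ofReal ((bracket 1 ^ θ)⁻¹) * ‖((bracket 1 ^ θ : ℝ) : ℂ) * x 1‖ₑ := by
          rw [h1, ← ofReal_norm, ← ofReal_norm, ← ENNReal.ofReal_mul (by positivity), norm_mul,
            Complex.norm_real, Real.norm_of_nonneg hb.le, inv_mul_cancel_left₀ hb.ne']
      _ ≤ _ := by
          gcongr
          · exact le_rfl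
          · rw [Int.cast_one] at h; exact h
  · refine norm_le_zero_iff.1 ((norm_bilinPow_le norm_conv_le (k - 1) 0).trans_eq ?_)
    simp
  · intro R x y hx hy
    have := norm_bilinPow_sub_le norm_conv_le (k - 1) hx hy
    rwa [Nat.cast_sub (by omega), Nat.cast_one, sub_add_cancel] at this
  · intro a x
    have := bilinPow_smul (B := conv) (k - 1) a x
    rwa [Nat.sub_add_cancel (by omega)] at this
  · have h1 := (tendsto_flCircle_single hq hs a).comp
      ((Nat.cast_injective (R := ℤ)).tendsto_cofinite)
    have h2 := (tendsto_flCircle_single hq hs a).comp (injective_resonant hk).tendsto_cofinite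
    rw [Nat.cofinite_eq_atTop] at h1 h2
    have h3 := h1.add h2
    rw [add_zero] at h3
    refine tendsto_of_tendsto_of_tendsto_of_le_of_le tendsto_const_nhds h3 (fun _ => zero_le)
      fun n => ?_
    refine le_trans (le_of_eq ?_) (flCircle_add q hq s _ _)
    rw [resonantPair, smul_add, ← lp.single_smul, ← lp.single_smul]
    rw [smul_eq_mul, mul_one]
    rfl
  · refine tendsto_const_nhds.congr' ?_
    filter_upwards [eventually_gt_atTop 1] with n hn
    have h1 : (coeffCLM 1 ∘L toFun) (resonantPair k n) = resonantPair k n 1 :=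
      congrFun (fourierCoeff_toFun _) 1
    have h2 : (1 : ℤ) ≠ n := by omega
    have h3 : (1 : ℤ) ≠ 1 - (k - 1) * n := by
      have : (0 : ℤ) < (k - 1) * n := by
        apply mul_pos <;> omega
      omega
    rw [h1, resonantPair]
    simp [h2, h3]
  · have := symbol_pos one_ne_zero
    simp only [ne_eq, mul_eq_zero, Complex.ofReal_eq_zero, Nat.cast_eq_zero, not_or]
    exact ⟨this.ne', by omega⟩
  · refine tendsto_const_nhds.congr fun n => ?_
    have h1 : (coeffCLM 1 ∘L toFun) (multiplier (bilinPow conv (k - 1) (resonantPair k n))) =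
      multiplier (bilinPow conv (k - 1) (resonantPair k n)) 1 := congrFun (fourierCoeff_toFun _) 1
    rw [h1, multiplier_apply, bilinPow_resonantPair hk]
    simp

end Circle

/-! ### Tempered distributions given by functions -/

section Represents

variable {g g₁ g₂ : ℝ → ℂ} {f f₁ f₂ : 𝓢'(ℝ, ℂ)}

/-- Only the products of `g` with Schwartz functions are known to be measurable; `g` is the
pointwise limit of its products with bumps equal to one on growing balls. -/
theorem Represents.aestronglyMeasurable (h : Represents g f) :
    AEStronglyMeasurable g volume := by
  let b (n : ℕ) : ContDiffBump (0 : ℝ) := ⟨n + 1, n + 2, by positivity, by linarith⟩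
  have hc (n : ℕ) : HasCompactSupport fun x => (b n x : ℂ) :=
    (b n).hasCompactSupport.comp_left (g := fun y : ℝ => (y : ℂ)) rfl
  have hd (n : ℕ) : ContDiff ℝ ∞ fun x => (b n x : ℂ) :=
    Complex.ofRealCLM.contDiff.comp (b n).contDiff
  refine aestronglyMeasurable_of_tendsto_ae atTop
    (fun n => (h ((hc n).toSchwartzMap (hd n))).1.aestronglyMeasurable)
    (Eventually.of_forall fun x => tendsto_const_nhds.congr' ?_)
  obtain ⟨N, hN⟩ := exists_nat_ge |x|
  filter_upwards [eventually_ge_atTop N] with n hn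
  have hn : (N : ℝ) ≤ n := by exact_mod_cast hn
  have : b n x = 1 := (b n).one_of_mem_closedBall (by
    rw [mem_closedBall_zero_iff, Real.norm_eq_abs]
    change |x| ≤ n + 1
    linarith)
  change g x = (b n x : ℂ) * g x
  rw [this, Complex.ofReal_one, one_mul]

theorem Represents.add (h₁ : Represents g₁ f₁) (h₂ : Represents g₂ f₂) :
    Represents (g₁ + g₂) (f₁ + f₂) := by
  intro φ
  have e : (fun x => φ x * (g₁ + g₂) x) = fun x => φ x * g₁ x + φ x * g₂ x := by
    funext x; exact mul_add _ _ _
  rw [e]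
  refine ⟨(h₁ φ).1.add (h₂ φ).1, ?_⟩
  rw [integral_add (h₁ φ).1 (h₂ φ).1, ← (h₁ φ).2, ← (h₂ φ).2]
  rfl

theorem Represents.neg (h : Represents g f) : Represents (-g) (-f) := by
  intro φ
  have e : (fun x => φ x * (-g) x) = fun x => -(φ x * g x) := by
    funext x; exact mul_neg _ _
  rw [e]
  refine ⟨(h φ).1.neg, ?_⟩
  rw [integral_neg, ← (h φ).2]
  rfl

theorem Represents.enorm_apply_le {q q' : ℝ≥0∞} [q'.HolderConjugate q] (h : Represents g f)
    (φ : 𝓢(ℝ, ℂ)) : ‖f φ‖ₑ ≤ eLpNorm φ q' volume * eLpNorm g q volume := by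
  rw [(h φ).2]
  refine (enorm_integral_le_lintegral_enorm _).trans ?_
  rw [← eLpNorm_one_eq_lintegral_enorm]
  have h₂ := eLpNorm_smul_le_mul_eLpNorm (p := q') (q := q) (r := 1) h.aestronglyMeasurable
    (φ.continuous.aestronglyMeasurable (μ := volume))
  exact h₂

theorem represents_toTemperedDistribution {p : ℝ≥0∞} [hp : Fact (1 ≤ p)]
    (y : Lp ℂ p (volume : Measure ℝ)) : Represents y (Lp.toTemperedDistribution y) := by
  intro φ
  refine ⟨?_, by simp⟩
  have := ENNReal.HolderConjugate.inv_one_sub_inv' hp.out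
  have : ((1 - p⁻¹)⁻¹).HolderConjugate p := this.symm
  have h : Integrable ((φ : ℝ → ℂ) * (y : ℝ → ℂ)) volume :=
    MemLp.integrable_mul (φ.memLp (1 - p⁻¹)⁻¹ volume) (Lp.memLp y)
  exact h

theorem represents_schwartz (ψ : 𝓢(ℝ, ℂ)) :
    Represents ψ (SchwartzMap.toTemperedDistributionCLM ℝ ℂ volume ψ) := by
  intro φ
  refine ⟨?_, by simp⟩
  have : (fun x => φ x * ψ x) = SchwartzMap.pairing (ContinuousLinearMap.mul ℂ ℂ) φ ψ := by
    funext x; simp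
  rw [this]
  exact SchwartzMap.integrable _

end Represents

/-- The norms are infima over representing functions, and equal `∞` if there are none. Passing to `C
+ 1` avoids the product `0 * ∞ = 0`. -/
theorem le_add_one_mul_iInf₂ {ι : Sort*} {κ : ι → Sort*} {a : ℝ≥0∞} {C : NNReal}
    {F : (i : ι) → κ i → ℝ≥0∞} (h : ∀ i j, a ≤ C * F i j) :
    a ≤ ((C + 1 : NNReal) : ℝ≥0∞) * ⨅ i, ⨅ j, F i j := by
  have h0 : ((C + 1 : NNReal) : ℝ≥0∞) ≠ 0 := by
    simp
  rw [ENNReal.mul_iInf_of_ne h0 ENNReal.coe_ne_top]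
  refine le_iInf fun i => ?_
  rw [ENNReal.mul_iInf_of_ne h0 ENNReal.coe_ne_top]
  refine le_iInf fun j => (h i j).trans ?_
  gcongr
  simp

/-! ### Fourier–Lebesgue norms on the line -/

section FourierLebesgue

theorem measurable_bracket_rpow (s : ℝ) : Measurable fun ξ : ℝ => ((bracket ξ ^ s : ℝ) : ℂ) := by
  unfold bracket
  fun_prop

theorem flLine_add {q : ℝ≥0∞} (hq : 1 ≤ q) (s : ℝ) (f₁ f₂ : 𝓢'(ℝ, ℂ)) :
    flLine q s (f₁ + f₂) ≤ flLine q s f₁ + flLine q s f₂ := by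
  refine ENNReal.le_iInf₂_add_iInf₂ fun g₁ h₁ g₂ h₂ => ?_
  refine (iInf₂_le (g₁ + g₂) (by rw [FourierTransform.fourier_add]; exact h₁.add h₂)).trans ?_
  refine le_trans (le_of_eq ?_) (eLpNorm_add_le
    ((measurable_bracket_rpow s).aestronglyMeasurable.mul h₁.aestronglyMeasurable)
    ((measurable_bracket_rpow s).aestronglyMeasurable.mul h₂.aestronglyMeasurable) hq)
  congr 1
  funext ξ
  exact mul_add _ _ _

theorem flLine_neg (q : ℝ≥0∞) (s : ℝ) (f : 𝓢'(ℝ, ℂ)) : flLine q s (-f) = flLine q s f := by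
  have key (f : 𝓢'(ℝ, ℂ)) : flLine q s (-f) ≤ flLine q s f := by
    refine le_iInf₂ fun g h => ?_
    refine (iInf₂_le (-g) (by rw [FourierTransform.fourier_neg]; exact h.neg)).trans (le_of_eq ?_)
    rw [← eLpNorm_neg]
    congr 1
    funext ξ
    simp
  exact le_antisymm (key f) (by simpa using key (-f))

/-- Hölder's inequality, after moving the weight `⟨ξ⟩ ^ (-θ)` onto `χ`, which stays Schwartz
whatever the sign of `θ`. -/
theorem exists_enorm_fourier_le_flLine {q : ℝ≥0∞} (hq : 1 ≤ q) (θ : ℝ) (χ : 𝓢(ℝ, ℂ)) :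
    ∃ C : NNReal, ∀ f : 𝓢'(ℝ, ℂ), ‖(𝓕 f) χ‖ₑ ≤ C * flLine q θ f := by
  have hq' := (ENNReal.HolderConjugate.inv_one_sub_inv' hq).symm
  set q' := (1 - q⁻¹)⁻¹ with hqdef
  have hb : Function.HasTemperateGrowth fun ξ : ℝ => ((bracket ξ ^ (-θ) : ℝ) : ℂ) := by
    have h := Function.hasTemperateGrowth_one_add_norm_sq_rpow ℝ (-θ / 2)
    have e : (fun ξ : ℝ => ((bracket ξ ^ (-θ) : ℝ) : ℂ)) =
        Complex.ofReal ∘ fun ξ : ℝ => (1 + ‖ξ‖ ^ 2) ^ (-θ / 2) := by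
      funext ξ
      simp only [Function.comp, bracket, Real.sqrt_eq_rpow, Real.norm_eq_abs, sq_abs]
      rw [← Real.rpow_mul (by positivity)]
      congr 2
      ring
    rw [e]
    exact Function.Complex.hasTemperateGrowth_ofReal.comp h
  set ψ := SchwartzMap.smulLeftCLM ℂ (fun ξ : ℝ => ((bracket ξ ^ (-θ) : ℝ) : ℂ)) χ with hψ
  refine ⟨(eLpNorm ψ q' volume).toNNReal + 1, fun f => le_add_one_mul_iInf₂ fun g h => ?_⟩
  rw [ENNReal.coe_toNNReal (ψ.eLpNorm_lt_top q' volume).ne, (h χ).2]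
  refine (enorm_integral_le_lintegral_enorm _).trans ?_
  have e : (fun ξ => χ ξ * g ξ) = (ψ : ℝ → ℂ) • fun ξ => ((bracket ξ ^ θ : ℝ) : ℂ) * g ξ := by
    funext ξ
    have h1 : ((bracket ξ ^ (-θ) : ℝ) : ℂ) * ((bracket ξ ^ θ : ℝ) : ℂ) = 1 := by
      rw [← Complex.ofReal_mul, ← Real.rpow_add (bracket_pos ξ)]
      simp
    simp only [Pi.smul_apply', hψ, SchwartzMap.smulLeftCLM_apply_apply hb, smul_eq_mul]
    linear_combination -χ ξ * g ξ * h1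
  rw [← eLpNorm_one_eq_lintegral_enorm, e]
  exact eLpNorm_smul_le_mul_eLpNorm (r := 1)
    ((measurable_bracket_rpow θ).aestronglyMeasurable.mul h.aestronglyMeasurable)
    ψ.continuous.aestronglyMeasurable

end FourierLebesgue

/-! ### Modulation and Wiener amalgam norms -/

section Modulation

variable {ρ : ℝ → ℝ}

theorem lpLine_add {p : ℝ≥0∞} (hp : 1 ≤ p) (f₁ f₂ : 𝓢'(ℝ, ℂ)) :
    lpLine p (f₁ + f₂) ≤ lpLine p f₁ + lpLine p f₂ :=
  ENNReal.le_iInf₂_add_iInf₂ fun g₁ h₁ g₂ h₂ => (iInf₂_le (g₁ + g₂) (h₁.add h₂)).trans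
    (eLpNorm_add_le h₁.aestronglyMeasurable h₂.aestronglyMeasurable hp)

theorem lpLine_neg (p : ℝ≥0∞) (f : 𝓢'(ℝ, ℂ)) : lpLine p (-f) = lpLine p f := by
  have key (f : 𝓢'(ℝ, ℂ)) : lpLine p (-f) ≤ lpLine p f :=
    le_iInf₂ fun g h => (iInf₂_le (-g) h.neg).trans_eq (eLpNorm_neg g p volume)
  exact le_antisymm (key f) (by simpa using key (-f))

theorem exists_enorm_apply_le_lpLine {p : ℝ≥0∞} (hp : 1 ≤ p) (φ : 𝓢(ℝ, ℂ)) :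
    ∃ C : NNReal, ∀ f : 𝓢'(ℝ, ℂ), ‖f φ‖ₑ ≤ C * lpLine p f := by
  have hq' := (ENNReal.HolderConjugate.inv_one_sub_inv' hp).symm
  refine ⟨(eLpNorm φ (1 - p⁻¹)⁻¹ volume).toNNReal + 1, fun f => le_add_one_mul_iInf₂ fun g h => ?_⟩
  rw [ENNReal.coe_toNNReal (φ.eLpNorm_lt_top _ volume).ne]
  exact h.enorm_apply_le φ

/-- A test function carrying the factor `σ_n` sees only the piece `P_n f`, so such a pairing is
bounded by one term of the norm, at the price of a constant depending on `n` and `θ`. -/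
theorem fourier_smulLeft_sigma (n : ℤ) (f : 𝓢'(ℝ, ℂ)) (χ : 𝓢(ℝ, ℂ)) :
    (𝓕 f) (SchwartzMap.smulLeftCLM ℂ (fun ξ => (sigma ρ n ξ : ℂ)) χ) = freqProj ρ n f (𝓕 χ) := by
  rw [freqProj, TemperedDistribution.fourierMultiplierCLM_apply_apply,
    FourierTransform.fourierInv_fourier_eq, TemperedDistribution.fourier_apply]

/-- The weight `(1 + |n|) ^ s`. -/
noncomputable def intWeight (s : ℝ) (n : ℤ) : ℝ := (1 + |(n : ℝ)|) ^ s

theorem intWeight_pos (s : ℝ) (n : ℤ) : 0 < intWeight s n := by unfold intWeight; positivity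

theorem intWeight_le_one {s : ℝ} (hs : s ≤ 0) (n : ℤ) : intWeight s n ≤ 1 :=
  Real.rpow_le_one_of_one_le_of_nonpos (by linarith [abs_nonneg (n : ℝ)]) hs

theorem modulation_add (p q : ℝ≥0∞) (hp : 1 ≤ p) (hq : 1 ≤ q) (s : ℝ) (f₁ f₂ : 𝓢'(ℝ, ℂ)) :
    modulation ρ p q s (f₁ + f₂) ≤ modulation ρ p q s f₁ + modulation ρ p q s f₂ := by
  unfold modulation
  refine le_trans (eLpNorm_mono_enorm fun n => ?_)
    (eLpNorm_add_le (measurable_of_countable _).aestronglyMeasurable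
    (measurable_of_countable _).aestronglyMeasurable hq)
  simp only [enorm_eq_self, Pi.add_apply, ← mul_add, freqProj, map_add]
  gcongr
  exact lpLine_add hp _ _

theorem modulation_neg (p q : ℝ≥0∞) (s : ℝ) (f : 𝓢'(ℝ, ℂ)) :
    modulation ρ p q s (-f) = modulation ρ p q s f := by
  simp only [modulation, freqProj, map_neg, lpLine_neg]

theorem exists_enorm_fourier_le_modulation {p q : ℝ≥0∞} (hp : 1 ≤ p) (hq : 1 ≤ q) (θ : ℝ) (n : ℤ)
    (χ : 𝓢(ℝ, ℂ)) : ∃ C : NNReal, ∀ f : 𝓢'(ℝ, ℂ),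
      ‖(𝓕 f) (SchwartzMap.smulLeftCLM ℂ (fun ξ => (sigma ρ n ξ : ℂ)) χ)‖ₑ ≤
        C * modulation ρ p q θ f := by
  obtain ⟨C, hC⟩ := exists_enorm_apply_le_lpLine hp (𝓕 χ)
  refine ⟨C * (intWeight θ n)⁻¹.toNNReal, fun f => ?_⟩
  have hw := intWeight_pos θ n
  rw [fourier_smulLeft_sigma]
  refine (hC _).trans ?_
  have h := enorm_le_eLpNorm_count (fun n : ℤ => ENNReal.ofReal ((1 + |(n : ℝ)|) ^ θ) *
    lpLine p (freqProj ρ n f)) n (zero_lt_one.trans_le hq).ne'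
  rw [enorm_eq_self] at h
  rw [ENNReal.coe_mul, mul_assoc]
  gcongr
  refine le_trans (le_of_eq ?_) (mul_le_mul_right h _)
  have e : ((intWeight θ n)⁻¹.toNNReal : ℝ≥0∞) * ENNReal.ofReal (intWeight θ n) = 1 := by
    rw [← ENNReal.ofReal, ← ENNReal.ofReal_mul (by positivity), inv_mul_cancel₀ hw.ne',
      ENNReal.ofReal_one]
  rw [← mul_assoc]
  exact (by rw [e, one_mul] :
    lpLine p (freqProj ρ n f) = _ * ENNReal.ofReal (intWeight θ n) * lpLine p (freqProj ρ n f))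

/-- Measurability of the inner norm, needed for the triangle inequality of the outer one: a
countable supremum if `q = ∞`, a countable sum otherwise. -/
theorem aemeasurable_eLpNorm_count {q : ℝ≥0∞} (hq : q ≠ 0) {c : ℤ → ℂ} {g : ℤ → ℝ → ℂ}
    (hg : ∀ n, AEStronglyMeasurable (g n) volume) :
    AEMeasurable (fun x => eLpNorm (fun n => c n * g n x) q Measure.count) volume := by
  have h (n : ℤ) : AEMeasurable (fun x => ‖c n * g n x‖ₑ) volume :=
    (aestronglyMeasurable_const.mul (hg n)).enorm
  rcases eq_or_ne q ∞ with rfl | hq'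
  · simp only [eLpNorm_exponent_top, eLpNormEssSup_count]
    exact AEMeasurable.iSup h
  · simp only [eLpNorm_eq_lintegral_rpow_enorm_toReal hq hq', lintegral_count]
    exact (AEMeasurable.tsum fun n => (h n).pow_const _).pow_const _

theorem wienerAmalgam_add (p q : ℝ≥0∞) (hp : 1 ≤ p) (hq : 1 ≤ q) (s : ℝ) (f₁ f₂ : 𝓢'(ℝ, ℂ)) :
    wienerAmalgam ρ p q s (f₁ + f₂) ≤ wienerAmalgam ρ p q s f₁ + wienerAmalgam ρ p q s f₂ := by
  have hq0 : q ≠ 0 := (zero_lt_one.trans_le hq).ne'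
  refine ENNReal.le_iInf₂_add_iInf₂ fun g₁ h₁ g₂ h₂ => ?_
  refine (iInf₂_le (g₁ + g₂) fun n => ?_).trans ?_
  · rw [freqProj, map_add]
    exact (h₁ n).add (h₂ n)
  refine le_trans (eLpNorm_mono_enorm fun x => ?_) (eLpNorm_add_le
    (aemeasurable_eLpNorm_count hq0 fun n => (h₁ n).aestronglyMeasurable).aestronglyMeasurable
    (aemeasurable_eLpNorm_count hq0 fun n => (h₂ n).aestronglyMeasurable).aestronglyMeasurable hp)
  simp only [enorm_eq_self, Pi.add_apply]
  refine le_trans (le_of_eq ?_) (eLpNorm_add_le (measurable_of_countable _).aestronglyMeasurable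
    (measurable_of_countable _).aestronglyMeasurable hq)
  congr 1
  funext n
  exact mul_add _ _ _

theorem wienerAmalgam_neg (p q : ℝ≥0∞) (s : ℝ) (f : 𝓢'(ℝ, ℂ)) :
    wienerAmalgam ρ p q s (-f) = wienerAmalgam ρ p q s f := by
  have key (f : 𝓢'(ℝ, ℂ)) : wienerAmalgam ρ p q s (-f) ≤ wienerAmalgam ρ p q s f := by
    refine le_iInf₂ fun g h => (iInf₂_le (-g) fun n => ?_).trans (le_of_eq ?_)
    · rw [freqProj, map_neg]
      exact (h n).neg
    · congr 1
      funext x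
      rw [← eLpNorm_neg]
      congr 1
      funext n
      simp
  exact le_antisymm (key f) (by simpa using key (-f))

theorem exists_enorm_fourier_le_wienerAmalgam {p q : ℝ≥0∞} (hp : 1 ≤ p) (hq : 1 ≤ q) (θ : ℝ)
    (n : ℤ) (χ : 𝓢(ℝ, ℂ)) : ∃ C : NNReal, ∀ f : 𝓢'(ℝ, ℂ),
      ‖(𝓕 f) (SchwartzMap.smulLeftCLM ℂ (fun ξ => (sigma ρ n ξ : ℂ)) χ)‖ₑ ≤
        C * wienerAmalgam ρ p q θ f := by
  obtain ⟨C, hC⟩ := exists_enorm_apply_le_lpLine hp (𝓕 χ)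
  have hw := intWeight_pos θ n
  refine ⟨C * (intWeight θ n)⁻¹.toNNReal + 1, fun f => le_add_one_mul_iInf₂ fun g h => ?_⟩
  rw [fourier_smulLeft_sigma]
  refine (hC _).trans ?_
  rw [ENNReal.coe_mul, mul_assoc]
  gcongr
  refine (iInf₂_le (g n) (h n)).trans ?_
  have e : ((intWeight θ n)⁻¹.toNNReal : ℝ≥0∞) = ‖((intWeight θ n : ℝ) : ℂ)⁻¹‖ₑ := by
    rw [← ofReal_norm, norm_inv, Complex.norm_real, Real.norm_of_nonneg hw.le]
    rfl
  rw [e]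
  have e2 : g n = (((intWeight θ n : ℝ) : ℂ)⁻¹) • fun x => ((intWeight θ n : ℝ) : ℂ) * g n x := by
    funext x
    have : ((intWeight θ n : ℝ) : ℂ) ≠ 0 := by exact_mod_cast hw.ne'
    simp [this]
  conv_lhs => rw [e2, eLpNorm_const_smul]
  gcongr
  refine eLpNorm_mono_enorm fun x => ?_
  rw [enorm_eq_self]
  exact enorm_le_eLpNorm_count (fun n => ((intWeight θ n : ℝ) : ℂ) * g n x) n
    (zero_lt_one.trans_le hq).ne'

end Modulation

/-! ### The frequency-uniform partition of unity -/

section Partition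

variable {ρ : ℝ → ℝ}

/-- The integers within distance one of `ξ`, and a few more. -/
noncomputable def nearInts (ξ : ℝ) : Finset ℤ := Finset.Icc (⌊ξ⌋ - 1) (⌊ξ⌋ + 2)

theorem mem_nearInts {ξ : ℝ} {n : ℤ} (h : |ξ - n| ≤ 1) : n ∈ nearInts ξ := by
  rw [abs_le] at h
  have h1 := Int.floor_le ξ
  have h2 := Int.lt_floor_add_one ξ
  rw [nearInts, Finset.mem_Icc]
  constructor
  · have : ((⌊ξ⌋ - 1 : ℤ) : ℝ) ≤ n := by push_cast; linarith
    exact_mod_cast this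
  · have : (n : ℝ) ≤ ((⌊ξ⌋ + 2 : ℤ) : ℝ) := by push_cast; linarith
    exact_mod_cast this

theorem card_nearInts (ξ : ℝ) : (nearInts ξ).card = 4 := by
  rw [nearInts, Int.card_Icc]
  have : ⌊ξ⌋ + 2 + 1 - (⌊ξ⌋ - 1) = 4 := by ring
  rw [this]
  rfl

/-- Bounded overlap: at each `ξ` only the integers of `nearInts ξ` contribute. -/
theorem sum_le_of_near {F : Finset ℤ} {a : ℤ → ℝ} {C : ℝ} (hC : 0 ≤ C) (ξ : ℝ)
    (ha : ∀ n, a n ≤ C) (h0 : ∀ n : ℤ, 1 < |ξ - n| → a n = 0) : ∑ n ∈ F, a n ≤ 4 * C := by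
  classical
  calc ∑ n ∈ F, a n ≤ ∑ n ∈ F, if n ∈ nearInts ξ then C else 0 := by
        refine Finset.sum_le_sum fun n _ => ?_
        split_ifs with h
        · exact ha n
        · exact (h0 n (not_le.1 fun h' => h (mem_nearInts h'))).le
    _ = ∑ n ∈ F ∩ nearInts ξ, C := by rw [← Finset.sum_filter, Finset.filter_mem_eq_inter]
    _ ≤ ∑ n ∈ nearInts ξ, C := Finset.sum_le_sum_of_subset_of_nonneg Finset.inter_subset_right
        fun _ _ _ => hC
    _ = 4 * C := by rw [Finset.sum_const, card_nearInts]; simp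

theorem sigma_eq_sigma_zero (n : ℤ) (ξ : ℝ) : sigma ρ n ξ = sigma ρ 0 (ξ - n) := by
  simp only [sigma, Int.cast_zero, sub_zero]
  congr 1
  rw [← (Equiv.addRight n).tsum_eq]
  simp [sub_sub, add_comm]

namespace IsCutoff

variable (hρ : IsCutoff ρ)
include hρ

theorem hasFiniteSupport (ξ : ℝ) : (Function.support fun l : ℤ => ρ (ξ - l)).Finite := by
  refine (nearInts ξ).finite_toSet.subset fun l hl => mem_nearInts ?_
  by_contra h
  exact hl (hρ.eq_zero _ (not_le.1 h).le)

theorem summable (ξ : ℝ) : Summable fun l : ℤ => ρ (ξ - l) :=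
  summable_of_hasFiniteSupport (hρ.hasFiniteSupport ξ)

theorem le_tsum (n : ℤ) (ξ : ℝ) : ρ (ξ - n) ≤ ∑' l : ℤ, ρ (ξ - l) :=
  (hρ.summable ξ).le_tsum n fun _ _ => (hρ.mem_Icc _).1

theorem one_le_tsum (ξ : ℝ) : 1 ≤ ∑' l : ℤ, ρ (ξ - l) := by
  have := hρ.le_tsum (round ξ) ξ
  rwa [hρ.eq_one _ (abs_sub_round ξ)] at this

theorem sigma_mem_Icc (n : ℤ) (ξ : ℝ) : sigma ρ n ξ ∈ Icc (0 : ℝ) 1 := by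
  have h := zero_lt_one.trans_le (hρ.one_le_tsum ξ)
  exact ⟨div_nonneg (hρ.mem_Icc _).1 h.le, (div_le_one h).2 (hρ.le_tsum n ξ)⟩

theorem sigma_round_pos (ξ : ℝ) : 0 < sigma ρ (round ξ) ξ := by
  rw [sigma, hρ.eq_one _ (abs_sub_round ξ)]
  exact one_div_pos.2 (zero_lt_one.trans_le (hρ.one_le_tsum ξ))

theorem sigma_eq_zero {n : ℤ} {ξ : ℝ} (h : 1 ≤ |ξ - n|) : sigma ρ n ξ = 0 := by
  rw [sigma, hρ.eq_zero _ h, zero_div]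

/-- The sum is locally finite: on the unit ball around `ξ₀` it runs over one fixed finite set of
integers. -/
theorem contDiff_tsum : ContDiff ℝ ∞ fun ξ => ∑' l : ℤ, ρ (ξ - l) := by
  refine contDiff_iff_contDiffAt.2 fun ξ₀ => ?_
  have h : ContDiff ℝ ∞ fun ξ => ∑ l ∈ Finset.Icc (⌊ξ₀⌋ - 3) (⌊ξ₀⌋ + 3), ρ (ξ - l) :=
    ContDiff.sum fun l _ => hρ.smooth.comp (contDiff_id.sub contDiff_const)
  refine h.contDiffAt.congr_of_eventuallyEq ?_
  filter_upwards [Metric.ball_mem_nhds ξ₀ zero_lt_one] with ξ hξ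
  refine tsum_eq_sum fun l hl => hρ.eq_zero _ ?_
  by_contra hcon
  rw [not_le, abs_lt] at hcon
  rw [Metric.mem_ball, Real.dist_eq, abs_lt] at hξ
  refine hl (Finset.mem_Icc.2 ?_)
  have h1 := Int.floor_le ξ₀
  have h2 := Int.lt_floor_add_one ξ₀
  constructor
  · have : ((⌊ξ₀⌋ - 3 : ℤ) : ℝ) ≤ l := by push_cast; linarith
    exact_mod_cast this
  · have : (l : ℝ) ≤ ((⌊ξ₀⌋ + 3 : ℤ) : ℝ) := by push_cast; linarith
    exact_mod_cast this

theorem contDiff_sigma (n : ℤ) : ContDiff ℝ ∞ (sigma ρ n) :=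
  (hρ.smooth.comp (contDiff_id.sub contDiff_const)).div hρ.contDiff_tsum fun ξ =>
    (zero_lt_one.trans_le (hρ.one_le_tsum ξ)).ne'

theorem tsupport_sigma_subset (n : ℤ) : tsupport (sigma ρ n) ⊆ Metric.closedBall (n : ℝ) 1 := by
  refine closure_minimal (fun ξ hξ => ?_) Metric.isClosed_closedBall
  rw [Metric.mem_closedBall, Real.dist_eq]
  by_contra h
  exact hξ (hρ.sigma_eq_zero (not_le.1 h).le)

theorem hasCompactSupport_sigma (n : ℤ) : HasCompactSupport (sigma ρ n) :=
  (isCompact_closedBall (n : ℝ) 1).of_isClosed_subset (isClosed_tsupport _)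
    (hρ.tsupport_sigma_subset n)

theorem hasTemperateGrowth_sigma (n : ℤ) : (sigma ρ n).HasTemperateGrowth :=
  (hρ.hasCompactSupport_sigma n).hasTemperateGrowth (hρ.contDiff_sigma n)

theorem hasTemperateGrowth_ofReal_sigma (n : ℤ) :
    Function.HasTemperateGrowth fun ξ => (sigma ρ n ξ : ℂ) :=
  Function.Complex.hasTemperateGrowth_ofReal.comp (hρ.hasTemperateGrowth_sigma n)

theorem exists_abs_deriv_sigma_le : ∃ C, 0 ≤ C ∧ ∀ n ξ, |deriv (sigma ρ n) ξ| ≤ C := by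
  obtain ⟨C, hC⟩ := ((hρ.contDiff_sigma 0).continuous_deriv (by simp)).bounded_above_of_compact_support
    (hρ.hasCompactSupport_sigma 0).deriv
  refine ⟨C, (norm_nonneg _).trans (hC 0), fun n ξ => ?_⟩
  have : sigma ρ n = fun ξ => sigma ρ 0 (ξ - n) := funext fun ξ => sigma_eq_sigma_zero n ξ
  rw [this, deriv_comp_sub_const]
  exact hC _

theorem deriv_sigma_eq_zero {n : ℤ} {ξ : ℝ} (h : 1 < |ξ - n|) : deriv (sigma ρ n) ξ = 0 := by
  by_contra hcon
  have := hρ.tsupport_sigma_subset n (support_deriv_subset hcon)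
  rw [Metric.mem_closedBall, Real.dist_eq] at this
  exact absurd this (not_le.2 h)

end IsCutoff

end Partition

/-! ### Convolution of Schwartz functions, and regularity of the symbol -/

section Schwartz

/-- A one-dimensional Schwartz function is bounded by the `L¹` norm of its derivative. -/
theorem norm_le_integral_norm_deriv (g : 𝓢(ℝ, ℂ)) (ξ : ℝ) : ‖g ξ‖ ≤ ∫ x, ‖deriv g x‖ := by
  have hi : Integrable (deriv g) := (SchwartzMap.derivCLM ℂ ℂ g).integrable
  have ht : Tendsto g atBot (𝓝 0) :=
    (zero_at_infty (g.toZeroAtInfty)).mono_left atBot_le_cocompact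
  have h := integral_Iic_of_hasDerivAt_of_tendsto' (a := ξ) (fun x _ => g.hasDerivAt x)
    hi.integrableOn ht
  rw [sub_zero] at h
  rw [← h]
  exact (norm_integral_le_integral_norm _).trans
    (setIntegral_le_integral hi.norm (Eventually.of_forall fun _ => norm_nonneg _))

/-- Convolution of Schwartz functions. -/
noncomputable abbrev schwartzConv : 𝓢(ℝ, ℂ) →ₗ[ℂ] 𝓢(ℝ, ℂ) →L[ℂ] 𝓢(ℝ, ℂ) :=
  SchwartzMap.convolution (ContinuousLinearMap.mul ℂ ℂ)

theorem integral_norm_schwartzConv_le (g h : 𝓢(ℝ, ℂ)) :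
    ∫ x, ‖schwartzConv g h x‖ ≤ (∫ x, ‖g x‖) * ∫ x, ‖h x‖ := by
  have hg : Integrable (fun x => ‖g x‖) := g.integrable.norm
  have hh : Integrable (fun x => ‖h x‖) := h.integrable.norm
  have e := integral_convolution (ContinuousLinearMap.mul ℝ ℝ) hg hh
  rw [ContinuousLinearMap.mul_apply'] at e
  rw [← e]
  refine integral_mono (schwartzConv g h).integrable.norm
    (hg.integrable_convolution (ContinuousLinearMap.mul ℝ ℝ) hh) fun x => ?_
  change ‖_‖ ≤ _
  rw [SchwartzMap.convolution_apply, MeasureTheory.convolution, MeasureTheory.convolution]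
  refine (norm_integral_le_integral_norm _).trans (le_of_eq ?_)
  simp

theorem derivCLM_eq_lineDerivOp (g : 𝓢(ℝ, ℂ)) :
    SchwartzMap.derivCLM ℂ ℂ g = LineDeriv.lineDerivOp (1 : ℝ) g := by
  ext x
  rw [SchwartzMap.lineDerivOp_apply_eq_fderiv, SchwartzMap.derivCLM_apply, fderiv_apply_one_eq_deriv]

theorem hasTemperateGrowth_inner_one : Function.HasTemperateGrowth fun ξ : ℝ => inner ℝ ξ (1 : ℝ) := by
  fun_prop

theorem fourier_derivCLM_apply (g : 𝓢(ℝ, ℂ)) (ξ : ℝ) :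
    𝓕 (SchwartzMap.derivCLM ℂ ℂ g) ξ = 2 * Real.pi * Complex.I * ξ * 𝓕 g ξ := by
  rw [derivCLM_eq_lineDerivOp, SchwartzMap.fourier_lineDerivOp_eq, _root_.smul_apply,
    SchwartzMap.smulLeftCLM_apply_apply hasTemperateGrowth_inner_one]
  simp
  ring

theorem fourierInv_derivCLM_apply (g : 𝓢(ℝ, ℂ)) (ξ : ℝ) :
    𝓕⁻ (SchwartzMap.derivCLM ℂ ℂ g) ξ = -(2 * Real.pi * Complex.I * ξ * 𝓕⁻ g ξ) := by
  rw [derivCLM_eq_lineDerivOp, SchwartzMap.fourierInv_lineDerivOp_eq, _root_.smul_apply,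
    SchwartzMap.smulLeftCLM_apply_apply hasTemperateGrowth_inner_one]
  simp
  ring

theorem fourier_schwartzConv_apply (g h : 𝓢(ℝ, ℂ)) (ξ : ℝ) :
    𝓕 (schwartzConv g h) ξ = 𝓕 g ξ * 𝓕 h ξ := by
  rw [SchwartzMap.fourier_convolution]
  simp

theorem fourierInv_apply_eq_fourier_neg (g : 𝓢(ℝ, ℂ)) (x : ℝ) : 𝓕⁻ g x = 𝓕 g (-x) := rfl

theorem fourierInv_schwartzConv_apply (g h : 𝓢(ℝ, ℂ)) (x : ℝ) :
    𝓕⁻ (schwartzConv g h) x = 𝓕⁻ g x * 𝓕⁻ h x := by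
  simp only [fourierInv_apply_eq_fourier_neg, fourier_schwartzConv_apply]

/-- The derivative can be put on a single factor; on the Fourier side this is associativity of
multiplication. It makes the norm of the model space submultiplicative. -/
theorem derivCLM_schwartzConv (g h : 𝓢(ℝ, ℂ)) :
    SchwartzMap.derivCLM ℂ ℂ (schwartzConv g h) =
      schwartzConv (SchwartzMap.derivCLM ℂ ℂ g) h := by
  have : 𝓕 (SchwartzMap.derivCLM ℂ ℂ (schwartzConv g h)) =
      𝓕 (schwartzConv (SchwartzMap.derivCLM ℂ ℂ g) h) := by
    ext ξ
    rw [fourier_derivCLM_apply, fourier_schwartzConv_apply, fourier_schwartzConv_apply,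
      fourier_derivCLM_apply]
    ring
  exact (FourierTransform.fourierCLE ℂ 𝓢(ℝ, ℂ)).injective this

theorem hasTemperateGrowth_symbol : symbol.HasTemperateGrowth := by
  have h := (Function.hasTemperateGrowth_one_add_norm_sq_rpow ℝ (-1)).comp
    (((2 * Real.pi) • ContinuousLinearMap.id ℝ ℝ).hasTemperateGrowth)
  have e : symbol = fun ξ => 1 - ((fun x : ℝ => (1 + ‖x‖ ^ 2) ^ (-1 : ℝ)) ∘
      ((2 * Real.pi) • ContinuousLinearMap.id ℝ ℝ)) ξ := by
    funext ξ
    simp only [symbol, Function.comp, _root_.smul_apply, ContinuousLinearMap.id_apply,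
      smul_eq_mul, Real.norm_eq_abs, sq_abs, Real.rpow_neg_one]
    have : 1 + 4 * Real.pi ^ 2 * ξ ^ 2 ≠ 0 := by positivity
    have : 1 + (2 * Real.pi * ξ) ^ 2 ≠ 0 := by positivity
    field_simp
    ring
  rw [e]
  exact (Function.HasTemperateGrowth.const 1).sub h

theorem hasTemperateGrowth_ofReal_symbol :
    Function.HasTemperateGrowth fun ξ => (symbol ξ : ℂ) :=
  Function.Complex.hasTemperateGrowth_ofReal.comp hasTemperateGrowth_symbol

theorem hasDerivAt_symbol (ξ : ℝ) :
    HasDerivAt symbol (8 * Real.pi ^ 2 * ξ / (1 + 4 * Real.pi ^ 2 * ξ ^ 2) ^ 2) ξ := by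
  have h1 : HasDerivAt (fun ξ : ℝ => 4 * Real.pi ^ 2 * ξ ^ 2) (4 * Real.pi ^ 2 * (2 * ξ)) ξ := by
    simpa using ((hasDerivAt_id ξ).pow 2).const_mul (4 * Real.pi ^ 2)
  have h := h1.div (h1.const_add 1) (by positivity)
  convert! h using 1
  congr 1
  ring

/-- From `2 (2π|ξ|) ≤ 1 + (2πξ)²`. The constant is not sharp; only boundedness matters. -/
theorem abs_deriv_symbol_le (ξ : ℝ) : |deriv symbol ξ| ≤ 4 * Real.pi := by
  rw [(hasDerivAt_symbol ξ).deriv, abs_div, abs_of_pos (by positivity : (0 : ℝ) < (1 + 4 * Real.pi ^ 2 * ξ ^ 2) ^ 2),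
    div_le_iff₀ (by positivity), abs_mul, abs_of_pos (by positivity : (0 : ℝ) < 8 * Real.pi ^ 2)]
  have h1 : 2 * (2 * Real.pi * |ξ|) ≤ 1 + 4 * Real.pi ^ 2 * ξ ^ 2 := by
    have := sq_nonneg (2 * Real.pi * |ξ| - 1)
    have e := sq_abs ξ
    nlinarith
  have h2 : 1 + 4 * Real.pi ^ 2 * ξ ^ 2 ≤ (1 + 4 * Real.pi ^ 2 * ξ ^ 2) ^ 2 :=
    le_self_pow₀ (by have : 0 ≤ 4 * Real.pi ^ 2 * ξ ^ 2 := by positivity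
                     linarith) two_ne_zero
  have h3 : 2 * (2 * Real.pi * |ξ|) ≤ (1 + 4 * Real.pi ^ 2 * ξ ^ 2) ^ 2 := h1.trans h2
  have := mul_le_mul_of_nonneg_left h3 (by positivity : 0 ≤ 2 * Real.pi)
  have hp : 0 ≤ Real.pi * (1 + 4 * Real.pi ^ 2 * ξ ^ 2) ^ 2 := by positivity
  linarith

/-- The derivative of the product of a Schwartz function with a real function. -/
theorem deriv_smulLeftCLM_ofReal {m : ℝ → ℝ} (hm : m.HasTemperateGrowth) (g : 𝓢(ℝ, ℂ)) (ξ : ℝ) :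
    deriv (SchwartzMap.smulLeftCLM ℂ (fun ξ => (m ξ : ℂ)) g) ξ =
      (deriv m ξ : ℝ) * g ξ + (m ξ : ℝ) * deriv g ξ := by
  have hm' : Function.HasTemperateGrowth fun ξ => (m ξ : ℂ) :=
    Function.Complex.hasTemperateGrowth_ofReal.comp hm
  have h1 : HasDerivAt m (deriv m ξ) ξ := (hm.1.differentiable (by simp) ξ).hasDerivAt
  have e : (SchwartzMap.smulLeftCLM ℂ (fun ξ => (m ξ : ℂ)) g : ℝ → ℂ) = fun ξ => (m ξ : ℂ) * g ξ := by
    funext x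
    rw [SchwartzMap.smulLeftCLM_apply_apply hm', smul_eq_mul]
  rw [e]
  exact (h1.ofReal_comp.mul (g.hasDerivAt ξ)).deriv

end Schwartz

/-! ### The Banach algebra model on the line -/

section FreqSpace

/-- A Schwartz function and its derivative, as integrable functions. -/
noncomputable def sobolevMap :
    𝓢(ℝ, ℂ) →ₗ[ℂ] Lp ℂ 1 (volume : Measure ℝ) × Lp ℂ 1 (volume : Measure ℝ) :=
  ((SchwartzMap.toLpCLM ℂ ℂ 1 volume).prod
    (SchwartzMap.toLpCLM ℂ ℂ 1 volume ∘L SchwartzMap.derivCLM ℂ ℂ)).toLinearMap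

/-- The integrable functions with integrable derivative on the frequency side, as the closure of
the Schwartz functions. -/
def FreqSpace : Type := (LinearMap.range sobolevMap).topologicalClosure

namespace FreqSpace

noncomputable instance : NormedAddCommGroup FreqSpace :=
  inferInstanceAs (NormedAddCommGroup (LinearMap.range sobolevMap).topologicalClosure)

noncomputable instance : NormedSpace ℂ FreqSpace :=
  inferInstanceAs (NormedSpace ℂ (LinearMap.range sobolevMap).topologicalClosure)

instance : CompleteSpace FreqSpace :=
  (LinearMap.range sobolevMap).isClosed_topologicalClosure.completeSpace_coe

/-- The inclusion of the model space into the pairs of integrable functions. -/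
noncomputable def val :
    FreqSpace →L[ℂ] Lp ℂ 1 (volume : Measure ℝ) × Lp ℂ 1 (volume : Measure ℝ) :=
  (LinearMap.range sobolevMap).topologicalClosure.subtypeL

end FreqSpace

/-- The dense embedding of the Schwartz functions. -/
noncomputable def emb : 𝓢(ℝ, ℂ) →ₗ[ℂ] FreqSpace :=
  sobolevMap.codRestrict (LinearMap.range sobolevMap).topologicalClosure fun g => Submodule.le_topologicalClosure _ (LinearMap.mem_range_self _ g)

theorem denseRange_emb : DenseRange emb := by
  intro x
  refine closure_subtype.2 ?_
  have h : (Subtype.val '' Set.range emb :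
      Set (Lp ℂ 1 (volume : Measure ℝ) × Lp ℂ 1 (volume : Measure ℝ))) = Set.range sobolevMap :=
    (Set.range_comp _ _).symm
  exact (Set.ext_iff.1 (congrArg closure h) _).2 x.2

theorem norm_emb (g : 𝓢(ℝ, ℂ)) : ‖emb g‖ = max (∫ x, ‖g x‖) (∫ x, ‖deriv g x‖) := by
  change max ‖g.toLp 1 volume‖ ‖(SchwartzMap.derivCLM ℂ ℂ g).toLp 1 volume‖ = _
  rw [SchwartzMap.norm_toLp_one, SchwartzMap.norm_toLp_one]
  rfl

theorem integral_norm_le_norm_emb (g : 𝓢(ℝ, ℂ)) : ∫ x, ‖g x‖ ≤ ‖emb g‖ :=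
  (le_max_left _ _).trans_eq (norm_emb g).symm

theorem integral_norm_deriv_le_norm_emb (g : 𝓢(ℝ, ℂ)) : ∫ x, ‖deriv g x‖ ≤ ‖emb g‖ :=
  (le_max_right _ _).trans_eq (norm_emb g).symm

/-- This is what the derivative in the norm provides: with the `L¹` bound it gives all `L^q` bounds
at once. -/
theorem norm_le_norm_emb (g : 𝓢(ℝ, ℂ)) (ξ : ℝ) : ‖g ξ‖ ≤ ‖emb g‖ :=
  (norm_le_integral_norm_deriv g ξ).trans (integral_norm_deriv_le_norm_emb g)

theorem norm_emb_schwartzConv_le (g h : 𝓢(ℝ, ℂ)) : ‖emb (schwartzConv g h)‖ ≤ ‖emb g‖ * ‖emb h‖ := by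
  rw [norm_emb]
  refine max_le ?_ ?_
  · refine (integral_norm_schwartzConv_le g h).trans ?_
    exact mul_le_mul (integral_norm_le_norm_emb g) (integral_norm_le_norm_emb h)
      (integral_nonneg fun _ => norm_nonneg _) (norm_nonneg _)
  · have e : (fun x => ‖deriv (schwartzConv g h) x‖) =
        fun x => ‖schwartzConv (SchwartzMap.derivCLM ℂ ℂ g) h x‖ := by
      rw [← derivCLM_schwartzConv]
      rfl
    rw [e]
    refine (integral_norm_schwartzConv_le _ h).trans ?_
    exact mul_le_mul (integral_norm_deriv_le_norm_emb g) (integral_norm_le_norm_emb h)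
      (integral_nonneg fun _ => norm_nonneg _) (norm_nonneg _)

theorem eLpNorm_le_enorm_emb {q : ℝ≥0∞} (hq : 1 ≤ q) (g : 𝓢(ℝ, ℂ)) :
    eLpNorm g q volume ≤ ‖emb g‖ₑ := by
  refine eLpNorm_le_of_enorm_le_of_lintegral_le hq (Eventually.of_forall fun ξ => ?_) ?_
  · exact enorm_le_iff_norm_le.2 (norm_le_norm_emb g ξ)
  · rw [← ofReal_integral_norm_eq_lintegral_enorm g.integrable, ← ofReal_norm]
    exact ENNReal.ofReal_le_ofReal (integral_norm_le_norm_emb g)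

theorem norm_toLp_le_norm_emb {q : ℝ≥0∞} (hq : 1 ≤ q) (g : 𝓢(ℝ, ℂ)) :
    ‖g.toLp q volume‖ ≤ ‖emb g‖ := by
  rw [SchwartzMap.norm_toLp, ← toReal_enorm]
  exact ENNReal.toReal_mono enorm_ne_top (eLpNorm_le_enorm_emb hq g)

/-- Two continuous maps on the model space agree if they agree on Schwartz functions. -/
theorem eq_of_emb {Y : Type*} [TopologicalSpace Y] [T2Space Y] {F G : FreqSpace → Y}
    (hF : Continuous F) (hG : Continuous G) (h : ∀ g, F (emb g) = G (emb g)) (x : FreqSpace) :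
    F x = G x :=
  congrFun (denseRange_emb.equalizer hF hG (funext h)) x

/-- Convolution by a fixed Schwartz function. -/
noncomputable def convLeft (g : 𝓢(ℝ, ℂ)) : FreqSpace →L[ℂ] FreqSpace :=
  (emb ∘ₗ (schwartzConv g).toLinearMap).extendOfNorm emb

theorem convLeft_emb (g h : 𝓢(ℝ, ℂ)) : convLeft g (emb h) = emb (schwartzConv g h) :=
  LinearMap.extendOfNorm_eq denseRange_emb ⟨‖emb g‖, norm_emb_schwartzConv_le g⟩ h

theorem norm_convLeft_le (g : 𝓢(ℝ, ℂ)) : ‖convLeft g‖ ≤ ‖emb g‖ :=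
  ContinuousLinearMap.opNorm_le_bound _ (norm_nonneg _) fun x =>
    LinearMap.norm_extendOfNorm_apply_le denseRange_emb _ (norm_emb_schwartzConv_le g) x

/-- `convLeft` as a linear map. -/
noncomputable def convLeftₗ : 𝓢(ℝ, ℂ) →ₗ[ℂ] FreqSpace →L[ℂ] FreqSpace where
  toFun := convLeft
  map_add' g g' := by
    ext1 x
    refine eq_of_emb (convLeft (g + g')).continuous (convLeft g + convLeft g').continuous
      (fun h => ?_) x
    rw [_root_.add_apply, convLeft_emb, convLeft_emb, convLeft_emb, ← map_add, map_add]
    rfl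
  map_smul' a g := by
    ext1 x
    refine eq_of_emb (convLeft (a • g)).continuous (a • convLeft g).continuous (fun h => ?_) x
    rw [_root_.smul_apply, convLeft_emb, convLeft_emb, ← map_smul, map_smul]
    rfl

/-- The convolution product. -/
noncomputable def freqConv : FreqSpace →L[ℂ] FreqSpace →L[ℂ] FreqSpace :=
  LinearMap.extendOfNorm convLeftₗ emb

/-- The product is extended by density in two stages, first in the right factor and then in the left
one. -/
theorem freqConv_emb (g h : 𝓢(ℝ, ℂ)) : freqConv (emb g) (emb h) = emb (schwartzConv g h) := by
  have : freqConv (emb g) = convLeft g := LinearMap.extendOfNorm_eq (f := convLeftₗ) denseRange_emb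
    ⟨1, fun g => (norm_convLeft_le g).trans_eq (one_mul _).symm⟩ g
  rw [this, convLeft_emb]

theorem norm_freqConv_le (x y : FreqSpace) : ‖freqConv x y‖ ≤ ‖x‖ * ‖y‖ := by
  refine ((freqConv x).le_opNorm y).trans ?_
  gcongr
  refine (LinearMap.norm_extendOfNorm_apply_le (f := convLeftₗ) denseRange_emb 1
    (fun g => (norm_convLeft_le g).trans_eq (one_mul _).symm) x).trans_eq (one_mul _)

/-- By the product rule: `4π` bounds the derivative of the symbol and `1` the symbol itself. -/
theorem norm_emb_smulLeftCLM_symbol_le (g : 𝓢(ℝ, ℂ)) :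
    ‖emb (SchwartzMap.smulLeftCLM ℂ (fun ξ => (symbol ξ : ℂ)) g)‖ ≤ (4 * Real.pi + 1) * ‖emb g‖ := by
  have hg := g.integrable (μ := volume).norm
  have hd : Integrable fun x => ‖deriv g x‖ := (SchwartzMap.derivCLM ℂ ℂ g).integrable.norm
  have hs (ξ : ℝ) : ‖((symbol ξ : ℝ) : ℂ)‖ ≤ 1 := by
    rw [Complex.norm_real, Real.norm_of_nonneg (symbol_nonneg ξ)]
    exact symbol_le_one ξ
  rw [norm_emb]
  refine max_le ?_ ?_
  · calc _ ≤ ∫ x, ‖g x‖ := by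
          refine integral_mono (SchwartzMap.integrable _).norm hg fun ξ => ?_
          change ‖_‖ ≤ _
          rw [SchwartzMap.smulLeftCLM_apply_apply hasTemperateGrowth_ofReal_symbol, norm_smul]
          exact mul_le_of_le_one_left (norm_nonneg _) (hs ξ)
      _ ≤ ‖emb g‖ := integral_norm_le_norm_emb g
      _ ≤ _ := le_mul_of_one_le_left (norm_nonneg _) (by linarith [Real.pi_pos])
  · calc _ ≤ ∫ x, (4 * Real.pi * ‖g x‖ + ‖deriv g x‖) := by
          refine integral_mono (SchwartzMap.derivCLM ℂ ℂ _).integrable.norm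
            ((hg.const_mul _).add hd) fun ξ => ?_
          change ‖deriv _ ξ‖ ≤ _
          rw [deriv_smulLeftCLM_ofReal hasTemperateGrowth_symbol]
          refine (norm_add_le _ _).trans ?_
          rw [norm_mul, norm_mul]
          gcongr
          · rw [Complex.norm_real]
            exact abs_deriv_symbol_le ξ
          · exact mul_le_of_le_one_left (norm_nonneg _) (hs ξ)
      _ = 4 * Real.pi * (∫ x, ‖g x‖) + ∫ x, ‖deriv g x‖ := by
          rw [integral_add (hg.const_mul _) hd, integral_const_mul]
      _ ≤ 4 * Real.pi * ‖emb g‖ + ‖emb g‖ := by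
          gcongr
          · exact integral_norm_le_norm_emb g
          · exact integral_norm_deriv_le_norm_emb g
      _ = _ := by ring

/-- Multiplication by the symbol of `-∂ₓ² (1 - ∂ₓ²)⁻¹`. -/
noncomputable def freqMultiplier : FreqSpace →L[ℂ] FreqSpace :=
  (emb ∘ₗ (SchwartzMap.smulLeftCLM ℂ (fun ξ => (symbol ξ : ℂ))).toLinearMap).extendOfNorm emb

theorem freqMultiplier_emb (g : 𝓢(ℝ, ℂ)) : freqMultiplier (emb g) =
    emb (SchwartzMap.smulLeftCLM ℂ (fun ξ => (symbol ξ : ℂ)) g) :=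
  LinearMap.extendOfNorm_eq denseRange_emb ⟨_, norm_emb_smulLeftCLM_symbol_le⟩ g

/-- The inclusion of the model space into the tempered distributions. -/
noncomputable def freqIncl : FreqSpace →L[ℂ] 𝓢'(ℝ, ℂ) :=
  FourierTransform.fourierInvCLM ℂ 𝓢'(ℝ, ℂ) ∘L Lp.toTemperedDistributionCLM ℂ volume 1 ∘L
    ContinuousLinearMap.fst ℂ _ _ ∘L FreqSpace.val

theorem freqIncl_emb (g : 𝓢(ℝ, ℂ)) :
    freqIncl (emb g) = SchwartzMap.toTemperedDistributionCLM ℝ ℂ volume (𝓕⁻ g) := by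
  rw [← TemperedDistribution.fourierInv_toTemperedDistributionCLM_eq,
    ← Lp.toTemperedDistribution_toLp_eq (p := 1)]
  rfl

theorem fourier_freqIncl_emb (g : 𝓢(ℝ, ℂ)) :
    𝓕 (freqIncl (emb g)) = SchwartzMap.toTemperedDistributionCLM ℝ ℂ volume g := by
  rw [freqIncl_emb, TemperedDistribution.fourier_toTemperedDistributionCLM_eq,
    FourierTransform.fourier_fourierInv_eq]

/-- The function whose Fourier transform is the given element of the model space. -/
noncomputable def freqFun : FreqSpace →L[ℂ] BoundedContinuousFunction ℝ ℂ :=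
  ((SchwartzMap.toBoundedContinuousFunctionCLM ℂ ℝ ℂ).toLinearMap ∘ₗ
    (FourierTransform.fourierInvCLM ℂ 𝓢(ℝ, ℂ)).toLinearMap).extendOfNorm emb

theorem freqFun_emb (g : 𝓢(ℝ, ℂ)) (x : ℝ) : freqFun (emb g) x = 𝓕⁻ g x := by
  have h := LinearMap.extendOfNorm_eq (f := (SchwartzMap.toBoundedContinuousFunctionCLM ℂ ℝ ℂ).toLinearMap ∘ₗ
    (FourierTransform.fourierInvCLM ℂ 𝓢(ℝ, ℂ)).toLinearMap) denseRange_emb ⟨1, fun g => ?_⟩ g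
  · exact DFunLike.congr_fun h x
  · rw [one_mul]
    refine (BoundedContinuousFunction.norm_le (norm_nonneg _)).2 fun x => ?_
    refine (SchwartzMap.norm_fourier_apply_le_toLp_one g (-x)).trans ?_
    rw [SchwartzMap.norm_toLp_one]
    exact integral_norm_le_norm_emb g

theorem freqFun_freqConv (x y : FreqSpace) (t : ℝ) :
    freqFun (freqConv x y) t = freqFun x t * freqFun y t := by
  have hc : ∀ t, Continuous fun w : BoundedContinuousFunction ℝ ℂ => w t := fun t =>
    (BoundedContinuousFunction.evalCLM ℂ t).continuous
  refine eq_of_emb (F := fun x => freqFun (freqConv x y) t) (G := fun x => freqFun x t * freqFun y t)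
    ((hc t).comp (by fun_prop)) (((hc t).comp (by fun_prop)).mul continuous_const) (fun g => ?_) x
  refine eq_of_emb (F := fun y => freqFun (freqConv (emb g) y) t)
    (G := fun y => freqFun (emb g) t * freqFun y t)
    ((hc t).comp (by fun_prop)) (continuous_const.mul ((hc t).comp (by fun_prop))) (fun h => ?_) y
  simp only [freqConv_emb, freqFun_emb, fourierInv_schwartzConv_apply]

theorem freqFun_bilinPow (n : ℕ) (x : FreqSpace) (t : ℝ) :
    freqFun (bilinPow freqConv n x) t = freqFun x t ^ (n + 1) := by
  induction n with
  | zero => simp [bilinPow_zero]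
  | succ n ih => rw [bilinPow_succ, freqFun_freqConv, ih, pow_succ' _ (n + 1)]

theorem integrable_schwartz_mul_bounded (φ : 𝓢(ℝ, ℂ)) (w : BoundedContinuousFunction ℝ ℂ) :
    Integrable fun x => φ x * w x :=
  φ.integrable.mul_bdd w.continuous.aestronglyMeasurable
    (Eventually.of_forall fun x => w.norm_coe_le_norm x)

theorem continuous_integral_schwartz_mul (φ : 𝓢(ℝ, ℂ)) :
    Continuous fun w : BoundedContinuousFunction ℝ ℂ => ∫ x, φ x * w x := by
  let L : BoundedContinuousFunction ℝ ℂ →L[ℂ] ℂ := LinearMap.mkContinuous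
    { toFun := fun w => ∫ x, φ x * w x
      map_add' := fun w w' => by
        rw [← integral_add (integrable_schwartz_mul_bounded φ w)
          (integrable_schwartz_mul_bounded φ w')]
        simp only [BoundedContinuousFunction.coe_add, Pi.add_apply, mul_add]
      map_smul' := fun a w => by
        rw [RingHom.id_apply, smul_eq_mul, ← integral_const_mul]
        simp only [BoundedContinuousFunction.coe_smul, smul_eq_mul, mul_left_comm] }
    (∫ x, ‖φ x‖) fun w => by
      rw [← integral_mul_const]
      refine (norm_integral_le_integral_norm _).trans ?_
      refine integral_mono (integrable_schwartz_mul_bounded φ w).norm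
        (φ.integrable.norm.mul_const _) fun x => ?_
      change ‖φ x * w x‖ ≤ ‖φ x‖ * ‖w‖
      rw [norm_mul]
      gcongr
      exact w.norm_coe_le_norm x
  exact L.continuous

theorem continuous_freqIncl_apply (φ : 𝓢(ℝ, ℂ)) : Continuous fun x => freqIncl x φ :=
  (PointwiseConvergenceCLM.evalCLM _ _ φ).continuous.comp freqIncl.continuous

theorem represents_freqFun (x : FreqSpace) : Represents (freqFun x) (freqIncl x) := by
  intro φ
  refine ⟨integrable_schwartz_mul_bounded φ _, ?_⟩
  refine eq_of_emb (continuous_freqIncl_apply φ)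
    ((continuous_integral_schwartz_mul φ).comp freqFun.continuous) (fun g => ?_) x
  simp only [freqIncl_emb, Function.comp, freqFun_emb,
    SchwartzMap.toTemperedDistributionCLM_apply_apply, smul_eq_mul]

/-- The model space is embedded into every `L^q`. -/
noncomputable def freqToLp (q : ℝ≥0∞) [Fact (1 ≤ q)] : FreqSpace →L[ℂ] Lp ℂ q (volume : Measure ℝ) :=
  (SchwartzMap.toLpCLM ℂ ℂ q volume).toLinearMap.extendOfNorm emb

theorem norm_toLpCLM_le {q : ℝ≥0∞} [hq : Fact (1 ≤ q)] (g : 𝓢(ℝ, ℂ)) :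
    ‖(SchwartzMap.toLpCLM ℂ ℂ q volume).toLinearMap g‖ ≤ 1 * ‖emb g‖ := by
  rw [one_mul]
  exact norm_toLp_le_norm_emb hq.out g

theorem norm_freqToLp_le {q : ℝ≥0∞} [Fact (1 ≤ q)] (x : FreqSpace) : ‖freqToLp q x‖ ≤ ‖x‖ :=
  (LinearMap.norm_extendOfNorm_apply_le denseRange_emb 1 norm_toLpCLM_le x).trans_eq (one_mul _)

theorem freqToLp_emb {q : ℝ≥0∞} [Fact (1 ≤ q)] (g : 𝓢(ℝ, ℂ)) :
    freqToLp q (emb g) = g.toLp q volume :=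
  LinearMap.extendOfNorm_eq denseRange_emb ⟨1, norm_toLpCLM_le⟩ g

theorem represents_freqToLp {q : ℝ≥0∞} [Fact (1 ≤ q)] (x : FreqSpace) :
    Represents (freqToLp q x) (𝓕 (freqIncl x)) := by
  have h : 𝓕 (freqIncl x) = Lp.toTemperedDistribution (freqToLp q x) := by
    refine eq_of_emb (F := fun x => FourierTransform.fourierCLM ℂ 𝓢'(ℝ, ℂ) (freqIncl x))
      (G := fun x => Lp.toTemperedDistributionCLM ℂ volume q (freqToLp q x))
      (by fun_prop) (by fun_prop) (fun g => ?_) x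
    simp only [FourierTransform.fourierCLM_apply, fourier_freqIncl_emb, freqToLp_emb,
      Lp.toTemperedDistributionCLM_apply, Lp.toTemperedDistribution_toLp_eq]
  rw [h]
  exact represents_toTemperedDistribution _

theorem densePreimage_freqIncl : DensePreimage testLine freqIncl.toLinearMap := by
  intro x ε hε
  obtain ⟨g, hg⟩ := denseRange_emb.exists_dist_lt x hε
  refine ⟨emb g, ⟨𝓕⁻ g, (freqIncl_emb g).symm⟩, ?_⟩
  rwa [← dist_eq_norm]

theorem exists_freqIncl_eq_of_mem_testLine (f : 𝓢'(ℝ, ℂ)) (hf : f ∈ testLine) :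
    ∃ x, freqIncl.toLinearMap x = f := by
  obtain ⟨φ, rfl⟩ := hf
  refine ⟨emb (𝓕 φ), ?_⟩
  change freqIncl _ = _
  rw [freqIncl_emb, FourierTransform.fourierInv_fourier_eq]

theorem isPowLine_bilinPow {k : ℕ} (hk : 1 ≤ k) (x : FreqSpace) :
    IsPowLine k (freqIncl x) (freqIncl (bilinPow freqConv (k - 1) x)) := by
  refine ⟨freqFun x, represents_freqFun x, ?_⟩
  have h := represents_freqFun (bilinPow freqConv (k - 1) x)
  have e : (freqFun (bilinPow freqConv (k - 1) x) : ℝ → ℂ) = fun t => freqFun x t ^ k := by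
    funext t
    rw [freqFun_bilinPow, Nat.sub_add_cancel hk]
  rwa [e] at h

theorem fourier_freqIncl_freqMultiplier (x : FreqSpace) (φ : 𝓢(ℝ, ℂ)) :
    𝓕 (freqIncl (freqMultiplier x)) φ =
      𝓕 (freqIncl x) (SchwartzMap.smulLeftCLM ℂ (fun ξ => (symbol ξ : ℂ)) φ) := by
  simp only [TemperedDistribution.fourier_apply]
  refine eq_of_emb ((continuous_freqIncl_apply _).comp freqMultiplier.continuous)
    (continuous_freqIncl_apply _) (fun g => ?_) x
  simp only [Function.comp, freqMultiplier_emb, ← TemperedDistribution.fourier_apply,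
    fourier_freqIncl_emb, SchwartzMap.toTemperedDistributionCLM_apply_apply,
    SchwartzMap.smulLeftCLM_apply_apply hasTemperateGrowth_ofReal_symbol, smul_eq_mul]
  congr 1
  funext ξ
  ring

theorem apply_eq_fourier_apply (f : 𝓢'(ℝ, ℂ)) (φ : 𝓢(ℝ, ℂ)) : f φ = 𝓕 f (𝓕⁻ φ) := by
  rw [TemperedDistribution.fourier_apply, FourierTransform.fourier_fourierInv_eq]

theorem dxxLine_add (f g : 𝓢'(ℝ, ℂ)) : dxxLine (f + g) = dxxLine f + dxxLine g := by
  simp only [dxxLine, map_add]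

theorem dxxLine_apply (f : 𝓢'(ℝ, ℂ)) (φ : 𝓢(ℝ, ℂ)) :
    dxxLine f φ = f (SchwartzMap.derivCLM ℂ ℂ (SchwartzMap.derivCLM ℂ ℂ φ)) := by
  simp only [dxxLine, TemperedDistribution.derivCLM_apply_apply, map_neg, neg_neg]

theorem freqIncl_freqMultiplier_sub_dxxLine (x : FreqSpace) :
    freqIncl (freqMultiplier x) - dxxLine (freqIncl (freqMultiplier x)) =
      -dxxLine (freqIncl x) := by
  ext φ
  set ψ := 𝓕⁻ (SchwartzMap.derivCLM ℂ ℂ (SchwartzMap.derivCLM ℂ ℂ φ)) with hψ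
  have h1 : freqIncl (freqMultiplier x) φ - dxxLine (freqIncl (freqMultiplier x)) φ =
      -dxxLine (freqIncl x) φ := by
    rw [dxxLine_apply, dxxLine_apply, apply_eq_fourier_apply, apply_eq_fourier_apply _
      (SchwartzMap.derivCLM ℂ ℂ _), apply_eq_fourier_apply (freqIncl x),
      fourier_freqIncl_freqMultiplier, fourier_freqIncl_freqMultiplier, ← map_sub, ← map_neg]
    -- Both sides are now the Fourier transform of `freqIncl x` evaluated at Schwartz functions,
    -- which agree pointwise by `symbol_add_mul`.
    congr 1
    ext ξ
    have h := congrArg (fun r : ℝ => (r : ℂ)) (symbol_add_mul ξ)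
    push_cast at h
    simp only [_root_.sub_apply, _root_.neg_apply,
      SchwartzMap.smulLeftCLM_apply_apply hasTemperateGrowth_ofReal_symbol, smul_eq_mul,
      fourierInv_derivCLM_apply]
    linear_combination 𝓕⁻ φ ξ * h +
      4 * Real.pi ^ 2 * ξ ^ 2 * 𝓕⁻ φ ξ * (1 - symbol ξ) * Complex.I_sq
  exact h1

end FreqSpace

/-! ### Embedding of the model into the three scales, and smallness of high frequencies -/

section Pieces

variable {ρ : ℝ → ℝ}

/-- The frequency-localized piece `P_n` on the frequency side, as a square-integrable function. -/
noncomputable def piece (ρ : ℝ → ℝ) (n : ℤ) : 𝓢(ℝ, ℂ) →ₗ[ℂ] Lp ℂ 2 (volume : Measure ℝ) :=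
  (SchwartzMap.toLpCLM ℂ ℂ 2 volume).toLinearMap ∘ₗ
    (FourierTransform.fourierInvCLM ℂ 𝓢(ℝ, ℂ)).toLinearMap ∘ₗ
      (SchwartzMap.smulLeftCLM ℂ fun ξ => (sigma ρ n ξ : ℂ)).toLinearMap

theorem piece_apply (n : ℤ) (g : 𝓢(ℝ, ℂ)) : piece ρ n g =
    (𝓕⁻ (SchwartzMap.smulLeftCLM ℂ (fun ξ => (sigma ρ n ξ : ℂ)) g)).toLp 2 volume := rfl

/-- Plancherel replaces the piece by `σ_n g`, whose `L²` norm is bounded by its norm in the model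
space. The bound is an integral, so it can be summed over `n` under the integral sign. -/
theorem norm_piece_le (n : ℤ) (g : 𝓢(ℝ, ℂ)) : ‖piece ρ n g‖ ≤
    ∫ ξ, (‖SchwartzMap.smulLeftCLM ℂ (fun ξ => (sigma ρ n ξ : ℂ)) g ξ‖ +
      ‖deriv (SchwartzMap.smulLeftCLM ℂ (fun ξ => (sigma ρ n ξ : ℂ)) g) ξ‖) := by
  set h := SchwartzMap.smulLeftCLM ℂ (fun ξ => (sigma ρ n ξ : ℂ)) g with hh
  have h1 : ‖piece ρ n g‖ = ‖h.toLp 2 volume‖ := by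
    rw [piece_apply, ← SchwartzMap.norm_fourier_toL2_eq, FourierTransform.fourier_fourierInv_eq]
  have hd : Integrable (fun ξ => ‖deriv h ξ‖) := (SchwartzMap.derivCLM ℂ ℂ h).integrable.norm
  rw [h1, integral_add h.integrable.norm hd]
  refine (norm_toLp_le_norm_emb one_le_two h).trans ?_
  rw [norm_emb]
  exact max_le_add_of_nonneg (integral_nonneg fun _ => norm_nonneg _)
    (integral_nonneg fun _ => norm_nonneg _)

theorem exists_sum_norm_piece_le (hρ : IsCutoff ρ) : ∃ C : NNReal, 0 < C ∧
    ∀ (F : Finset ℤ) (g : 𝓢(ℝ, ℂ)), ∑ n ∈ F, ‖piece ρ n g‖ ≤ C * ‖emb g‖ := by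
  obtain ⟨C, hC0, hC⟩ := hρ.exists_abs_deriv_sigma_le
  lift C to NNReal using hC0
  refine ⟨8 * (C + 1), by positivity, fun F g => ?_⟩
  have hg : Integrable (fun ξ => ‖g ξ‖) := g.integrable.norm
  have hd : Integrable (fun ξ => ‖deriv g ξ‖) := (SchwartzMap.derivCLM ℂ ℂ g).integrable.norm
  set h : ℤ → 𝓢(ℝ, ℂ) := fun n => SchwartzMap.smulLeftCLM ℂ (fun ξ => (sigma ρ n ξ : ℂ)) g with hh
  have hi (n : ℤ) : Integrable fun ξ => ‖h n ξ‖ + ‖deriv (h n) ξ‖ :=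
    (h n).integrable.norm.add (SchwartzMap.derivCLM ℂ ℂ (h n)).integrable.norm
  have e1 (n : ℤ) (ξ : ℝ) : h n ξ = (sigma ρ n ξ : ℂ) * g ξ :=
    SchwartzMap.smulLeftCLM_apply_apply (hρ.hasTemperateGrowth_ofReal_sigma n) g ξ
  have e2 (n : ℤ) (ξ : ℝ) : deriv (h n) ξ =
      (deriv (sigma ρ n) ξ : ℝ) * g ξ + (sigma ρ n ξ : ℝ) * deriv g ξ :=
    deriv_smulLeftCLM_ofReal (hρ.hasTemperateGrowth_sigma n) g ξ
  have hs (n : ℤ) (ξ : ℝ) : ‖((sigma ρ n ξ : ℝ) : ℂ)‖ ≤ 1 := by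
    rw [Complex.norm_real, Real.norm_of_nonneg (hρ.sigma_mem_Icc n ξ).1]
    exact (hρ.sigma_mem_Icc n ξ).2
  have hs' (n : ℤ) (ξ : ℝ) : ‖((deriv (sigma ρ n) ξ : ℝ) : ℂ)‖ ≤ C := by
    rw [Complex.norm_real]
    exact hC n ξ
  calc ∑ n ∈ F, ‖piece ρ n g‖ ≤ ∑ n ∈ F, ∫ ξ, (‖h n ξ‖ + ‖deriv (h n) ξ‖) :=
        Finset.sum_le_sum fun n _ => norm_piece_le n g
    _ = ∫ ξ, ∑ n ∈ F, (‖h n ξ‖ + ‖deriv (h n) ξ‖) :=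
        (integral_finsetSum F fun n _ => hi n).symm
    -- The factor `4` is the overlap of the partition; `C + 1` comes from the product rule and
    -- `|σ_n| ≤ 1`.
    _ ≤ ∫ ξ, 4 * ((C + 1) * (‖g ξ‖ + ‖deriv g ξ‖)) := by
        refine integral_mono (integrable_finsetSum F fun n _ => hi n)
          (((hg.add hd).const_mul _).const_mul _) fun ξ => ?_
        refine sum_le_of_near (by positivity) ξ (fun n => ?_) fun n hn => ?_
        · rw [e1, e2]
          have h1 := norm_add_le ((deriv (sigma ρ n) ξ : ℝ) * g ξ) ((sigma ρ n ξ : ℝ) * deriv g ξ)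
          rw [norm_mul, norm_mul] at h1
          rw [norm_mul]
          have h2 := mul_le_mul_of_nonneg_right (hs n ξ) (norm_nonneg (g ξ))
          have h3 := mul_le_mul_of_nonneg_right (hs n ξ) (norm_nonneg (deriv g ξ))
          have h4 := mul_le_mul_of_nonneg_right (hs' n ξ) (norm_nonneg (g ξ))
          have h5 : 0 ≤ C * ‖deriv g ξ‖ := by positivity
          linarith
        · rw [e1, e2, hρ.sigma_eq_zero hn.le, hρ.deriv_sigma_eq_zero hn]
          simp
    _ = 4 * ((C + 1) * ((∫ ξ, ‖g ξ‖) + ∫ ξ, ‖deriv g ξ‖)) := by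
        rw [integral_const_mul, integral_const_mul, integral_add hg hd]
    _ ≤ 4 * ((C + 1) * (‖emb g‖ + ‖emb g‖)) := by
        gcongr
        · exact integral_norm_le_norm_emb g
        · exact integral_norm_deriv_le_norm_emb g
    _ = _ := by push_cast; ring

/-- The piece `P_n` of an element of the model space. -/
noncomputable def freqPiece (ρ : ℝ → ℝ) (n : ℤ) : FreqSpace →L[ℂ] Lp ℂ 2 (volume : Measure ℝ) :=
  (piece ρ n).extendOfNorm emb

theorem freqPiece_emb (hρ : IsCutoff ρ) (n : ℤ) (g : 𝓢(ℝ, ℂ)) :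
    freqPiece ρ n (emb g) = piece ρ n g := by
  obtain ⟨C, -, hC⟩ := exists_sum_norm_piece_le hρ
  exact LinearMap.extendOfNorm_eq denseRange_emb ⟨C, fun g => by simpa using hC {n} g⟩ g

theorem exists_tsum_enorm_freqPiece_le (hρ : IsCutoff ρ) : ∃ C : NNReal, 0 < C ∧
    ∀ x : FreqSpace, ∑' n, ‖freqPiece ρ n x‖ₑ ≤ C * ‖x‖ₑ := by
  obtain ⟨C, hC0, hC⟩ := exists_sum_norm_piece_le hρ
  refine ⟨C, hC0, fun x => ?_⟩
  rw [ENNReal.tsum_eq_iSup_sum]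
  refine iSup_le fun F => ?_
  have h : ∑ n ∈ F, ‖freqPiece ρ n x‖ ≤ C * ‖x‖ := by
    refine denseRange_emb.induction_on (p := fun x => ∑ n ∈ F, ‖freqPiece ρ n x‖ ≤ C * ‖x‖) x
      (isClosed_le (by fun_prop) (by fun_prop)) fun g => ?_
    simp only [freqPiece_emb hρ]
    exact hC F g
  have h2 := ENNReal.ofReal_le_ofReal h
  rw [ENNReal.ofReal_sum_of_nonneg fun _ _ => norm_nonneg _, ENNReal.ofReal_mul C.coe_nonneg] at h2
  simpa using h2

theorem represents_freqPiece (hρ : IsCutoff ρ) (n : ℤ) (x : FreqSpace) :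
    Represents (freqPiece ρ n x) (freqProj ρ n (freqIncl x)) := by
  have h : freqProj ρ n (freqIncl x) = Lp.toTemperedDistribution (freqPiece ρ n x) := by
    refine eq_of_emb (F := fun x => TemperedDistribution.fourierMultiplierCLM ℂ
        (fun ξ => (sigma ρ n ξ : ℂ)) (freqIncl x))
      (G := fun x => Lp.toTemperedDistributionCLM ℂ volume 2 (freqPiece ρ n x))
      (by fun_prop) (by fun_prop) (fun g => ?_) x
    simp only [freqIncl_emb, freqPiece_emb hρ, Lp.toTemperedDistributionCLM_apply, piece_apply,
      Lp.toTemperedDistribution_toLp_eq]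
    rw [TemperedDistribution.fourierMultiplierCLM_toTemperedDistributionCLM_eq
      (hρ.hasTemperateGrowth_ofReal_sigma n), SchwartzMap.fourierMultiplierCLM_apply,
      FourierTransform.fourier_fourierInv_eq]
  rw [h]
  exact represents_toTemperedDistribution _

/-- The weighted sum of the norms of the pieces, which dominates the modulation and amalgam norms. -/
noncomputable def pieceSum (ρ : ℝ → ℝ) (s : ℝ) (x : FreqSpace) : ℝ≥0∞ :=
  ∑' n : ℤ, ENNReal.ofReal (intWeight s n) * ‖freqPiece ρ n x‖ₑ

theorem modulation_freqIncl_le (hρ : IsCutoff ρ) {q : ℝ≥0∞} (hq : 1 ≤ q) (s : ℝ) (x : FreqSpace) :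
    modulation ρ 2 q s (freqIncl x) ≤ pieceSum ρ s x := by
  have h (n : ℤ) : lpLine 2 (freqProj ρ n (freqIncl x)) ≤ ‖freqPiece ρ n x‖ₑ :=
    (iInf₂_le (freqPiece ρ n x : ℝ → ℂ) (represents_freqPiece hρ n x)).trans_eq
      (Lp.enorm_def _).symm
  refine eLpNorm_le_of_enorm_le_of_lintegral_le hq (Eventually.of_forall fun n => ?_) ?_
  · rw [enorm_eq_self]
    refine le_trans ?_ (ENNReal.le_tsum n)
    gcongr
    · exact le_rfl
    · exact h n
  · rw [lintegral_count]
    refine ENNReal.tsum_le_tsum fun n => ?_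
    rw [enorm_eq_self]
    gcongr
    · exact le_rfl
    · exact h n

/-- Minkowski's inequality for countable sums of nonnegative functions, in `L²`. -/
theorem eLpNorm_two_tsum_le {α ι : Type*} [Countable ι] [MeasurableSpace α] {μ : Measure α}
    {a : ι → α → ℝ≥0∞} (ha : ∀ n, AEMeasurable (a n) μ) :
    eLpNorm (fun x => ∑' n, a n x) 2 μ ≤ ∑' n, eLpNorm (a n) 2 μ := by
  have e (f : α → ℝ≥0∞) : eLpNorm f 2 μ = (∫⁻ x, f x ^ (2 : ℝ) ∂μ) ^ (1 / (2 : ℝ)) := by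
    rw [eLpNorm_eq_lintegral_rpow_enorm_toReal two_ne_zero ENNReal.ofNat_ne_top]
    simp
  have hmul (m n : ι) : ∫⁻ x, a m x * a n x ∂μ ≤ eLpNorm (a m) 2 μ * eLpNorm (a n) 2 μ := by
    rw [e, e]
    exact ENNReal.lintegral_mul_le_Lp_mul_Lq μ Real.HolderConjugate.two_two (ha m) (ha n)
  -- The square is expanded into a double sum and Cauchy–Schwarz is applied to each term.
  have key : ∫⁻ x, (∑' n, a n x) ^ (2 : ℝ) ∂μ ≤ (∑' n, eLpNorm (a n) 2 μ) ^ (2 : ℝ) := by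
    simp only [ENNReal.rpow_ofNat, sq, ← ENNReal.tsum_mul_right]
    have hs (m : ι) : AEMeasurable (fun x => a m x * ∑' n, a n x) μ :=
      (ha m).mul (AEMeasurable.tsum ha)
    rw [lintegral_tsum hs]
    refine ENNReal.tsum_le_tsum fun m => ?_
    simp only [← ENNReal.tsum_mul_left]
    have hp (n : ι) : AEMeasurable (fun x => a m x * a n x) μ := (ha m).mul (ha n)
    rw [lintegral_tsum hp]
    exact ENNReal.tsum_le_tsum fun n => hmul m n
  rw [e]
  refine (ENNReal.rpow_le_rpow key (by norm_num)).trans_eq ?_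
  rw [← ENNReal.rpow_mul]
  norm_num

/-- The `ℓ^q` norm is at most the `ℓ¹` norm at each point; Minkowski then exchanges the sum with the
`L²` norm. -/
theorem wienerAmalgam_freqIncl_le (hρ : IsCutoff ρ) {q : ℝ≥0∞} (hq : 1 ≤ q) (s : ℝ)
    (x : FreqSpace) : wienerAmalgam ρ 2 q s (freqIncl x) ≤ pieceSum ρ s x := by
  refine (iInf₂_le (fun n => (freqPiece ρ n x : ℝ → ℂ)) fun n => represents_freqPiece hρ n x).trans ?_
  calc _ ≤ eLpNorm (fun t => ∑' n : ℤ, ‖((intWeight s n : ℝ) : ℂ) * freqPiece ρ n x t‖ₑ) 2 volume := by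
        refine eLpNorm_mono_enorm fun t => ?_
        rw [enorm_eq_self, enorm_eq_self]
        refine eLpNorm_le_of_enorm_le_of_lintegral_le hq (Eventually.of_forall fun n => ?_) ?_
        · exact ENNReal.le_tsum (f := fun n : ℤ =>
            ‖((intWeight s n : ℝ) : ℂ) * freqPiece ρ n x t‖ₑ) n
        · rw [lintegral_count]
          rfl
    _ ≤ ∑' n : ℤ, eLpNorm (fun t => ‖((intWeight s n : ℝ) : ℂ) * freqPiece ρ n x t‖ₑ) 2 volume :=
        eLpNorm_two_tsum_le fun n =>
          (aestronglyMeasurable_const.mul (Lp.aestronglyMeasurable _)).enorm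
    _ = pieceSum ρ s x := by
        refine tsum_congr fun n => ?_
        rw [eLpNorm_enorm]
        have := eLpNorm_const_smul ((intWeight s n : ℝ) : ℂ) (freqPiece ρ n x : ℝ → ℂ) 2 volume
        refine Eq.trans this ?_
        rw [← Lp.enorm_def, ← ofReal_norm, Complex.norm_real,
          Real.norm_of_nonneg (intWeight_pos s n).le]

theorem exists_pieceSum_le (hρ : IsCutoff ρ) {s : ℝ} (hs : s ≤ 0) :
    ∃ C : NNReal, ∀ x : FreqSpace, pieceSum ρ s x ≤ C * ‖x‖ₑ := by
  obtain ⟨C, -, hC⟩ := exists_tsum_enorm_freqPiece_le hρ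
  refine ⟨C, fun x => le_trans (ENNReal.tsum_le_tsum fun n => ?_) (hC x)⟩
  refine mul_le_of_le_one_left' ?_
  exact ENNReal.ofReal_le_one.2 (intWeight_le_one hs n)

/-- High frequencies are small for `N`. -/
def HighFreqSmall (N : 𝓢'(ℝ, ℂ) → ℝ≥0∞) : Prop :=
  ∀ ε : NNReal, 0 < ε → ∃ A : ℝ, ∀ g : 𝓢(ℝ, ℂ), (∀ ξ, |ξ| < A → g ξ = 0) →
    N (freqIncl (emb g)) ≤ ε * ‖emb g‖ₑ

theorem tendsto_intWeight_atTop {s : ℝ} (hs : s < 0) :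
    Tendsto (fun r : ℝ => (1 + r) ^ s) atTop (𝓝 0) := by
  have := (tendsto_rpow_neg_atTop (neg_pos.2 hs)).comp (tendsto_atTop_add_const_left atTop 1 tendsto_id)
  rwa [neg_neg] at this

theorem exists_pieceSum_le_of_high (hρ : IsCutoff ρ) {s : ℝ} (hs : s < 0) (ε : NNReal) (hε : 0 < ε) :
    ∃ A : ℝ, ∀ g : 𝓢(ℝ, ℂ), (∀ ξ, |ξ| < A → g ξ = 0) → pieceSum ρ s (emb g) ≤ ε * ‖emb g‖ₑ := by
  obtain ⟨C, hC0, hC⟩ := exists_tsum_enorm_freqPiece_le hρ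
  have hε' : (0 : ℝ) < ε / C := by positivity
  obtain ⟨A, hA⟩ := ((tendsto_intWeight_atTop hs).eventually_lt_const hε').exists_forall_of_atTop
  -- The weight is small for `|n| ≥ A`. For `|n| < A` the function `σ_n` lives in `|ξ| < A + 1`,
  -- where `g` vanishes.
  refine ⟨A + 1, fun g hg => ?_⟩
  have key (n : ℤ) : ENNReal.ofReal (intWeight s n) * ‖freqPiece ρ n (emb g)‖ₑ ≤
      ((ε / C : NNReal) : ℝ≥0∞) * ‖freqPiece ρ n (emb g)‖ₑ := by
    rcases le_or_gt A |(n : ℝ)| with h | h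
    · gcongr
      rw [← ENNReal.ofReal_coe_nnreal]
      exact ENNReal.ofReal_le_ofReal (hA _ h).le
    · have h0 : SchwartzMap.smulLeftCLM ℂ (fun ξ => (sigma ρ n ξ : ℂ)) g = 0 := by
        ext ξ
        rw [SchwartzMap.smulLeftCLM_apply_apply (hρ.hasTemperateGrowth_ofReal_sigma n)]
        rcases lt_or_ge |ξ| (A + 1) with h' | h'
        · rw [hg ξ h', smul_zero]
          rfl
        · have : 1 ≤ |ξ - n| := by linarith [abs_sub_abs_le_abs_sub ξ n]
          rw [hρ.sigma_eq_zero this, Complex.ofReal_zero, zero_smul]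
          rfl
      have : freqPiece ρ n (emb g) = 0 := by
        rw [freqPiece_emb hρ, piece, LinearMap.comp_apply, LinearMap.comp_apply,
          ContinuousLinearMap.coe_coe (SchwartzMap.smulLeftCLM ℂ _), h0, map_zero, map_zero]
      simp [this]
  calc pieceSum ρ s (emb g) ≤ ∑' n, ((ε / C : NNReal) : ℝ≥0∞) * ‖freqPiece ρ n (emb g)‖ₑ :=
        ENNReal.tsum_le_tsum key
    _ ≤ ((ε / C : NNReal) : ℝ≥0∞) * (C * ‖emb g‖ₑ) := by
        rw [ENNReal.tsum_mul_left]
        gcongr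
        exact hC _
    _ = ε * ‖emb g‖ₑ := by
        rw [← mul_assoc, ← ENNReal.coe_mul, div_mul_cancel₀ _ hC0.ne']

theorem highFreqSmall_modulation (hρ : IsCutoff ρ) {q : ℝ≥0∞} (hq : 1 ≤ q) {s : ℝ} (hs : s < 0) :
    HighFreqSmall (modulation ρ 2 q s) := fun ε hε =>
  (exists_pieceSum_le_of_high hρ hs ε hε).imp fun _ hA g hg =>
    (modulation_freqIncl_le hρ hq s _).trans (hA g hg)

theorem highFreqSmall_wienerAmalgam (hρ : IsCutoff ρ) {q : ℝ≥0∞} (hq : 1 ≤ q) {s : ℝ} (hs : s < 0) :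
    HighFreqSmall (wienerAmalgam ρ 2 q s) := fun ε hε =>
  (exists_pieceSum_le_of_high hρ hs ε hε).imp fun _ hA g hg =>
    (wienerAmalgam_freqIncl_le hρ hq s _).trans (hA g hg)

theorem boundedInto_modulation (hρ : IsCutoff ρ) {q : ℝ≥0∞} (hq : 1 ≤ q) {s : ℝ} (hs : s ≤ 0) :
    BoundedInto (modulation ρ 2 q s) freqIncl.toLinearMap :=
  (exists_pieceSum_le hρ hs).imp fun _ hC x => (modulation_freqIncl_le hρ hq s x).trans (hC x)

theorem boundedInto_wienerAmalgam (hρ : IsCutoff ρ) {q : ℝ≥0∞} (hq : 1 ≤ q) {s : ℝ} (hs : s ≤ 0) :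
    BoundedInto (wienerAmalgam ρ 2 q s) freqIncl.toLinearMap :=
  (exists_pieceSum_le hρ hs).imp fun _ hC x => (wienerAmalgam_freqIncl_le hρ hq s x).trans (hC x)

theorem boundedInto_flLine {q : ℝ≥0∞} (hq : 1 ≤ q) {s : ℝ} (hs : s ≤ 0) :
    BoundedInto (flLine q s) freqIncl.toLinearMap := by
  have : Fact (1 ≤ q) := ⟨hq⟩
  refine ⟨1, fun x => (iInf₂_le (freqToLp q x : ℝ → ℂ) (represents_freqToLp x)).trans ?_⟩
  rw [ENNReal.coe_one, one_mul]
  refine (eLpNorm_mono_enorm fun ξ => enorm_bracket_rpow_mul_le ξ hs _).trans ?_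
  rw [← Lp.enorm_def]
  exact enorm_le_iff_norm_le.2 (norm_freqToLp_le x)

theorem highFreqSmall_flLine {q : ℝ≥0∞} (hq : 1 ≤ q) {s : ℝ} (hs : s < 0) :
    HighFreqSmall (flLine q s) := by
  intro ε hε
  have h := (tendsto_rpow_neg_atTop (neg_pos.2 hs)).eventually_lt_const (NNReal.coe_pos.2 hε)
  rw [neg_neg] at h
  obtain ⟨A, hA⟩ := h.exists_forall_of_atTop
  refine ⟨A, fun g hg => ?_⟩
  refine (iInf₂_le (g : ℝ → ℂ) (by rw [fourier_freqIncl_emb]; exact represents_schwartz g)).trans ?_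
  refine le_trans ?_ (mul_le_mul_right (eLpNorm_le_enorm_emb hq g) _)
  refine eLpNorm_le_nnreal_smul_eLpNorm_of_ae_le_mul (Eventually.of_forall fun ξ => ?_) q
  rw [← NNReal.coe_le_coe, NNReal.coe_mul, coe_nnnorm, coe_nnnorm, norm_mul, Complex.norm_real,
    Real.norm_of_nonneg (bracket_rpow_pos ξ s).le]
  rcases lt_or_ge |ξ| A with h | h
  · simp [hg ξ h]
  · gcongr
    exact (hA _ (h.trans (abs_le_bracket ξ))).le

end Pieces

/-! ### Resonance and norm inflation on the line -/

section LineInflation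

/-- Translation of Schwartz functions. -/
noncomputable abbrev translate (a : ℝ) : 𝓢(ℝ, ℂ) →L[ℂ] 𝓢(ℝ, ℂ) :=
  SchwartzMap.compSubConstCLM ℂ a

theorem norm_emb_translate (a : ℝ) (g : 𝓢(ℝ, ℂ)) : ‖emb (translate a g)‖ = ‖emb g‖ := by
  have e : (translate a g : ℝ → ℂ) = fun x => g (x - a) := by
    funext x
    rw [SchwartzMap.compSubConstCLM_apply]
  rw [norm_emb, norm_emb, e]
  simp only [deriv_comp_sub_const]
  rw [integral_sub_right_eq_self (fun x => ‖g x‖) a,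
    integral_sub_right_eq_self (fun x => ‖deriv g x‖) a]

theorem fourierInv_translate (a : ℝ) (g : 𝓢(ℝ, ℂ)) (t : ℝ) :
    𝓕⁻ (translate a g) t = (Real.fourierChar (a * t) : ℂ) * 𝓕⁻ g t := by
  rw [SchwartzMap.fourierInv_coe, SchwartzMap.fourierInv_coe, Real.fourierInv_eq, Real.fourierInv_eq,
    ← integral_const_mul,
    ← integral_sub_right_eq_self (fun v => (Real.fourierChar (a * t) : ℂ) *
      (Real.fourierChar (inner ℝ v t) • g v)) a]
  congr 1
  funext v
  rw [SchwartzMap.compSubConstCLM_apply, Circle.smul_def, Circle.smul_def, smul_eq_mul, smul_eq_mul,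
    ← mul_assoc, ← Circle.coe_mul, ← AddChar.map_add_eq_mul]
  congr 3
  simp
  ring

/-- Translation preserves the norm of the model space and carries the compact support off to
infinity. -/
theorem HighFreqSmall.tendsto_translate {N : 𝓢'(ℝ, ℂ) → ℝ≥0∞} (hN : HighFreqSmall N)
    {g : 𝓢(ℝ, ℂ)} (hg : HasCompactSupport g) {c : ℝ} (hc : c ≠ 0) :
    Tendsto (fun n : ℕ => N (freqIncl (emb (translate (c * n) g)))) atTop (𝓝 0) := by
  rw [ENNReal.tendsto_nhds_zero]
  intro ε hε
  obtain ⟨δ, hδ, hδε⟩ := ENNReal.exists_nnreal_pos_mul_lt (enorm_ne_top (x := emb g)) hε.ne'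
  obtain ⟨A, hA⟩ := hN δ hδ
  obtain ⟨R, hR⟩ := hg.isCompact.isBounded.subset_closedBall 0
  have ht : Tendsto (fun n : ℕ => |c * n|) atTop atTop := by
    simp only [abs_mul, Nat.abs_cast]
    exact tendsto_natCast_atTop_atTop.const_mul_atTop (abs_pos.2 hc)
  filter_upwards [ht.eventually_ge_atTop (A + R + 1)] with n hn
  have h1 := hA (translate (c * n) g) fun ξ hξ => by
    rw [SchwartzMap.compSubConstCLM_apply]
    by_contra h
    have h2 := hR (subset_tsupport _ h)
    rw [mem_closedBall_zero_iff, Real.norm_eq_abs] at h2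
    have h3 := abs_sub_abs_le_abs_sub (c * n) ξ
    rw [abs_sub_comm] at h3
    linarith
  refine h1.trans ?_
  rw [← ofReal_norm, norm_emb_translate, ofReal_norm]
  exact hδε.le

/-- The Riemann–Lebesgue lemma. For non-integrable `W` the integrals are zero by convention. -/
theorem tendsto_integral_fourierChar_mul (W : ℝ → ℂ) {c : ℝ} (hc : c ≠ 0) :
    Tendsto (fun n : ℕ => ∫ t, (Real.fourierChar (c * n * t) : ℂ) * W t) atTop (𝓝 0) := by
  have ht : Tendsto (fun n : ℕ => -(c * n)) atTop (cocompact ℝ) := by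
    rw [← Metric.cobounded_eq_cocompact, ← tendsto_norm_atTop_iff_cobounded]
    simp only [norm_neg, norm_mul, Real.norm_eq_abs, Nat.abs_cast]
    exact tendsto_natCast_atTop_atTop.const_mul_atTop (abs_pos.2 hc)
  refine ((Real.tendsto_integral_exp_smul_cocompact W).comp ht).congr fun n => ?_
  simp only [Function.comp]
  congr 1
  funext t
  rw [Circle.smul_def, smul_eq_mul]
  congr 3
  ring

theorem exists_emb_eq_bilinPow (n : ℕ) (g : 𝓢(ℝ, ℂ)) :
    ∃ h, emb h = bilinPow freqConv n (emb g) := by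
  induction n with
  | zero => exact ⟨g, rfl⟩
  | succ n ih =>
    obtain ⟨h, hh⟩ := ih
    exact ⟨schwartzConv g h, by rw [bilinPow_succ, ← hh, freqConv_emb]⟩

/-- Two bumps at high frequencies whose `k`-fold sums contain the origin. -/
noncomputable def resonantBumps (k : ℕ) (Γ : 𝓢(ℝ, ℂ)) (n : ℕ) : FreqSpace :=
  emb (translate (1 * n) Γ) + emb (translate (-(k - 1) * n) Γ)

theorem freqFun_resonantBumps (k : ℕ) (Γ : 𝓢(ℝ, ℂ)) (n : ℕ) (t : ℝ) :
    freqFun (resonantBumps k Γ n) t = ((Real.fourierChar (1 * n * t) : ℂ) +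
      Real.fourierChar (-(k - 1) * n * t)) * 𝓕⁻ Γ t := by
  rw [resonantBumps, map_add, BoundedContinuousFunction.coe_add, Pi.add_apply, freqFun_emb,
    freqFun_emb, fourierInv_translate, fourierInv_translate, add_mul]

theorem integrable_fourierChar_mul {W : ℝ → ℂ} (hW : Integrable W) (c : ℝ) :
    Integrable fun t => (Real.fourierChar (c * t) : ℂ) * W t := by
  refine hW.bdd_mul (c := 1) (Continuous.aestronglyMeasurable (by fun_prop))
    (Eventually.of_forall fun t => ?_)
  rw [Circle.norm_coe]

theorem tendsto_integral_resonantBumps {k : ℕ} (hk : 2 ≤ k) {W : ℝ → ℂ} (hW : Integrable W) :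
    Tendsto (fun n : ℕ => ∫ t, ((Real.fourierChar (1 * n * t) : ℂ) +
      Real.fourierChar (-(k - 1) * n * t)) ^ k * W t) atTop (𝓝 (k * ∫ t, W t)) := by
  -- The `j`-th binomial term oscillates with phase `c j * n * t`, and `c j = k (1 - r)` for `r = k
  -- - j`. Only `r = 1` is stationary, with weight `k`; the other terms vanish in the limit.
  let c (j : ℕ) : ℝ := j - (k - j : ℕ) * (k - 1)
  have hexp (n : ℕ) (t : ℝ) : ((Real.fourierChar (1 * n * t) : ℂ) +
      Real.fourierChar (-(k - 1) * n * t)) ^ k * W t =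
      ∑ j ∈ Finset.range (k + 1), (k.choose j : ℂ) * ((Real.fourierChar (c j * n * t) : ℂ) * W t) := by
    rw [add_pow, Finset.sum_mul]
    refine Finset.sum_congr rfl fun j _ => ?_
    rw [← Circle.coe_pow, ← Circle.coe_pow, ← Circle.coe_mul, ← AddChar.map_nsmul_eq_pow,
      ← AddChar.map_nsmul_eq_pow, ← AddChar.map_add_eq_mul]
    have : j • (1 * n * t) + (k - j) • (-(k - 1) * n * t) = c j * n * t := by
      simp only [nsmul_eq_mul, c]
      ring
    rw [this]
    ring
  have hint (n j : ℕ) : Integrable fun t =>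
      (k.choose j : ℂ) * ((Real.fourierChar (c j * n * t) : ℂ) * W t) :=
    (integrable_fourierChar_mul hW _).const_mul _
  have hlim (j : ℕ) (hj : j ∈ Finset.range (k + 1)) : Tendsto (fun n : ℕ =>
      (k.choose j : ℂ) * ∫ t, (Real.fourierChar (c j * n * t) : ℂ) * W t) atTop
      (𝓝 (if j = k - 1 then k * ∫ t, W t else 0)) := by
    have hj : j ≤ k := Nat.lt_succ_iff.1 (Finset.mem_range.1 hj)
    obtain ⟨r, hr⟩ := Nat.exists_eq_add_of_le hj
    have hcj : c j = k * (1 - r) := by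
      simp only [c]
      rw [hr, Nat.add_sub_cancel_left]
      push_cast
      ring
    split_ifs with h
    · have hr1 : r = 1 := by omega
      have hc0 : c j = 0 := by rw [hcj, hr1]; simp
      have hch : k.choose j = k := by rw [h, Nat.choose_symm (by omega : 1 ≤ k), Nat.choose_one_right]
      simp only [hc0, hch, zero_mul, AddChar.map_zero_eq_one, Circle.coe_one, one_mul]
      exact tendsto_const_nhds
    · have hc0 : c j ≠ 0 := by
        rw [hcj]
        have h1 : (k : ℝ) ≠ 0 := by exact_mod_cast (by omega : k ≠ 0)
        have h2 : (1 : ℝ) - r ≠ 0 := by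
          rw [sub_ne_zero]
          exact_mod_cast (by omega : 1 ≠ r)
        exact mul_ne_zero h1 h2
      simpa using (tendsto_integral_fourierChar_mul W hc0).const_mul (k.choose j : ℂ)
  have h := tendsto_finsetSum _ hlim
  rw [Finset.sum_ite_eq', if_pos (Finset.mem_range.2 (by omega))] at h
  refine h.congr fun n => ?_
  simp only [hexp]
  rw [integral_finsetSum _ fun j _ => hint n j]
  exact Finset.sum_congr rfl fun j _ => (integral_const_mul _ _).symm

/-- The distribution `f` is tested through its Fourier transform. -/
noncomputable def fourierTest (χ : 𝓢(ℝ, ℂ)) : FreqSpace →L[ℂ] ℂ :=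
  PointwiseConvergenceCLM.evalCLM _ _ χ ∘L FourierTransform.fourierCLM ℂ 𝓢'(ℝ, ℂ) ∘L freqIncl

theorem fourierTest_apply (χ : 𝓢(ℝ, ℂ)) (x : FreqSpace) :
    fourierTest χ x = 𝓕 (freqIncl x) χ := rfl

theorem fourierTest_eq_integral (χ : 𝓢(ℝ, ℂ)) (x : FreqSpace) :
    fourierTest χ x = ∫ t, 𝓕 χ t * freqFun x t := by
  rw [fourierTest_apply, TemperedDistribution.fourier_apply, (represents_freqFun x _).2]

theorem fourierTest_freqMultiplier (χ : 𝓢(ℝ, ℂ)) (x : FreqSpace) :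
    fourierTest χ (freqMultiplier x) =
      fourierTest (SchwartzMap.smulLeftCLM ℂ (fun ξ => (symbol ξ : ℂ)) χ) x :=
  fourier_freqIncl_freqMultiplier x χ

theorem tendsto_fourierTest_resonantBumps {k : ℕ} (hk : 2 ≤ k) (Γ χ : 𝓢(ℝ, ℂ)) :
    Tendsto (fun n => fourierTest χ (resonantBumps k Γ n)) atTop (𝓝 0) := by
  have hk1 : -((k : ℝ) - 1) ≠ 0 := by
    have : (2 : ℝ) ≤ k := by exact_mod_cast hk
    linarith
  have hW := integrable_schwartz_mul_bounded (𝓕 χ) (freqFun (emb Γ))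
  have h := (tendsto_integral_fourierChar_mul (fun t => 𝓕 χ t * freqFun (emb Γ) t)
    one_ne_zero).add (tendsto_integral_fourierChar_mul (fun t => 𝓕 χ t * freqFun (emb Γ) t) hk1)
  rw [add_zero] at h
  refine h.congr fun n => ?_
  rw [fourierTest_eq_integral, ← integral_add (integrable_fourierChar_mul hW _)
    (integrable_fourierChar_mul hW _)]
  congr 1
  funext t
  rw [freqFun_resonantBumps, freqFun_emb]
  ring

theorem tendsto_fourierTest_freqMultiplier_bilinPow {k : ℕ} (hk : 2 ≤ k) (Γ χ H : 𝓢(ℝ, ℂ))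
    (hH : emb H = bilinPow freqConv (k - 1) (emb Γ)) :
    Tendsto (fun n => fourierTest χ
      (freqMultiplier (bilinPow freqConv (k - 1) (resonantBumps k Γ n)))) atTop
      (𝓝 (k * ∫ ξ, (symbol ξ : ℂ) * χ ξ * H ξ)) := by
  set ψ := SchwartzMap.smulLeftCLM ℂ (fun ξ => (symbol ξ : ℂ)) χ with hψ
  have hW := integrable_schwartz_mul_bounded (𝓕 ψ) (freqFun (emb H))
  have h := tendsto_integral_resonantBumps hk hW
  have hpow (x : FreqSpace) (t : ℝ) : freqFun (bilinPow freqConv (k - 1) x) t = freqFun x t ^ k := by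
    rw [freqFun_bilinPow, Nat.sub_add_cancel (by omega)]
  -- The Fourier transform is moved from `ψ` onto `𝓕⁻ H`.
  have e : ∫ t, 𝓕 ψ t * freqFun (emb H) t = ∫ ξ, (symbol ξ : ℂ) * χ ξ * H ξ := by
    simp only [freqFun_emb]
    have h := SchwartzMap.integral_fourier_mul_eq ψ (𝓕⁻ H)
    rw [FourierTransform.fourier_fourierInv_eq] at h
    rw [h]
    simp only [hψ, SchwartzMap.smulLeftCLM_apply_apply hasTemperateGrowth_ofReal_symbol, smul_eq_mul]
  rw [e] at h
  refine h.congr fun n => ?_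
  rw [fourierTest_freqMultiplier, fourierTest_eq_integral]
  congr 1
  funext t
  rw [hpow, hH, hpow, freqFun_resonantBumps, freqFun_emb, mul_pow]
  ring

/-- The complex conjugate of a Schwartz function. -/
noncomputable def schwartzConj (H : 𝓢(ℝ, ℂ)) : 𝓢(ℝ, ℂ) :=
  SchwartzMap.postcompCLM (𝕜 := ℝ) (Complex.conjCLE : ℂ →L[ℝ] ℂ) H

theorem schwartzConj_apply (H : 𝓢(ℝ, ℂ)) (ξ : ℝ) : schwartzConj H ξ = starRingEnd ℂ (H ξ) := rfl

/-- Testing `H` against its own conjugate makes the integrand `symbol * σ_n * |H|²`, which is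
nonnegative. It is positive at a point `ξ₀ ≠ 0` with `H ξ₀ ≠ 0` if `n` is the integer nearest to
`ξ₀`; the origin is avoided because `symbol` vanishes there. -/
theorem exists_integral_symbol_sigma_ne_zero {ρ : ℝ → ℝ} (hρ : IsCutoff ρ) {H : 𝓢(ℝ, ℂ)}
    (hH : H ≠ 0) : ∃ n : ℤ, ∫ ξ, (symbol ξ : ℂ) *
      SchwartzMap.smulLeftCLM ℂ (fun ξ => (sigma ρ n ξ : ℂ)) (schwartzConj H) ξ * H ξ ≠ 0 := by
  obtain ⟨ξ₀, hξ₀, hξH⟩ : ∃ ξ : ℝ, ξ ≠ 0 ∧ H ξ ≠ 0 := by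
    obtain ⟨ξ₁, h₁⟩ : ∃ ξ, H ξ ≠ 0 := by
      by_contra! h
      exact hH (SchwartzMap.ext h)
    have ho : IsOpen {ξ | H ξ ≠ 0} := isOpen_ne_fun H.continuous continuous_const
    obtain ⟨ξ, h, h'⟩ := (dense_compl_singleton (0 : ℝ)).inter_open_nonempty _ ho ⟨ξ₁, h₁⟩
    exact ⟨ξ, h', h⟩
  have hsym : Continuous symbol := hasTemperateGrowth_symbol.1.continuous
  refine ⟨round ξ₀, ?_⟩
  have e (ξ : ℝ) : (symbol ξ : ℂ) * SchwartzMap.smulLeftCLM ℂ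
      (fun ξ => (sigma ρ (round ξ₀) ξ : ℂ)) (schwartzConj H) ξ * H ξ =
      ((symbol ξ * sigma ρ (round ξ₀) ξ * ‖H ξ‖ ^ 2 : ℝ) : ℂ) := by
    rw [SchwartzMap.smulLeftCLM_apply_apply (hρ.hasTemperateGrowth_ofReal_sigma _),
      schwartzConj_apply, smul_eq_mul]
    push_cast
    rw [← Complex.conj_mul']
    ring
  simp only [e]
  rw [integral_complex_ofReal, Complex.ofReal_ne_zero]
  refine (Continuous.integral_pos_of_hasCompactSupport_nonneg_nonzero (x := ξ₀) ?_ ?_ ?_ ?_).ne'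
  · exact (hsym.mul (hρ.contDiff_sigma _).continuous).mul (H.continuous.norm.pow 2)
  · exact ((hρ.hasCompactSupport_sigma _).mul_left).mul_right
  · intro ξ
    exact mul_nonneg (mul_nonneg (symbol_nonneg ξ) (hρ.sigma_mem_Icc _ ξ).1) (sq_nonneg _)
  · exact mul_ne_zero (mul_ne_zero (symbol_pos hξ₀).ne' (hρ.sigma_round_pos ξ₀).ne')
      (pow_ne_zero 2 (norm_ne_zero_iff.2 hξH))

theorem exists_schwartz_bump : ∃ Γ : 𝓢(ℝ, ℂ), HasCompactSupport Γ ∧ Γ ≠ 0 := by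
  let b : ContDiffBump (0 : ℝ) := ⟨1, 2, one_pos, one_lt_two⟩
  have hc : HasCompactSupport fun x => (b x : ℂ) :=
    b.hasCompactSupport.comp_left (g := fun y : ℝ => (y : ℂ)) rfl
  have hd : ContDiff ℝ ∞ fun x => (b x : ℂ) := Complex.ofRealCLM.contDiff.comp b.contDiff
  refine ⟨hc.toSchwartzMap hd, hc, fun h => ?_⟩
  have h0 : (b 0 : ℂ) = 0 := DFunLike.congr_fun h 0
  rw [b.one_of_mem_closedBall (Metric.mem_closedBall_self zero_le_one)] at h0
  simp at h0

/-- The three scales on the line share the model space, the perturbations and the functional. The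
test function contains a factor `σ_n`, so that a single piece `P_n` controls the pairing. -/
theorem normInflationLine_of_highFreqSmall {ρ : ℝ → ℝ} (hρ : IsCutoff ρ)
    {Z : ℝ → 𝓢'(ℝ, ℂ) → ℝ≥0∞} {k : ℕ} (hk : 2 ≤ k) {s θ : ℝ}
    (hZ : BoundedInto (Z s) freqIncl.toLinearMap)
    (hZadd : ∀ f g, Z s (f + g) ≤ Z s f + Z s g) (hZneg : ∀ f, Z s (-f) = Z s f)
    (hsmall : HighFreqSmall (Z s))
    (hΛ : ∀ (n : ℤ) (χ : 𝓢(ℝ, ℂ)), ∃ C : NNReal, ∀ f : 𝓢'(ℝ, ℂ),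
      ‖(𝓕 f) (SchwartzMap.smulLeftCLM ℂ (fun ξ => (sigma ρ n ξ : ℂ)) χ)‖ₑ ≤ C * Z θ f) :
    NormInflationLine Z k s θ := by
  obtain ⟨Γ, hΓc, hΓ⟩ := exists_schwartz_bump
  obtain ⟨H, hH⟩ := exists_emb_eq_bilinPow (k - 1) Γ
  -- `H` is the `k`-fold convolution of `Γ`, the profile left at low frequency. It is nonzero
  -- because its inverse transform is the `k`-th power of that of `Γ`.
  have hHpow (t : ℝ) : 𝓕⁻ H t = 𝓕⁻ Γ t ^ k := by
    rw [← freqFun_emb, hH, freqFun_bilinPow, Nat.sub_add_cancel (by omega), freqFun_emb]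
  have hH0 : H ≠ 0 := by
    rintro rfl
    have h0 : 𝓕⁻ (0 : 𝓢(ℝ, ℂ)) = 0 := (FourierTransform.fourierInvCLM ℂ 𝓢(ℝ, ℂ)).map_zero
    have h1 : 𝓕⁻ Γ = 0 := by
      ext t
      have h := hHpow t
      rw [h0] at h
      exact (pow_eq_zero_iff (by omega : k ≠ 0)).1 h.symm
    refine hΓ ?_
    rw [← FourierTransform.fourier_fourierInv_eq (F := 𝓢(ℝ, ℂ)) Γ, h1]
    exact (FourierTransform.fourierCLM ℂ 𝓢(ℝ, ℂ)).map_zero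
  obtain ⟨n₀, hn₀⟩ := exists_integral_symbol_sigma_ne_zero hρ hH0
  set χ := SchwartzMap.smulLeftCLM ℂ (fun ξ => (sigma ρ n₀ ξ : ℂ)) (schwartzConj H) with hχ
  refine normInflation_of_model hk freqIncl.toLinearMap (bilinPow freqConv (k - 1)) freqMultiplier
    (fourierTest χ) (resonantBumps k Γ) (K := k) (c := ‖emb Γ‖ + ‖emb Γ‖)
    (γ := k * ∫ ξ, (symbol ξ : ℂ) * χ ξ * H ξ) dxxLine_add (boundedInto_flLine le_rfl le_rfl) hZ
    densePreimage_freqIncl exists_freqIncl_eq_of_mem_testLine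
    (isPowLine_bilinPow (by omega)) freqIncl_freqMultiplier_sub_dxxLine hZadd hZneg ?_ ?_ ?_ ?_
    (fun n => ?_) (fun a => ?_) (tendsto_fourierTest_resonantBumps hk Γ χ) ?_
    (tendsto_fourierTest_freqMultiplier_bilinPow hk Γ χ H hH)
  · obtain ⟨C, hC⟩ := hΛ n₀ (schwartzConj H)
    exact ⟨C, fun x => hC _⟩
  · refine norm_le_zero_iff.1 ((norm_bilinPow_le norm_freqConv_le (k - 1) 0).trans_eq ?_)
    simp
  · intro R x y hx hy
    have := norm_bilinPow_sub_le norm_freqConv_le (k - 1) hx hy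
    rwa [Nat.cast_sub (by omega), Nat.cast_one, sub_add_cancel] at this
  · intro a x
    have := bilinPow_smul (B := freqConv) (k - 1) a x
    rwa [Nat.sub_add_cancel (by omega)] at this
  · refine (norm_add_le _ _).trans_eq ?_
    rw [norm_emb_translate, norm_emb_translate]
  · have hk1 : -((k : ℝ) - 1) ≠ 0 := by
      have : (2 : ℝ) ≤ k := by exact_mod_cast hk
      linarith
    have hc : HasCompactSupport (a • Γ : 𝓢(ℝ, ℂ)) :=
      hΓc.comp_left (g := fun z : ℂ => a * z) (mul_zero a)
    have h := (hsmall.tendsto_translate hc one_ne_zero).add (hsmall.tendsto_translate hc hk1)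
    rw [add_zero] at h
    refine tendsto_of_tendsto_of_tendsto_of_le_of_le tendsto_const_nhds h (fun _ => zero_le)
      fun n => ?_
    refine le_trans (le_of_eq ?_) (hZadd _ _)
    rw [resonantBumps, smul_add, map_add]
    simp only [map_smul]
    rfl
  · exact mul_ne_zero (by exact_mod_cast (by omega : k ≠ 0)) hn₀

end LineInflation

end GIBq

theorem mainTheorem4 (k : ℕ) (hk : 2 ≤ k) (s θ : ℝ) (hs : s < 0) (q : ℝ≥0∞) (hq : 1 ≤ q)
    (ρ : ℝ → ℝ) (hρ : GIBq.IsCutoff ρ) :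
    GIBq.NormInflationLine (GIBq.flLine q) k s θ ∧
    GIBq.NormInflationCircle (GIBq.flCircle q) k s θ ∧
    GIBq.NormInflationLine (GIBq.modulation ρ 2 q) k s θ ∧
    GIBq.NormInflationLine (GIBq.wienerAmalgam ρ 2 q) k s θ :=
  ⟨GIBq.normInflationLine_of_highFreqSmall hρ hk (GIBq.boundedInto_flLine hq hs.le)
      (GIBq.flLine_add hq s) (GIBq.flLine_neg q s) (GIBq.highFreqSmall_flLine hq hs)
      -- For this scale every Schwartz test function is admissible, and `σ_n χ` is simply one of
      -- them.
      fun _ _ => GIBq.exists_enorm_fourier_le_flLine hq θ _,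
    GIBq.normInflationCircle_flCircle hk hs hq,
    GIBq.normInflationLine_of_highFreqSmall hρ hk (GIBq.boundedInto_modulation hρ hq hs.le)
      (GIBq.modulation_add 2 q one_le_two hq s) (GIBq.modulation_neg 2 q s)
      (GIBq.highFreqSmall_modulation hρ hq hs)
      fun n χ => GIBq.exists_enorm_fourier_le_modulation one_le_two hq θ n χ,
    GIBq.normInflationLine_of_highFreqSmall hρ hk (GIBq.boundedInto_wienerAmalgam hρ hq hs.le)
      (GIBq.wienerAmalgam_add 2 q one_le_two hq s) (GIBq.wienerAmalgam_neg 2 q s)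
      (GIBq.highFreqSmall_wienerAmalgam hρ hq hs)
      fun n χ => GIBq.exists_enorm_fourier_le_wienerAmalgam one_le_two hq θ n χ⟩
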